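/- **Theorem 3.2.** Let $K$ be a field and let $H=\bigoplus_{n\ge 0}H_n$ and $B=\bigoplus_{n\ge 0}B_n$ be graded Hopf algebras over $K$, that is, Hopf algebras with vector space decompositions such that (and likewise for $B$) $H_nH_m\subseteq H_{n+m}$, $1\in H_0$, $S(H_n)\subseteq H_n$, $\Delta(H_n)\subseteq\sum_{i+j=n}H_i\otimes H_j$, and $\varepsilon(H_n)=0$ for $n>0$. Assume that $H$ is generated as an algebra by $H_0$ and $H_1$, and $B$ by $B_0$ and $B_1$. Assume further that there is a bilinear map $\psi:H\times B\to K$ which is * a Hopf pairing: $\psi(1,b)=\varepsilon(b)$, $\psi(h,1)=\varepsilon(h)$, $\psi(h,bc)=\sum\psi(h_1,b)\psi(h_2,c)$, $\psi(hg,b)=\sum\psi(h,b_1)\psi(g,b_2)$ and $\psi(S(h),b)=\psi(h,S(b))$ for all $h,g\in H$, $b,c\in B$; * graded: $\psi(H_i,B_j)=0$ for $i\ne j$; * two-sided non-degenerate: $\psi(h,B)=0$ implies $h=0$, and $\psi(H,b)=0$ implies $b=0$. Then the canonical maps $j_H:H\to S_{H_0}(H_1)$ and $j_B:B\to S_{B_0}(B_1)$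 are isomorphisms of graded Hopf algebras. Here $H_0$ is a Hopf subalgebra of $H$, and $H_1$ is an $H_0$-Hopf bimodule, with the actions given by multiplication in $H$ and the coactions $\rho_l:H_1\to H_0\otimes H_1$, $\rho_r:H_1\to H_1\otimes H_0$ determined by $\Delta(m)=\rho_l(m)+\rho_r(m)$. For a Hopf algebra $A$ and an $A$-Hopf bimodule $M$, the cotensor Hopf algebra $\mathrm{Cot}_A(M)=A\oplus M\oplus(M\square_A M)\oplus\cdots$ has the comultiplication given by $\Delta_A$ on $A$ and, on $M^{\square n}$ with $n\geq 1$, by the sum of the left coaction on the first factor, deconcatenation, and the right coaction on the last factor; its counit is $\varepsilon_A$ on $A$ and $0$ on $M^{\square n}$, $n\geq 1$; its unit is $1_A$; and its multiplication is the unique graded coalgebra map $\mathrm{Cot}_A(M)\otimes \mathrm{Cot}_A(M)\to\mathrm{Cot}_A(M)$ that is the multiplication of $A$ on $A\otimes A$ and is $a\otimes n+n'\otimes a'\mapsto a.n+n'.a'$ on $(A\otimes M)\oplus(M\otimes A)$. The quantum symmetric algebra $S_A(M)$ is the graded Hopf subalgebra of $\mathrm{Cot}_A(M)$ generated as an algebra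 by $A$ and $M$. The map $j_H$ is the unique morphism of graded Hopf algebras $H\to S_{H_0}(H_1)$ whose restriction to $H_0\oplus H_1$ is the identity; $j_B$ is defined in the same way. (The existence and uniqueness of $j_H$ and $j_B$ are part of the claim.) -/

import Mathlib

/-
Overview of the definitions.
* `HopfBimodule K H M`: Hopf bimodules; `(H, M)` is then a couple.
* `HopfBimodule.Cot`: the cotensor coalgebra `H + M + M □ M + ...`, realised inside `H × T(M)` as
  the pairs `(h, x)` where `x` has no scalar part and satisfies all cotensor conditions
  (`cotSubmodule`); its comultiplication is the restriction of `ambComul`.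
* `cotLift`, `cot_hom_ext`: existence and uniqueness of coalgebra maps into the cotensor coalgebra.
* `HopfBimodule.cotMul` and the `Ring`, `Algebra`, `Bialgebra` instances on `Cot`.
* `HopfBimodule.QSym`: the subalgebra of `Cot` generated by `H` and `M`, with its `Bialgebra` and
  `HopfAlgebra` instances and its degree parts `qsymGr`.
* `GradedHopf`, `Deg0`, `couple`: graded Hopf algebras and the associated couple `(H₀, H₁)`.
* `IsHopfPairing`, `IsGradedPairing`, `IsCanonicalMap`.
The remaining declarations are the proofs that these structures satisfy their axioms.
-/
open scoped TensorProduct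

noncomputable section

namespace QuantumSymm

set_option linter.unusedSectionVars false
set_option linter.unusedSimpArgs false

/-- A Hopf bimodule `M` over a Hopf algebra `H`: an `H`-bimodule and `H`-bicomodule such that
`ρ_l(h.m.h') = ∑ h₁ m₋₁ h'₁ ⊗ h₂.m₀.h'₂` and `ρ_r(h.m.h') = ∑ h₁.m₀.h'₁ ⊗ h₂ m₁ h'₂`.
The pair `(H, M)` is called a couple. -/
structure HopfBimodule (K H M : Type*) [Field K] [Ring H] [HopfAlgebra K H]
    [AddCommGroup M] [Module K M] where
  /-- the left action `h.m` -/
  lact : H →ₗ[K] M →ₗ[K] M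
  /-- the right action `m.h` -/
  ract : M →ₗ[K] H →ₗ[K] M
  /-- the left coaction `ρ_l` -/
  lcoact : M →ₗ[K] H ⊗[K] M
  /-- the right coaction `ρ_r` -/
  rcoact : M →ₗ[K] M ⊗[K] H
  one_lact : ∀ m, lact 1 m = m
  mul_lact : ∀ g h m, lact (g * h) m = lact g (lact h m)
  ract_one : ∀ m, ract m 1 = m
  ract_mul : ∀ m g h, ract m (g * h) = ract (ract m g) h
  lact_ract : ∀ h m g, ract (lact h m) g = lact h (ract m g)
  lcoact_counit : ∀ m, TensorProduct.lid K M ((Coalgebra.counit (R := K)).rTensor M (lcoact m)) = m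
  rcoact_counit : ∀ m, TensorProduct.rid K M ((Coalgebra.counit (R := K)).lTensor M (rcoact m)) = m
  lcoact_coassoc : ∀ m, TensorProduct.assoc K H H M
    ((Coalgebra.comul (R := K)).rTensor M (lcoact m)) = lcoact.lTensor H (lcoact m)
  rcoact_coassoc : ∀ m, TensorProduct.assoc K M H H (rcoact.rTensor H (rcoact m)) =
    (Coalgebra.comul (R := K)).lTensor M (rcoact m)
  lcoact_rcoact : ∀ m, TensorProduct.assoc K H M H (lcoact.rTensor H (rcoact m)) =
    rcoact.lTensor H (lcoact m)
  lcoact_act : ∀ h m g, lcoact (ract (lact h m) g) =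
    TensorProduct.map₂ (LinearMap.mul K H) ract
      (TensorProduct.map₂ (LinearMap.mul K H) lact (Coalgebra.comul (R := K) h) (lcoact m))
      (Coalgebra.comul (R := K) g)
  rcoact_act : ∀ h m g, rcoact (ract (lact h m) g) =
    TensorProduct.map₂ ract (LinearMap.mul K H)
      (TensorProduct.map₂ lact (LinearMap.mul K H) (Coalgebra.comul (R := K) h) (rcoact m))
      (Coalgebra.comul (R := K) g)

section TensorAlg

variable {K M : Type*} [Field K] [AddCommGroup M] [Module K M]

/-- The linear map `f` on the tensor algebra with `f 1 = 0` and
`f (m ⊗ t) = g₁ m t + g₂ m (f t)`. -/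
def tRec {X : Type*} [AddCommGroup X] [Module K X]
    (g₁ : M →ₗ[K] TensorAlgebra K M →ₗ[K] X) (g₂ : M →ₗ[K] X →ₗ[K] X) :
    TensorAlgebra K M →ₗ[K] X :=
  LinearMap.snd K (TensorAlgebra K M) X ∘ₗ
    (LinearMap.applyₗ ((1, 0) : TensorAlgebra K M × X)) ∘ₗ
    (TensorAlgebra.lift K (LinearMap.mk₂ K
      (fun (m : M) (p : TensorAlgebra K M × X) =>
        (TensorAlgebra.ι K m * p.1, g₁ m p.1 + g₂ m p.2))
      (by intros; ext <;> simp [add_mul]; abel)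
      (by intros; ext <;> simp)
      (by intros; ext <;> simp [mul_add]; abel)
      (by intros; ext <;> simp)) :
        TensorAlgebra K M →ₐ[K] Module.End K (TensorAlgebra K M × X)).toLinearMap

theorem tRec_one {X : Type*} [AddCommGroup X] [Module K X]
    (g₁ : M →ₗ[K] TensorAlgebra K M →ₗ[K] X) (g₂ : M →ₗ[K] X →ₗ[K] X) :
    tRec g₁ g₂ 1 = 0 := by
  simp [tRec]

/-- Left induction on the tensor algebra. -/
theorem tInd {p : TensorAlgebra K M → Prop} (h1 : p 1) (hadd : ∀ x y, p x → p y → p (x + y))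
    (hsmul : ∀ (r : K) x, p x → p (r • x))
    (hmul : ∀ m x, p x → p (TensorAlgebra.ι K m * x)) (x : TensorAlgebra K M) : p x := by
  have key : ∀ a : TensorAlgebra K M, ∀ x, p x → p (a * x) := by
    intro a
    induction a using TensorAlgebra.induction with
    | algebraMap r => intro x hx; rw [← Algebra.smul_def]; exact hsmul r x hx
    | ι m => exact hmul m
    | mul a b ha hb => intro x hx; rw [mul_assoc]; exact ha _ (hb _ hx)
    | add a b ha hb => intro x hx; rw [add_mul]; exact hadd _ _ (ha _ hx) (hb _ hx)
  simpa using key x 1 h1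

theorem tExt {X : Type*} [AddCommGroup X] [Module K X] {f g : TensorAlgebra K M →ₗ[K] X}
    (h1 : f 1 = g 1)
    (hmul : ∀ m t, f t = g t → f (TensorAlgebra.ι K m * t) = g (TensorAlgebra.ι K m * t)) :
    ∀ t, f t = g t := by
  intro t
  induction t using tInd with
  | h1 => exact h1
  | hadd x y hx hy => rw [map_add, map_add, hx, hy]
  | hsmul r x hx => rw [map_smul, map_smul, hx]
  | hmul m x hx => exact hmul m x hx

theorem tRec_mul {X : Type*} [AddCommGroup X] [Module K X]
    (g₁ : M →ₗ[K] TensorAlgebra K M →ₗ[K] X) (g₂ : M →ₗ[K] X →ₗ[K] X)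
    (m : M) (t : TensorAlgebra K M) :
    tRec g₁ g₂ (TensorAlgebra.ι K m * t) = g₁ m t + g₂ m (tRec g₁ g₂ t) := by
  set F := (TensorAlgebra.lift K (LinearMap.mk₂ K
      (fun (m : M) (p : TensorAlgebra K M × X) =>
        (TensorAlgebra.ι K m * p.1, g₁ m p.1 + g₂ m p.2))
      (by intros; ext <;> simp [add_mul]; abel)
      (by intros; ext <;> simp)
      (by intros; ext <;> simp [mul_add]; abel)
      (by intros; ext <;> simp)) :
        TensorAlgebra K M →ₐ[K] Module.End K (TensorAlgebra K M × X)) with hF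
  have hfst : ∀ t, (F t ((1, 0) : TensorAlgebra K M × X)).1 = t := by
    intro t
    refine tExt (f := LinearMap.fst K (TensorAlgebra K M) X ∘ₗ
      (LinearMap.applyₗ ((1, 0) : TensorAlgebra K M × X)) ∘ₗ F.toLinearMap)
      (g := LinearMap.id) (by simp) ?_ t
    intro m t h
    simp only [LinearMap.coe_comp, Function.comp_apply, AlgHom.toLinearMap_apply,
      LinearMap.applyₗ_apply_apply, LinearMap.fst_apply, LinearMap.id_apply] at h ⊢
    rw [map_mul, Module.End.mul_apply, hF, TensorAlgebra.lift_ι_apply, ← hF]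
    simp [h]
  change (F (TensorAlgebra.ι K m * t) (1, 0)).2 = g₁ m t + g₂ m (F t (1, 0)).2
  rw [map_mul, Module.End.mul_apply]
  conv_lhs => rw [hF, TensorAlgebra.lift_ι_apply, ← hF]
  simp [hfst]

/-- The augmentation part removed: `t ↦ t - ε(t) 1`, the projection of `⨁_{n ≥ 0} M^{⊗n}` onto
`⨁_{n ≥ 1} M^{⊗n}`. -/
def tPlus : TensorAlgebra K M →ₗ[K] TensorAlgebra K M :=
  LinearMap.id - (Algebra.ofId K (TensorAlgebra K M)).toLinearMap ∘ₗ
    TensorAlgebra.algebraMapInv.toLinearMap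

theorem tPlus_one : tPlus (1 : TensorAlgebra K M) = 0 := by
  simp [tPlus]

theorem algebraMapInv_ι_mul (m : M) (t : TensorAlgebra K M) :
    TensorAlgebra.algebraMapInv (TensorAlgebra.ι K m * t) = 0 := by
  simp [TensorAlgebra.algebraMapInv]

theorem tPlus_ι_mul (m : M) (t : TensorAlgebra K M) :
    tPlus (TensorAlgebra.ι K m * t) = TensorAlgebra.ι K m * t := by
  simp [tPlus, TensorAlgebra.algebraMapInv]

/-- Left multiplication by elements of `M` on a module over the tensor algebra. -/
def tSmul (X : Type*) [AddCommGroup X] [Module K X] [Module (TensorAlgebra K M) X]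
    [IsScalarTower K (TensorAlgebra K M) X] : M →ₗ[K] X →ₗ[K] X :=
  (Algebra.lsmul K K (A := TensorAlgebra K M) X).toLinearMap ∘ₗ TensorAlgebra.ι K

@[simp] theorem tSmul_apply (X : Type*) [AddCommGroup X] [Module K X]
    [Module (TensorAlgebra K M) X] [IsScalarTower K (TensorAlgebra K M) X] (m : M) (x : X) :
    tSmul (K := K) (M := M) X m x = TensorAlgebra.ι K m • x := rfl

/-- The projection `⨁ M^{⊗n} → M` onto degree one. -/
def tProj : TensorAlgebra K M →ₗ[K] M :=
  tRec ((LinearMap.lsmul K M).flip.compl₂ TensorAlgebra.algebraMapInv.toLinearMap) 0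

/-- Reduced deconcatenation
`m₁ ⊗ ⋯ ⊗ mₙ ↦ ∑_{0 < i < n} (m₁ ⊗ ⋯ ⊗ mᵢ) ⊗ (mᵢ₊₁ ⊗ ⋯ ⊗ mₙ)`. -/
def tDec : TensorAlgebra K M →ₗ[K] TensorAlgebra K M ⊗[K] TensorAlgebra K M :=
  tRec ((TensorProduct.mk K _ _ ∘ₗ TensorAlgebra.ι K).compl₂ tPlus) (tSmul _)

@[simp] theorem tProj_one : tProj (1 : TensorAlgebra K M) = 0 := tRec_one _ _

@[simp] theorem tProj_ι_mul (m : M) (t : TensorAlgebra K M) :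
    tProj (TensorAlgebra.ι K m * t) = TensorAlgebra.algebraMapInv t • m := by
  simp [tProj, tRec_mul]

@[simp] theorem tDec_one : tDec (1 : TensorAlgebra K M) = 0 := tRec_one _ _

@[simp] theorem tDec_ι_mul (m : M) (t : TensorAlgebra K M) :
    tDec (TensorAlgebra.ι K m * t) =
      TensorAlgebra.ι K m ⊗ₜ[K] tPlus t + TensorAlgebra.ι K m • tDec t := by
  simp [tDec, tRec_mul]

end TensorAlg

namespace HopfBimodule

variable {K H M : Type*} [Field K] [Ring H] [HopfAlgebra K H] [AddCommGroup M] [Module K M]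
  (P : HopfBimodule K H M)

/-- The left coaction on `⨁_{n ≥ 1} M^{⊗n}` through the first factor,
`m₁ ⊗ ⋯ ⊗ mₙ ↦ ∑ (m₁)₋₁ ⊗ ((m₁)₀ ⊗ m₂ ⊗ ⋯ ⊗ mₙ)`, and zero on scalars. -/
def tL : TensorAlgebra K M →ₗ[K] H ⊗[K] TensorAlgebra K M :=
  tRec (LinearMap.mk₂ K (fun (m : M) (t : TensorAlgebra K M) =>
      (LinearMap.mulRight K t ∘ₗ TensorAlgebra.ι K).lTensor H (P.lcoact m))
    (by intros; simp)
    (by intros; simp)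
    (by
      intro m s t
      have : LinearMap.mulRight K (s + t) = LinearMap.mulRight K s + LinearMap.mulRight K t := by
        ext; simp [mul_add]
      rw [this, LinearMap.add_comp, LinearMap.lTensor_add, LinearMap.add_apply])
    (by
      intro c m t
      have : LinearMap.mulRight K (c • t) = c • LinearMap.mulRight K t := by
        ext; simp
      rw [this, LinearMap.smul_comp, LinearMap.lTensor_smul, LinearMap.smul_apply])) 0

/-- The right coaction on `⨁_{n ≥ 1} M^{⊗n}` through the last factor,
`m₁ ⊗ ⋯ ⊗ mₙ ↦ ∑ (m₁ ⊗ ⋯ ⊗ (mₙ)₀) ⊗ (mₙ)₁`, and zero on scalars. -/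
def tR : TensorAlgebra K M →ₗ[K] TensorAlgebra K M ⊗[K] H :=
  tRec (((LinearMap.lsmul K (TensorAlgebra K M ⊗[K] H)).flip ∘ₗ
      (TensorAlgebra.ι K).rTensor H ∘ₗ P.rcoact).compl₂
      TensorAlgebra.algebraMapInv.toLinearMap) (tSmul _)

@[simp] theorem tL_one : P.tL 1 = 0 := tRec_one _ _

@[simp] theorem tL_ι_mul (m : M) (t : TensorAlgebra K M) : P.tL (TensorAlgebra.ι K m * t) =
    (LinearMap.mulRight K t ∘ₗ TensorAlgebra.ι K).lTensor H (P.lcoact m) := by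
  simp [tL, tRec_mul]

@[simp] theorem tR_one : P.tR 1 = 0 := tRec_one _ _

@[simp] theorem tR_ι_mul (m : M) (t : TensorAlgebra K M) : P.tR (TensorAlgebra.ι K m * t) =
    TensorAlgebra.algebraMapInv t • (TensorAlgebra.ι K).rTensor H (P.rcoact m) +
      TensorAlgebra.ι K m • P.tR t := by
  simp [tR, tRec_mul]

/-- The junction defect: on `M^{⊗n}` its components for `0 < i < n` are
`m₁ ⊗ ⋯ ⊗ mₙ ↦ ∑ (m₁ ⊗ ⋯ ⊗ (mᵢ)₀) ⊗ (mᵢ)₁ ⊗ (mᵢ₊₁ ⊗ ⋯ ⊗ mₙ)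
  - ∑ (m₁ ⊗ ⋯ ⊗ mᵢ) ⊗ (mᵢ₊₁)₋₁ ⊗ ((mᵢ₊₁)₀ ⊗ ⋯ ⊗ mₙ)`
in `M^{⊗i} ⊗ H ⊗ M^{⊗(n-i)}`. -/
def junction : TensorAlgebra K M →ₗ[K] TensorAlgebra K M ⊗[K] (H ⊗[K] TensorAlgebra K M) :=
  (TensorProduct.assoc K _ _ _).toLinearMap ∘ₗ P.tR.rTensor _ ∘ₗ tDec - P.tL.lTensor _ ∘ₗ tDec

end HopfBimodule

section General

variable {K M : Type*} [Field K] [AddCommGroup M] [Module K M]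
  {A B C : Type*} [AddCommGroup A] [Module K A] [AddCommGroup B] [Module K B]
  [AddCommGroup C] [Module K C]

theorem lTensor_t_smul (f : A →ₗ[K] B) (s : TensorAlgebra K M) (z : TensorAlgebra K M ⊗[K] A) :
    f.lTensor (TensorAlgebra K M) (s • z) = s • f.lTensor (TensorAlgebra K M) z := by
  induction z using TensorProduct.induction_on with
  | zero => simp
  | tmul x y => simp [TensorProduct.smul_tmul']
  | add x y hx hy => rw [smul_add, map_add, map_add, hx, hy, smul_add]

theorem assoc_t_smul (s : TensorAlgebra K M) (z : (TensorAlgebra K M ⊗[K] A) ⊗[K] B) :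
    TensorProduct.assoc K (TensorAlgebra K M) A B (s • z) =
      s • TensorProduct.assoc K (TensorAlgebra K M) A B z := by
  induction z using TensorProduct.induction_on with
  | zero => simp
  | add x y hx hy => rw [smul_add, map_add, map_add, hx, hy, smul_add]
  | tmul x y =>
    induction x using TensorProduct.induction_on with
    | zero => simp
    | tmul x y => simp [TensorProduct.smul_tmul']
    | add u v hx hy =>
      rw [TensorProduct.add_tmul, smul_add, map_add, map_add, hx, hy, smul_add]

theorem rid_t_smul (s : TensorAlgebra K M) (z : TensorAlgebra K M ⊗[K] K) :
    TensorProduct.rid K (TensorAlgebra K M) (s • z) =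
      s * TensorProduct.rid K (TensorAlgebra K M) z := by
  induction z using TensorProduct.induction_on with
  | zero => simp
  | tmul x y => simp [TensorProduct.smul_tmul']
  | add x y hx hy => rw [smul_add, map_add, map_add, hx, hy, mul_add]

theorem tPlus_rTensor_smul (m : M) (z : TensorAlgebra K M ⊗[K] A) :
    tPlus.rTensor A (TensorAlgebra.ι K m • z) = TensorAlgebra.ι K m • z := by
  induction z using TensorProduct.induction_on with
  | zero => simp
  | tmul x y => simp [TensorProduct.smul_tmul', tPlus_ι_mul]
  | add x y hx hy => rw [smul_add, map_add, hx, hy]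

theorem tDec_rTensor_smul (m : M) (z : TensorAlgebra K M ⊗[K] A) :
    TensorProduct.assoc K _ _ _ (tDec.rTensor A (TensorAlgebra.ι K m • z)) =
      TensorAlgebra.ι K m ⊗ₜ (tPlus.rTensor A z) +
      TensorAlgebra.ι K m • TensorProduct.assoc K _ _ _ (tDec.rTensor A z) := by
  induction z using TensorProduct.induction_on with
  | zero => simp
  | tmul x y =>
    simp [TensorProduct.smul_tmul', TensorProduct.add_tmul, ← assoc_t_smul]
  | add x y hx hy =>
    simp only [smul_add, map_add, hx, hy, TensorProduct.tmul_add]; abel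

theorem tDec_tPlus (t : TensorAlgebra K M) : tDec (tPlus t) = tDec t := by
  simp [tPlus, Algebra.ofId_apply, Algebra.algebraMap_eq_smul_one]

theorem tPlus_tPlus (t : TensorAlgebra K M) : tPlus (tPlus t) = tPlus t := by
  simp [tPlus, Algebra.ofId_apply, Algebra.algebraMap_eq_smul_one]

theorem aug_tPlus (t : TensorAlgebra K M) : TensorAlgebra.algebraMapInv (tPlus t) = 0 := by
  simp [tPlus, Algebra.ofId_apply, Algebra.algebraMap_eq_smul_one]

theorem tPlus_of_aug {t : TensorAlgebra K M} (h : TensorAlgebra.algebraMapInv t = 0) :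
    tPlus t = t := by
  simp [tPlus, h]

theorem tPlus_rTensor_tDec (t : TensorAlgebra K M) : tPlus.rTensor _ (tDec t) = tDec t := by
  refine tExt (f := tPlus.rTensor _ ∘ₗ tDec) (g := tDec) (by simp) ?_ t
  intro m t _
  have : tPlus (TensorAlgebra.ι K m) = TensorAlgebra.ι K m := by
    simpa using tPlus_ι_mul m 1
  simp [tPlus_rTensor_smul, this]

theorem tPlus_lTensor_tDec (t : TensorAlgebra K M) : tPlus.lTensor _ (tDec t) = tDec t := by
  refine tExt (f := tPlus.lTensor _ ∘ₗ tDec) (g := tDec) (by simp) ?_ t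
  intro m t h
  simp only [LinearMap.comp_apply] at h
  simp [lTensor_t_smul, tPlus_tPlus, h]

theorem tDec_ι (m : M) : tDec (TensorAlgebra.ι K m) = 0 := by
  have := tDec_ι_mul m (1 : TensorAlgebra K M)
  rw [mul_one, tPlus_one, tDec_one, TensorProduct.tmul_zero] at this
  rw [this, zero_add]
  exact (tSmul (K := K) (M := M) (TensorAlgebra K M ⊗[K] TensorAlgebra K M) m).map_zero

theorem tDec_coassoc (t : TensorAlgebra K M) :
    TensorProduct.assoc K _ _ _ (tDec.rTensor _ (tDec t)) = tDec.lTensor _ (tDec t) := by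
  refine tExt (f := (TensorProduct.assoc K _ _ _).toLinearMap ∘ₗ tDec.rTensor _ ∘ₗ tDec)
    (g := tDec.lTensor _ ∘ₗ tDec) (by simp) ?_ t
  intro m t h
  simp only [LinearMap.comp_apply, LinearEquiv.coe_coe] at h
  have h1 : tDec (TensorAlgebra.ι K m) = 0 := by exact tDec_ι m
  simp [lTensor_t_smul, tDec_rTensor_smul, tPlus_rTensor_tDec, h, h1, tDec_tPlus]

end General

namespace HopfBimodule

variable {K H M : Type*} [Field K] [Ring H] [HopfAlgebra K H] [AddCommGroup M] [Module K M]
  (P : HopfBimodule K H M)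
  {A : Type*} [AddCommGroup A] [Module K A]

theorem tL_tPlus (t : TensorAlgebra K M) : P.tL (tPlus t) = P.tL t := by
  simp [tPlus, Algebra.ofId_apply, Algebra.algebraMap_eq_smul_one]

theorem tR_tPlus (t : TensorAlgebra K M) : P.tR (tPlus t) = P.tR t := by
  simp [tPlus, Algebra.ofId_apply, Algebra.algebraMap_eq_smul_one]

theorem tR_ι (m : M) :
    P.tR (TensorAlgebra.ι K m) = (TensorAlgebra.ι K).rTensor H (P.rcoact m) := by
  simpa using P.tR_ι_mul m 1

theorem tL_ι (m : M) :
    P.tL (TensorAlgebra.ι K m) = (TensorAlgebra.ι K).lTensor H (P.lcoact m) := by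
  have := P.tL_ι_mul m 1
  simpa using this

theorem tL_counit (t : TensorAlgebra K M) :
    TensorProduct.lid K _ ((Coalgebra.counit (R := K)).rTensor _ (P.tL t)) = tPlus t := by
  refine tExt (f := (TensorProduct.lid K _).toLinearMap ∘ₗ
    (Coalgebra.counit (R := K)).rTensor _ ∘ₗ P.tL) (g := tPlus) (by simp [tPlus_one]) ?_ t
  intro m t _
  have key : ∀ z : H ⊗[K] M, TensorProduct.lid K _ ((Coalgebra.counit (R := K)).rTensor _
      ((LinearMap.mulRight K t ∘ₗ TensorAlgebra.ι K).lTensor H z)) =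
      TensorAlgebra.ι K (TensorProduct.lid K _ ((Coalgebra.counit (R := K)).rTensor _ z)) * t := by
    intro z
    induction z using TensorProduct.induction_on with
    | zero => simp
    | tmul x y => simp
    | add x y hx hy => simp only [map_add, hx, hy, add_mul]
  simp only [LinearMap.comp_apply, LinearEquiv.coe_coe, tL_ι_mul, tPlus_ι_mul]
  rw [key, P.lcoact_counit]

theorem tR_counit (t : TensorAlgebra K M) :
    TensorProduct.rid K _ ((Coalgebra.counit (R := K)).lTensor _ (P.tR t)) = tPlus t := by
  refine tExt (f := (TensorProduct.rid K _).toLinearMap ∘ₗ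
    (Coalgebra.counit (R := K)).lTensor _ ∘ₗ P.tR) (g := tPlus) (by simp [tPlus_one]) ?_ t
  intro m t h
  have key : ∀ z : M ⊗[K] H, TensorProduct.rid K _ ((Coalgebra.counit (R := K)).lTensor _
      ((TensorAlgebra.ι K).rTensor H z)) =
      TensorAlgebra.ι K (TensorProduct.rid K _ ((Coalgebra.counit (R := K)).lTensor _ z)) := by
    intro z
    induction z using TensorProduct.induction_on with
    | zero => simp
    | tmul x y => simp
    | add x y hx hy => simp only [map_add, hx, hy]
  simp only [LinearMap.comp_apply, LinearEquiv.coe_coe] at h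
  simp only [LinearMap.comp_apply, LinearEquiv.coe_coe, tR_ι_mul, tPlus_ι_mul, map_add, map_smul,
    lTensor_t_smul, rid_t_smul, h]
  rw [key, P.rcoact_counit]
  simp [tPlus, Algebra.ofId_apply, Algebra.algebraMap_eq_smul_one, mul_sub]

theorem tL_coassoc (t : TensorAlgebra K M) :
    TensorProduct.assoc K _ _ _ ((Coalgebra.comul (R := K)).rTensor _ (P.tL t)) =
      P.tL.lTensor H (P.tL t) := by
  refine tExt (f := (TensorProduct.assoc K _ _ _).toLinearMap ∘ₗ
    (Coalgebra.comul (R := K)).rTensor _ ∘ₗ P.tL) (g := P.tL.lTensor H ∘ₗ P.tL) (by simp) ?_ t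
  intro m t _
  simp only [LinearMap.comp_apply, LinearEquiv.coe_coe, tL_ι_mul]
  have k1 : ∀ z : H ⊗[K] M, TensorProduct.assoc K _ _ _ ((Coalgebra.comul (R := K)).rTensor _
      ((LinearMap.mulRight K t ∘ₗ TensorAlgebra.ι K).lTensor H z)) =
      ((LinearMap.mulRight K t ∘ₗ TensorAlgebra.ι K).lTensor H).lTensor H
        (TensorProduct.assoc K _ _ _ ((Coalgebra.comul (R := K)).rTensor _ z)) := by
    intro z
    induction z using TensorProduct.induction_on with
    | zero => simp
    | tmul x y =>
      simp only [LinearMap.lTensor_tmul, LinearMap.rTensor_tmul]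
      induction Coalgebra.comul (R := K) x using TensorProduct.induction_on with
      | zero => simp
      | tmul a b => simp
      | add a b ha hb => simp only [TensorProduct.add_tmul, map_add, ha, hb]
    | add x y hx hy => simp only [map_add, hx, hy]
  have k2 : ∀ z : H ⊗[K] M, P.tL.lTensor H
      ((LinearMap.mulRight K t ∘ₗ TensorAlgebra.ι K).lTensor H z) =
      ((LinearMap.mulRight K t ∘ₗ TensorAlgebra.ι K).lTensor H).lTensor H
        (P.lcoact.lTensor H z) := by
    intro z
    induction z using TensorProduct.induction_on with
    | zero => simp
    | tmul x y => simp
    | add x y hx hy => simp only [map_add, hx, hy]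
  rw [k1, k2, P.lcoact_coassoc]

theorem tR_rTensor_smul (m : M) (z : TensorAlgebra K M ⊗[K] A) :
    TensorProduct.assoc K _ _ _ (P.tR.rTensor A (TensorAlgebra.ι K m • z)) =
      TensorProduct.assoc K _ _ _ (((TensorAlgebra.ι K).rTensor H (P.rcoact m)) ⊗ₜ
        TensorProduct.lid K _ (TensorAlgebra.algebraMapInv.toLinearMap.rTensor A z)) +
      TensorAlgebra.ι K m • TensorProduct.assoc K _ _ _ (P.tR.rTensor A z) := by
  induction z using TensorProduct.induction_on with
  | zero => simp
  | tmul x y =>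
    simp [TensorProduct.smul_tmul', TensorProduct.add_tmul, ← assoc_t_smul]
  | add x y hx hy =>
    simp only [smul_add, map_add, hx, hy, TensorProduct.tmul_add]; abel

theorem aug_rTensor_tR (t : TensorAlgebra K M) :
    TensorAlgebra.algebraMapInv.toLinearMap.rTensor H (P.tR t) = 0 := by
  have k : ∀ (m : M) (z : TensorAlgebra K M ⊗[K] H),
      TensorAlgebra.algebraMapInv.toLinearMap.rTensor H (TensorAlgebra.ι K m • z) = 0 := by
    intro m z
    induction z using TensorProduct.induction_on with
    | zero => simp
    | tmul x y => simp [TensorProduct.smul_tmul', TensorAlgebra.algebraMapInv]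
    | add x y hx hy => rw [smul_add, map_add, hx, hy, add_zero]
  refine tExt (f := TensorAlgebra.algebraMapInv.toLinearMap.rTensor H ∘ₗ P.tR) (g := 0)
    (by simp) ?_ t
  intro m t _
  have k2 : ∀ z : M ⊗[K] H, TensorAlgebra.algebraMapInv.toLinearMap.rTensor H
      ((TensorAlgebra.ι K).rTensor H z) = 0 := by
    intro z
    induction z using TensorProduct.induction_on with
    | zero => simp
    | tmul x y => simp [TensorAlgebra.algebraMapInv]
    | add x y hx hy => rw [map_add, map_add, hx, hy, add_zero]
  simp [k, k2]

theorem aug_lTensor_tL (t : TensorAlgebra K M) :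
    TensorAlgebra.algebraMapInv.toLinearMap.lTensor H (P.tL t) = 0 := by
  refine tExt (f := TensorAlgebra.algebraMapInv.toLinearMap.lTensor H ∘ₗ P.tL) (g := 0)
    (by simp) ?_ t
  intro m t _
  have k2 : ∀ z : H ⊗[K] M, TensorAlgebra.algebraMapInv.toLinearMap.lTensor H
      ((LinearMap.mulRight K t ∘ₗ TensorAlgebra.ι K).lTensor H z) = 0 := by
    intro z
    induction z using TensorProduct.induction_on with
    | zero => simp
    | tmul x y => simp [TensorAlgebra.algebraMapInv]
    | add x y hx hy => rw [map_add, map_add, hx, hy, add_zero]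
  simp only [LinearMap.comp_apply, tL_ι_mul, k2, LinearMap.zero_apply]

theorem tR_coassoc (t : TensorAlgebra K M) :
    TensorProduct.assoc K _ _ _ (P.tR.rTensor H (P.tR t)) =
      (Coalgebra.comul (R := K)).lTensor _ (P.tR t) := by
  refine tExt (f := (TensorProduct.assoc K _ _ _).toLinearMap ∘ₗ P.tR.rTensor H ∘ₗ P.tR)
    (g := (Coalgebra.comul (R := K)).lTensor _ ∘ₗ P.tR) (by simp) ?_ t
  intro m t h
  simp only [LinearMap.comp_apply, LinearEquiv.coe_coe] at h
  have k1 : ∀ z : M ⊗[K] H, TensorProduct.assoc K _ _ _ (P.tR.rTensor H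
      ((TensorAlgebra.ι K).rTensor H z)) = (TensorAlgebra.ι K).rTensor (H ⊗[K] H)
        (TensorProduct.assoc K _ _ _ (P.rcoact.rTensor H z)) := by
    intro z
    induction z using TensorProduct.induction_on with
    | zero => simp
    | tmul x y =>
      simp only [LinearMap.rTensor_tmul, tR_ι]
      induction P.rcoact x using TensorProduct.induction_on with
      | zero => simp
      | tmul a b => simp
      | add a b ha hb => simp only [TensorProduct.add_tmul, map_add, ha, hb]
    | add x y hx hy => simp only [map_add, hx, hy]
  have k2 : ∀ z : M ⊗[K] H, (Coalgebra.comul (R := K)).lTensor _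
      ((TensorAlgebra.ι K).rTensor H z) = (TensorAlgebra.ι K).rTensor (H ⊗[K] H)
        ((Coalgebra.comul (R := K)).lTensor _ z) := by
    intro z
    induction z using TensorProduct.induction_on with
    | zero => simp
    | tmul x y => simp
    | add x y hx hy => simp only [map_add, hx, hy]
  simp only [LinearMap.comp_apply, LinearEquiv.coe_coe, tR_ι_mul, map_add, map_smul,
    lTensor_t_smul, tR_rTensor_smul, k1, k2, h, aug_rTensor_tR, P.rcoact_coassoc]
  simp

theorem tL_rTensor_smul (m : M) (z : TensorAlgebra K M ⊗[K] A) :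
    TensorProduct.assoc K _ _ _ (P.tL.rTensor A (TensorAlgebra.ι K m • z)) =
      ((tSmul (TensorAlgebra K M ⊗[K] A)).flip z).lTensor H (P.lcoact m) := by
  induction z using TensorProduct.induction_on with
  | zero => simp
  | tmul x y =>
    rw [TensorProduct.smul_tmul', smul_eq_mul, LinearMap.rTensor_tmul, tL_ι_mul]
    induction P.lcoact m using TensorProduct.induction_on with
    | zero => simp
    | tmul a b => simp [TensorProduct.smul_tmul']
    | add a b ha hb => simp only [TensorProduct.add_tmul, map_add, ha, hb]
  | add x y hx hy =>
    simp only [smul_add, map_add, hx, hy, LinearMap.lTensor_add, LinearMap.add_apply]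

theorem tPlus_rTensor_tR (t : TensorAlgebra K M) : tPlus.rTensor H (P.tR t) = P.tR t := by
  have h : tPlus.rTensor H (P.tR t) = P.tR t -
      (Algebra.ofId K (TensorAlgebra K M)).toLinearMap.rTensor H
        (TensorAlgebra.algebraMapInv.toLinearMap.rTensor H (P.tR t)) := by
    rw [tPlus, LinearMap.rTensor_sub, LinearMap.rTensor_comp]
    simp
  rw [h, aug_rTensor_tR]
  simp

theorem tL_tR (t : TensorAlgebra K M) :
    TensorProduct.assoc K _ _ _ (P.tL.rTensor H (P.tR t)) = P.tR.lTensor H (P.tL t) := by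
  refine tExt (f := (TensorProduct.assoc K _ _ _).toLinearMap ∘ₗ P.tL.rTensor H ∘ₗ P.tR)
    (g := P.tR.lTensor H ∘ₗ P.tL) (by simp) ?_ t
  intro m t _
  have k1 : ∀ z : M ⊗[K] H, TensorProduct.assoc K _ _ _ (P.tL.rTensor H
      ((TensorAlgebra.ι K).rTensor H z)) = ((TensorAlgebra.ι K).rTensor H).lTensor H
        (TensorProduct.assoc K _ _ _ (P.lcoact.rTensor H z)) := by
    intro z
    induction z using TensorProduct.induction_on with
    | zero => simp
    | tmul x y =>
      simp only [LinearMap.rTensor_tmul, tL_ι]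
      induction P.lcoact x using TensorProduct.induction_on with
      | zero => simp
      | tmul a b => simp
      | add a b ha hb => simp only [TensorProduct.add_tmul, map_add, ha, hb]
    | add x y hx hy => simp only [map_add, hx, hy]
  have k2 : ∀ z : H ⊗[K] M, P.tR.lTensor H
      ((LinearMap.mulRight K t ∘ₗ TensorAlgebra.ι K).lTensor H z) =
      TensorAlgebra.algebraMapInv t • ((TensorAlgebra.ι K).rTensor H).lTensor H
        (P.rcoact.lTensor H z) +
      ((tSmul (TensorAlgebra K M ⊗[K] H)).flip (P.tR t)).lTensor H z := by
    intro z
    induction z using TensorProduct.induction_on with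
    | zero => simp
    | tmul x y => simp [TensorProduct.tmul_add]
    | add x y hx hy => simp only [map_add, hx, hy, smul_add]; abel
  simp only [LinearMap.comp_apply, LinearEquiv.coe_coe, tR_ι_mul, tL_ι_mul, map_add, map_smul,
    tL_rTensor_smul, k1, k2, P.lcoact_rcoact]

theorem tL_tDec (t : TensorAlgebra K M) :
    TensorProduct.assoc K _ _ _ (P.tL.rTensor _ (tDec t)) = tDec.lTensor H (P.tL t) := by
  refine tExt (f := (TensorProduct.assoc K _ _ _).toLinearMap ∘ₗ P.tL.rTensor _ ∘ₗ tDec)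
    (g := tDec.lTensor H ∘ₗ P.tL) (by simp) ?_ t
  intro m t _
  have k1 : ∀ z : H ⊗[K] M, TensorProduct.assoc K _ _ _
      ((TensorAlgebra.ι K).lTensor H z ⊗ₜ[K] tPlus t) +
      ((tSmul (TensorAlgebra K M ⊗[K] TensorAlgebra K M)).flip (tDec t)).lTensor H z =
      tDec.lTensor H ((LinearMap.mulRight K t ∘ₗ TensorAlgebra.ι K).lTensor H z) := by
    intro z
    induction z using TensorProduct.induction_on with
    | zero => simp
    | tmul x y => simp [TensorProduct.tmul_add]
    | add x y hx hy => simp only [map_add, ← hx, ← hy, TensorProduct.add_tmul]; abel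
  simp only [LinearMap.comp_apply, LinearEquiv.coe_coe, tDec_ι_mul, tL_ι_mul, map_add,
    tL_rTensor_smul, ← k1, LinearMap.rTensor_tmul, tL_ι]

theorem tDec_tR (t : TensorAlgebra K M) :
    TensorProduct.assoc K _ _ _ (tDec.rTensor H (P.tR t)) = P.tR.lTensor _ (tDec t) := by
  refine tExt (f := (TensorProduct.assoc K _ _ _).toLinearMap ∘ₗ tDec.rTensor H ∘ₗ P.tR)
    (g := P.tR.lTensor _ ∘ₗ tDec) (by simp) ?_ t
  intro m t h
  simp only [LinearMap.comp_apply, LinearEquiv.coe_coe] at h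
  have k1 : ∀ z : M ⊗[K] H, tDec.rTensor H ((TensorAlgebra.ι K).rTensor H z) = 0 := by
    intro z
    induction z using TensorProduct.induction_on with
    | zero => simp
    | tmul x y => simp [tDec_ι]
    | add x y hx hy => simp only [map_add, hx, hy, add_zero]
  simp only [LinearMap.comp_apply, LinearEquiv.coe_coe, tR_ι_mul, tDec_ι_mul, map_add, map_smul,
    k1, tDec_rTensor_smul, tPlus_rTensor_tR, h, lTensor_t_smul, LinearMap.lTensor_tmul, tR_tPlus,
    smul_zero, zero_add]

end HopfBimodule

section Assoc

variable {K : Type*} [Field K] {A B C D A' B' C' D' : Type*}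
  [AddCommGroup A] [Module K A] [AddCommGroup B] [Module K B] [AddCommGroup C] [Module K C]
  [AddCommGroup D] [Module K D] [AddCommGroup A'] [Module K A'] [AddCommGroup B'] [Module K B']
  [AddCommGroup C'] [Module K C'] [AddCommGroup D'] [Module K D']

/-- reassociation of four factors -/
theorem assoc_lTensor_left (f : A →ₗ[K] B ⊗[K] C) (g : C →ₗ[K] A' ⊗[K] B')
    (f' : A →ₗ[K] C' ⊗[K] B') (g' : C' →ₗ[K] B ⊗[K] A')
    (h : ∀ a, TensorProduct.assoc K _ _ _ (g'.rTensor B' (f' a)) = g.lTensor B (f a))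
    (z : A ⊗[K] D) :
    (((TensorProduct.assoc K A' B' D).toLinearMap ∘ₗ g.rTensor D).lTensor B)
      (TensorProduct.assoc K B C D (f.rTensor D z)) =
    TensorProduct.assoc K B A' (B' ⊗[K] D)
      (g'.rTensor _ (TensorProduct.assoc K C' B' D (f'.rTensor D z))) := by
  have k1 : ∀ (w : B ⊗[K] C) (d : D),
      (((TensorProduct.assoc K A' B' D).toLinearMap ∘ₗ g.rTensor D).lTensor B)
      (TensorProduct.assoc K B C D (w ⊗ₜ d)) =
      (TensorProduct.assoc K A' B' D).toLinearMap.lTensor B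
        (TensorProduct.assoc K B (A' ⊗[K] B') D (g.lTensor B w ⊗ₜ d)) := by
    intro w d
    induction w using TensorProduct.induction_on with
    | zero => simp
    | tmul x y => simp
    | add x y hx hy => simp only [map_add, TensorProduct.add_tmul, hx, hy]
  have k2 : ∀ (w : C' ⊗[K] B') (d : D),
      TensorProduct.assoc K B A' (B' ⊗[K] D)
        (g'.rTensor _ (TensorProduct.assoc K C' B' D (w ⊗ₜ d))) =
      (TensorProduct.assoc K A' B' D).toLinearMap.lTensor B
        (TensorProduct.assoc K B (A' ⊗[K] B') D
          (TensorProduct.assoc K _ _ _ (g'.rTensor B' w) ⊗ₜ d)) := by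
    intro w d
    induction w using TensorProduct.induction_on with
    | zero => simp
    | tmul x y =>
      simp only [TensorProduct.assoc_tmul, LinearMap.rTensor_tmul]
      induction g' x using TensorProduct.induction_on with
      | zero => simp
      | tmul a b => simp
      | add a b ha hb => simp only [TensorProduct.add_tmul, map_add, ha, hb]
    | add x y hx hy => simp only [map_add, TensorProduct.add_tmul, hx, hy]
  induction z using TensorProduct.induction_on with
  | zero => simp
  | tmul x y =>
    simp only [LinearMap.rTensor_tmul]
    rw [k1, k2, h]
  | add x y hx hy => simp only [map_add, hx, hy]

end Assoc

section Assoc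

variable {K : Type*} [Field K] {A B C D A' B' C' D' : Type*}
  [AddCommGroup A] [Module K A] [AddCommGroup B] [Module K B] [AddCommGroup C] [Module K C]
  [AddCommGroup D] [Module K D] [AddCommGroup A'] [Module K A'] [AddCommGroup B'] [Module K B']
  [AddCommGroup C'] [Module K C'] [AddCommGroup D'] [Module K D']

theorem assoc_lTensor_nat (f : A →ₗ[K] B ⊗[K] C) (g : D →ₗ[K] D') (z : A ⊗[K] D) :
    (g.lTensor C).lTensor B (TensorProduct.assoc K B C D (f.rTensor D z)) =
      TensorProduct.assoc K B C D' (f.rTensor D' (g.lTensor A z)) := by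
  induction z using TensorProduct.induction_on with
  | zero => simp
  | tmul x y =>
    simp only [LinearMap.rTensor_tmul, LinearMap.lTensor_tmul]
    induction f x using TensorProduct.induction_on with
    | zero => simp
    | tmul a b => simp
    | add a b ha hb => simp only [TensorProduct.add_tmul, map_add, ha, hb]
  | add x y hx hy => simp only [map_add, hx, hy]

theorem assoc_mid (g : B →ₗ[K] C ⊗[K] D) (z : (A ⊗[K] B) ⊗[K] A') :
    (TensorProduct.assoc K C D A').toLinearMap.lTensor A
      (TensorProduct.assoc K A (C ⊗[K] D) A' ((g.lTensor A).rTensor A' z)) =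
    ((TensorProduct.assoc K C D A').toLinearMap ∘ₗ g.rTensor A').lTensor A
      (TensorProduct.assoc K A B A' z) := by
  induction z using TensorProduct.induction_on with
  | zero => simp
  | tmul x y =>
    induction x using TensorProduct.induction_on with
    | zero => simp
    | tmul a b => simp
    | add a b ha hb => simp only [TensorProduct.add_tmul, map_add, ha, hb]
  | add x y hx hy => simp only [map_add, hx, hy]

theorem assoc_penta (g : A →ₗ[K] C ⊗[K] D) (z : (A ⊗[K] B) ⊗[K] A') :
    (TensorProduct.assoc K D B A').toLinearMap.lTensor C
      (TensorProduct.assoc K C (D ⊗[K] B) A'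
        (((TensorProduct.assoc K C D B).toLinearMap ∘ₗ g.rTensor B).rTensor A' z)) =
    TensorProduct.assoc K C D (B ⊗[K] A') (g.rTensor _ (TensorProduct.assoc K A B A' z)) := by
  induction z using TensorProduct.induction_on with
  | zero => simp
  | tmul x y =>
    induction x using TensorProduct.induction_on with
    | zero => simp
    | tmul a b =>
      simp only [LinearMap.rTensor_tmul, LinearMap.comp_apply, TensorProduct.assoc_tmul]
      induction g a using TensorProduct.induction_on with
      | zero => simp
      | tmul a b => simp
      | add a b ha hb => simp only [TensorProduct.add_tmul, map_add, ha, hb]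
    | add a b ha hb => simp only [TensorProduct.add_tmul, map_add, ha, hb]
  | add x y hx hy => simp only [map_add, hx, hy]

end Assoc

section Flat

variable {K : Type*} [Field K] {A B X Y : Type*}
  [AddCommGroup A] [Module K A] [AddCommGroup B] [Module K B]
  [AddCommGroup X] [Module K X] [AddCommGroup Y] [Module K Y]

theorem mem_range_rTensor_ker (f : A →ₗ[K] X) {z : A ⊗[K] B} (h : f.rTensor B z = 0) :
    z ∈ LinearMap.range ((LinearMap.ker f).subtype.rTensor B) := by
  have := Module.Flat.rTensor_exact B (LinearMap.exact_subtype_ker_map f)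
  exact (this z).1 h

theorem mem_range_lTensor_ker (f : B →ₗ[K] X) {z : A ⊗[K] B} (h : f.lTensor A z = 0) :
    z ∈ LinearMap.range ((LinearMap.ker f).subtype.lTensor A) := by
  have := Module.Flat.lTensor_exact A (LinearMap.exact_subtype_ker_map f)
  exact (this z).1 h

theorem map_injective {A' B' : Type*} [AddCommGroup A'] [Module K A'] [AddCommGroup B']
    [Module K B'] {f : A →ₗ[K] A'} {g : B →ₗ[K] B'} (hf : Function.Injective f)
    (hg : Function.Injective g) : Function.Injective (TensorProduct.map f g) := by
  rw [← LinearMap.rTensor_comp_lTensor]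
  exact (Module.Flat.rTensor_preserves_injective_linearMap _ hf).comp
    (Module.Flat.lTensor_preserves_injective_linearMap _ hg)

theorem mem_range_map_ker (f : A →ₗ[K] X) (g : B →ₗ[K] Y) {z : A ⊗[K] B}
    (h₁ : f.rTensor B z = 0) (h₂ : g.lTensor A z = 0) :
    z ∈ LinearMap.range (TensorProduct.map (LinearMap.ker f).subtype (LinearMap.ker g).subtype) := by
  obtain ⟨y, rfl⟩ := mem_range_rTensor_ker f h₁
  have h3 : (LinearMap.ker f).subtype.rTensor Y (g.lTensor _ y) = 0 := by
    rw [← h₂, ← LinearMap.comp_apply, ← LinearMap.comp_apply, LinearMap.rTensor_comp_lTensor,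
      LinearMap.lTensor_comp_rTensor]
  have h4 : g.lTensor _ y = 0 := by
    have := Module.Flat.rTensor_preserves_injective_linearMap (M := Y)
      (LinearMap.ker f).subtype (Submodule.injective_subtype _)
    exact this (by rw [h3, map_zero])
  obtain ⟨w, rfl⟩ := mem_range_lTensor_ker g h4
  exact ⟨w, by rw [← LinearMap.rTensor_comp_lTensor]; rfl⟩

theorem rTensor_prod_eq_zero (f : A →ₗ[K] X) (g : A →ₗ[K] Y) {z : A ⊗[K] B}
    (h₁ : f.rTensor B z = 0) (h₂ : g.rTensor B z = 0) : (f.prod g).rTensor B z = 0 := by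
  apply (TensorProduct.prodLeft K K X Y B).injective
  have : ∀ z : A ⊗[K] B, TensorProduct.prodLeft K K X Y B ((f.prod g).rTensor B z) =
      (f.rTensor B z, g.rTensor B z) := by
    intro z
    induction z using TensorProduct.induction_on with
    | zero => simp only [map_zero]; rfl
    | tmul x y => simp
    | add x y hx hy => simp only [map_add, hx, hy, Prod.mk_add_mk]
  rw [this, h₁, h₂, map_zero]; rfl

theorem lTensor_prod_eq_zero (f : B →ₗ[K] X) (g : B →ₗ[K] Y) {z : A ⊗[K] B}
    (h₁ : f.lTensor A z = 0) (h₂ : g.lTensor A z = 0) : (f.prod g).lTensor A z = 0 := by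
  apply (TensorProduct.prodRight K K A X Y).injective
  have : ∀ z : A ⊗[K] B, TensorProduct.prodRight K K A X Y ((f.prod g).lTensor A z) =
      (f.lTensor A z, g.lTensor A z) := by
    intro z
    induction z using TensorProduct.induction_on with
    | zero => simp only [map_zero]; rfl
    | tmul x y => simp
    | add x y hx hy => simp only [map_add, hx, hy, Prod.mk_add_mk]
  rw [this, h₁, h₂, map_zero]; rfl

end Flat

section Sub

variable {K E : Type*} [Field K] [AddCommGroup E] [Module K E]
  (Δ : E →ₗ[K] E ⊗[K] E) (ε : E →ₗ[K] K) (V : Submodule K E)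

/-- If `Δ` maps the subspace `V` into `V ⊗ V`, its restriction `V → V ⊗ V`. -/
def subComul (h : ∀ v ∈ V, Δ v ∈ LinearMap.range (TensorProduct.map V.subtype V.subtype)) :
    V →ₗ[K] V ⊗[K] V :=
  (LinearEquiv.ofInjective (TensorProduct.map V.subtype V.subtype)
    (map_injective V.injective_subtype V.injective_subtype)).symm.toLinearMap ∘ₗ
    (Δ ∘ₗ V.subtype).codRestrict _ (fun v => h v v.2)

theorem map_subComul
    (h : ∀ v ∈ V, Δ v ∈ LinearMap.range (TensorProduct.map V.subtype V.subtype)) (v : V) :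
    TensorProduct.map V.subtype V.subtype (subComul Δ V h v) = Δ v := by
  have := LinearEquiv.ofInjective_apply (f := TensorProduct.map V.subtype V.subtype)
    (h := map_injective V.injective_subtype V.injective_subtype) (subComul Δ V h v)
  rw [← this, subComul]
  simp
  rfl

/-- A subspace `V` with `Δ V ⊆ V ⊗ V`, on which `Δ` is coassociative and counital, is a
coalgebra. -/
@[reducible] def subCoalgebra
    (h : ∀ v ∈ V, Δ v ∈ LinearMap.range (TensorProduct.map V.subtype V.subtype))
    (hassoc : ∀ v ∈ V, TensorProduct.assoc K E E E (Δ.rTensor E (Δ v)) = Δ.lTensor E (Δ v))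
    (hl : ∀ v ∈ V, ε.rTensor E (Δ v) = 1 ⊗ₜ v)
    (hr : ∀ v ∈ V, ε.lTensor E (Δ v) = v ⊗ₜ 1) : Coalgebra K V where
  comul := subComul Δ V h
  counit := ε ∘ₗ V.subtype
  coassoc := by
    ext v
    have inj := map_injective V.injective_subtype
      (map_injective V.injective_subtype V.injective_subtype)
    apply inj
    have k1 : ∀ z : V ⊗[K] V, TensorProduct.map V.subtype (TensorProduct.map V.subtype V.subtype)
        (TensorProduct.assoc K V V V ((subComul Δ V h).rTensor V z)) =
        TensorProduct.assoc K E E E (Δ.rTensor E (TensorProduct.map V.subtype V.subtype z)) := by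
      intro z
      induction z using TensorProduct.induction_on with
      | zero => simp
      | tmul x y =>
        simp only [LinearMap.rTensor_tmul, TensorProduct.map_tmul]
        rw [Submodule.subtype_apply, ← map_subComul Δ V h x]
        induction subComul Δ V h x using TensorProduct.induction_on with
        | zero => simp
        | tmul a b => simp
        | add a b ha hb => simp only [TensorProduct.add_tmul, map_add, ha, hb]
      | add x y hx hy => simp only [map_add, hx, hy]
    have k2 : ∀ z : V ⊗[K] V, TensorProduct.map V.subtype (TensorProduct.map V.subtype V.subtype)
        ((subComul Δ V h).lTensor V z) =
        Δ.lTensor E (TensorProduct.map V.subtype V.subtype z) := by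
      intro z
      induction z using TensorProduct.induction_on with
      | zero => simp
      | tmul x y => simp [map_subComul]
      | add x y hx hy => simp only [map_add, hx, hy]
    simp only [LinearMap.comp_apply, LinearEquiv.coe_coe, k1, k2, map_subComul]
    exact hassoc v v.2
  rTensor_counit_comp_comul := by
    ext v
    apply Module.Flat.lTensor_preserves_injective_linearMap (M := K) V.subtype V.injective_subtype
    have k1 : ∀ z : V ⊗[K] V, V.subtype.lTensor K ((ε ∘ₗ V.subtype).rTensor V z) =
        ε.rTensor E (TensorProduct.map V.subtype V.subtype z) := by
      intro z
      induction z using TensorProduct.induction_on with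
      | zero => simp
      | tmul x y => simp
      | add x y hx hy => simp only [map_add, hx, hy]
    simp only [LinearMap.comp_apply, k1, map_subComul, hl v v.2]
    simp
  lTensor_counit_comp_comul := by
    ext v
    apply Module.Flat.rTensor_preserves_injective_linearMap (M := K) V.subtype V.injective_subtype
    have k1 : ∀ z : V ⊗[K] V, V.subtype.rTensor K ((ε ∘ₗ V.subtype).lTensor V z) =
        ε.lTensor E (TensorProduct.map V.subtype V.subtype z) := by
      intro z
      induction z using TensorProduct.induction_on with
      | zero => simp
      | tmul x y => simp
      | add x y hx hy => simp only [map_add, hx, hy]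
    simp only [LinearMap.comp_apply, k1, map_subComul, hr v v.2]
    simp

end Sub

namespace HopfBimodule

variable {K H M : Type*} [Field K] [Ring H] [HopfAlgebra K H] [AddCommGroup M] [Module K M]
  (P : HopfBimodule K H M)

theorem junction_left {X : Type*} [AddCommGroup X] [Module K X]
    (D : TensorAlgebra K M →ₗ[K] X ⊗[K] TensorAlgebra K M)
    (h₁ : ∀ t, TensorProduct.assoc K _ _ _ (D.rTensor _ (tDec t)) = tDec.lTensor X (D t))
    (h₂ : ∀ t, TensorProduct.assoc K _ _ _ (D.rTensor H (P.tR t)) = P.tR.lTensor X (D t))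
    (t : TensorAlgebra K M) :
    P.junction.lTensor X (D t) =
      TensorProduct.assoc K _ _ _ (D.rTensor _ (P.junction t)) := by
  have e1 : P.junction.lTensor X (D t) =
    ((TensorProduct.assoc K _ _ _).toLinearMap ∘ₗ P.tR.rTensor _).lTensor X
      (tDec.lTensor X (D t)) - (P.tL.lTensor _).lTensor X (tDec.lTensor X (D t)) := by
    rw [junction, LinearMap.lTensor_sub, LinearMap.sub_apply, ← LinearMap.comp_assoc,
      LinearMap.lTensor_comp, LinearMap.lTensor_comp X (P.tL.lTensor _)]
    rfl
  rw [e1, ← h₁, assoc_lTensor_left D P.tR P.tR D h₂, assoc_lTensor_nat, junction]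
  simp only [LinearMap.sub_apply, map_sub]
  rfl

theorem junction_right {X : Type*} [AddCommGroup X] [Module K X]
    (D : TensorAlgebra K M →ₗ[K] TensorAlgebra K M ⊗[K] X)
    (h₁ : ∀ t, TensorProduct.assoc K _ _ _ (tDec.rTensor X (D t)) = D.lTensor _ (tDec t))
    (h₂ : ∀ t, TensorProduct.assoc K _ _ _ (P.tL.rTensor X (D t)) = D.lTensor H (P.tL t))
    (t : TensorAlgebra K M) :
    (TensorProduct.assoc K _ _ _).toLinearMap.lTensor _
      (TensorProduct.assoc K _ _ _ (P.junction.rTensor X (D t))) =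
      (D.lTensor H).lTensor _ (P.junction t) := by
  have e1 : P.junction.rTensor X (D t) =
    ((TensorProduct.assoc K _ _ _).toLinearMap ∘ₗ P.tR.rTensor _).rTensor X
      (tDec.rTensor X (D t)) - (P.tL.lTensor _).rTensor X (tDec.rTensor X (D t)) := by
    rw [junction, LinearMap.rTensor_sub, ← LinearMap.comp_assoc,
      LinearMap.rTensor_comp, LinearMap.rTensor_comp X (P.tL.lTensor _)]
    rfl
  have e2 : ((TensorProduct.assoc K _ _ _).toLinearMap ∘ₗ P.tL.rTensor X).lTensor
      (TensorAlgebra K M) (D.lTensor _ (tDec t)) =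
      (D.lTensor H).lTensor _ (P.tL.lTensor _ (tDec t)) := by
    generalize tDec t = z
    induction z using TensorProduct.induction_on with
    | zero => simp only [map_zero]
    | tmul x y =>
      simp only [LinearMap.lTensor_tmul, LinearMap.comp_apply, LinearEquiv.coe_coe, h₂]
    | add x y hx hy => simp only [map_add, hx, hy]
  rw [e1, map_sub, map_sub, assoc_penta, assoc_mid, h₁, e2, junction, LinearMap.sub_apply,
    map_sub]
  congr 1
  simp only [LinearMap.comp_apply, LinearEquiv.coe_coe]
  generalize tDec t = z
  induction z using TensorProduct.induction_on with
  | zero => simp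
  | tmul x y =>
    simp only [LinearMap.lTensor_tmul, LinearMap.rTensor_tmul]
    induction P.tR x using TensorProduct.induction_on with
    | zero => simp
    | tmul a b => simp
    | add a b ha hb => simp only [TensorProduct.add_tmul, map_add, ha, hb]
  | add x y hx hy => simp only [map_add, hx, hy]

end HopfBimodule

namespace HopfBimodule

variable {K H M : Type*} [Field K] [Ring H] [HopfAlgebra K H] [AddCommGroup M] [Module K M]
  (P : HopfBimodule K H M)

/-- The map `Δ` on `H ⊕ ⨁_{n ≥ 1} M^{⊗n}` (inside `H × T(M)`): it is `Δ_H` on `H`, and the sum of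
left coaction on the first factor, deconcatenation, and right coaction on the last factor on
`M^{⊗n}`. It is coassociative on the cotensor coalgebra. -/
def ambComul : (H × TensorAlgebra K M) →ₗ[K]
    (H × TensorAlgebra K M) ⊗[K] (H × TensorAlgebra K M) :=
  LinearMap.coprod
    (TensorProduct.map (LinearMap.inl K H (TensorAlgebra K M))
      (LinearMap.inl K H (TensorAlgebra K M)) ∘ₗ Coalgebra.comul)
    (TensorProduct.map (LinearMap.inl K H (TensorAlgebra K M))
        (LinearMap.inr K H (TensorAlgebra K M)) ∘ₗ P.tL +
      TensorProduct.map (LinearMap.inr K H (TensorAlgebra K M))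
        (LinearMap.inr K H (TensorAlgebra K M)) ∘ₗ tDec +
      TensorProduct.map (LinearMap.inr K H (TensorAlgebra K M))
        (LinearMap.inl K H (TensorAlgebra K M)) ∘ₗ P.tR)

/-- The counit: `ε_H` on `H` and zero on `⨁_{n ≥ 1} M^{⊗n}`. -/
def ambCounit (K H M : Type*) [Field K] [Ring H] [HopfAlgebra K H] [AddCommGroup M]
    [Module K M] : (H × TensorAlgebra K M) →ₗ[K] K :=
  Coalgebra.counit ∘ₗ LinearMap.fst K H (TensorAlgebra K M)

/-- The subspace `H ⊕ ⨁_{n ≥ 1} M^{□n}` of `H × T(M)`: the pairs `(h, x)` such that `x` has no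
scalar component and `x` satisfies all cotensor conditions. -/
def cotSubmodule : Submodule K (H × TensorAlgebra K M) :=
  LinearMap.ker ((TensorAlgebra.algebraMapInv.toLinearMap.prod P.junction) ∘ₗ
    LinearMap.snd K H (TensorAlgebra K M))

theorem mem_cotSubmodule (a : H × TensorAlgebra K M) : a ∈ P.cotSubmodule ↔
    TensorAlgebra.algebraMapInv a.2 = 0 ∧ P.junction a.2 = 0 := by
  simp [cotSubmodule]

theorem ambComul_apply (a : H × TensorAlgebra K M) : P.ambComul a =
    TensorProduct.map (LinearMap.inl K H (TensorAlgebra K M))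
      (LinearMap.inl K H (TensorAlgebra K M)) (Coalgebra.comul a.1) +
    (TensorProduct.map (LinearMap.inl K H (TensorAlgebra K M))
        (LinearMap.inr K H (TensorAlgebra K M)) (P.tL a.2) +
      TensorProduct.map (LinearMap.inr K H (TensorAlgebra K M))
        (LinearMap.inr K H (TensorAlgebra K M)) (tDec a.2) +
      TensorProduct.map (LinearMap.inr K H (TensorAlgebra K M))
        (LinearMap.inl K H (TensorAlgebra K M)) (P.tR a.2)) := by
  simp [ambComul]

theorem aug_rTensor_tDec (t : TensorAlgebra K M) :
    TensorAlgebra.algebraMapInv.toLinearMap.rTensor _ (tDec t) = 0 := by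
  rw [← tPlus_rTensor_tDec, ← LinearMap.comp_apply, ← LinearMap.rTensor_comp]
  have : (TensorAlgebra.algebraMapInv (R := K) (M := M)).toLinearMap ∘ₗ tPlus = 0 := by
    ext1 t; exact aug_tPlus t
  rw [this]; simp

theorem aug_lTensor_tDec (t : TensorAlgebra K M) :
    TensorAlgebra.algebraMapInv.toLinearMap.lTensor _ (tDec t) = 0 := by
  rw [← tPlus_lTensor_tDec, ← LinearMap.comp_apply, ← LinearMap.lTensor_comp]
  have : (TensorAlgebra.algebraMapInv (R := K) (M := M)).toLinearMap ∘ₗ tPlus = 0 := by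
    ext1 t; exact aug_tPlus t
  rw [this]; simp

section
variable {Y : Type*} [AddCommGroup Y] [Module K Y] (j : Y →ₗ[K] H × TensorAlgebra K M)
  {Z : Type*} [AddCommGroup Z] [Module K Z] (g : TensorAlgebra K M →ₗ[K] Z)

theorem snd_rH (z : H ⊗[K] Y) : (g ∘ₗ LinearMap.snd K H (TensorAlgebra K M)).rTensor _
    (TensorProduct.map (LinearMap.inl K H (TensorAlgebra K M)) j z) = 0 := by
  induction z using TensorProduct.induction_on with
  | zero => simp
  | tmul x y => simp
  | add x y hx hy => simp only [map_add, hx, hy, add_zero]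

theorem snd_rT (z : TensorAlgebra K M ⊗[K] Y) :
    (g ∘ₗ LinearMap.snd K H (TensorAlgebra K M)).rTensor _
    (TensorProduct.map (LinearMap.inr K H (TensorAlgebra K M)) j z) =
    j.lTensor _ (g.rTensor _ z) := by
  induction z using TensorProduct.induction_on with
  | zero => simp
  | tmul x y => simp
  | add x y hx hy => simp only [map_add, hx, hy]

theorem snd_lH (z : Y ⊗[K] H) : (g ∘ₗ LinearMap.snd K H (TensorAlgebra K M)).lTensor _
    (TensorProduct.map j (LinearMap.inl K H (TensorAlgebra K M)) z) = 0 := by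
  induction z using TensorProduct.induction_on with
  | zero => simp
  | tmul x y => simp
  | add x y hx hy => simp only [map_add, hx, hy, add_zero]

theorem snd_lT (z : Y ⊗[K] TensorAlgebra K M) :
    (g ∘ₗ LinearMap.snd K H (TensorAlgebra K M)).lTensor _
    (TensorProduct.map j (LinearMap.inr K H (TensorAlgebra K M)) z) =
    j.rTensor _ (g.lTensor _ z) := by
  induction z using TensorProduct.induction_on with
  | zero => simp
  | tmul x y => simp
  | add x y hx hy => simp only [map_add, hx, hy]

theorem counit_rH (z : H ⊗[K] Y) : TensorProduct.lid K _ ((ambCounit K H M).rTensor _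
    (TensorProduct.map (LinearMap.inl K H (TensorAlgebra K M)) j z)) =
    j (TensorProduct.lid K _ ((Coalgebra.counit (R := K)).rTensor _ z)) := by
  induction z using TensorProduct.induction_on with
  | zero => simp
  | tmul x y => simp [ambCounit]
  | add x y hx hy => simp only [map_add, hx, hy]

theorem counit_rT (z : TensorAlgebra K M ⊗[K] Y) : (ambCounit K H M).rTensor _
    (TensorProduct.map (LinearMap.inr K H (TensorAlgebra K M)) j z) = 0 := by
  induction z using TensorProduct.induction_on with
  | zero => simp
  | tmul x y => simp [ambCounit]
  | add x y hx hy => simp only [map_add, hx, hy, add_zero]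

theorem counit_lH (z : Y ⊗[K] H) : TensorProduct.rid K _ ((ambCounit K H M).lTensor _
    (TensorProduct.map j (LinearMap.inl K H (TensorAlgebra K M)) z)) =
    j (TensorProduct.rid K _ ((Coalgebra.counit (R := K)).lTensor _ z)) := by
  induction z using TensorProduct.induction_on with
  | zero => simp
  | tmul x y => simp [ambCounit]
  | add x y hx hy => simp only [map_add, hx, hy]

theorem counit_lT (z : Y ⊗[K] TensorAlgebra K M) : (ambCounit K H M).lTensor _
    (TensorProduct.map j (LinearMap.inr K H (TensorAlgebra K M)) z) = 0 := by
  induction z using TensorProduct.induction_on with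
  | zero => simp
  | tmul x y => simp [ambCounit]
  | add x y hx hy => simp only [map_add, hx, hy, add_zero]

end

theorem rTensor_snd_ambComul {Y : Type*} [AddCommGroup Y] [Module K Y]
    (g : TensorAlgebra K M →ₗ[K] Y) (a : H × TensorAlgebra K M)
    (h₁ : g.rTensor _ (tDec a.2) = 0) (h₂ : g.rTensor _ (P.tR a.2) = 0) :
    (g ∘ₗ LinearMap.snd K H (TensorAlgebra K M)).rTensor _ (P.ambComul a) = 0 := by
  rw [ambComul_apply]
  simp only [map_add, snd_rH, snd_rT, h₁, h₂, map_zero, add_zero]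

theorem lTensor_snd_ambComul {Y : Type*} [AddCommGroup Y] [Module K Y]
    (g : TensorAlgebra K M →ₗ[K] Y) (a : H × TensorAlgebra K M)
    (h₁ : g.lTensor _ (tDec a.2) = 0) (h₂ : g.lTensor _ (P.tL a.2) = 0) :
    (g ∘ₗ LinearMap.snd K H (TensorAlgebra K M)).lTensor _ (P.ambComul a) = 0 := by
  rw [ambComul_apply]
  simp only [map_add, snd_lH, snd_lT, h₁, h₂, map_zero, add_zero]

theorem junction_zero_right {X : Type*} [AddCommGroup X] [Module K X]
    (D : TensorAlgebra K M →ₗ[K] TensorAlgebra K M ⊗[K] X)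
    (h₁ : ∀ t, TensorProduct.assoc K _ _ _ (tDec.rTensor X (D t)) = D.lTensor _ (tDec t))
    (h₂ : ∀ t, TensorProduct.assoc K _ _ _ (P.tL.rTensor X (D t)) = D.lTensor H (P.tL t))
    (t : TensorAlgebra K M) (ht : P.junction t = 0) : P.junction.rTensor X (D t) = 0 := by
  have h := P.junction_right D h₁ h₂ t
  rw [ht, map_zero] at h
  have h' : (LinearEquiv.lTensor (TensorAlgebra K M)
    (TensorProduct.assoc K H (TensorAlgebra K M) X)) (TensorProduct.assoc K _ _ _
      (P.junction.rTensor X (D t))) = 0 := h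
  rwa [LinearEquiv.map_eq_zero_iff, LinearEquiv.map_eq_zero_iff] at h'

theorem ambComul_mem (a : H × TensorAlgebra K M) (ha : a ∈ P.cotSubmodule) :
    P.ambComul a ∈ LinearMap.range
      (TensorProduct.map P.cotSubmodule.subtype P.cotSubmodule.subtype) := by
  obtain ⟨-, h⟩ := (P.mem_cotSubmodule a).1 ha
  apply mem_range_map_ker
  · rw [LinearMap.prod_comp]
    apply rTensor_prod_eq_zero
    · exact P.rTensor_snd_ambComul _ a (aug_rTensor_tDec _) (P.aug_rTensor_tR _)
    · exact P.rTensor_snd_ambComul _ a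
        (P.junction_zero_right _ tDec_coassoc P.tL_tDec _ h)
        (P.junction_zero_right _ P.tDec_tR P.tL_tR _ h)
  · rw [LinearMap.prod_comp]
    apply lTensor_prod_eq_zero
    · exact P.lTensor_snd_ambComul _ a (aug_lTensor_tDec _) (P.aug_lTensor_tL _)
    · refine P.lTensor_snd_ambComul _ a ?_ ?_
      · rw [P.junction_left _ tDec_coassoc P.tDec_tR, h]; simp
      · rw [P.junction_left _ P.tL_tDec P.tL_tR, h]; simp

section
variable {Y : Type*} [AddCommGroup Y] [Module K Y] (j : Y →ₗ[K] H × TensorAlgebra K M)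

theorem amb_rH (z : H ⊗[K] Y) : TensorProduct.assoc K _ _ _ (P.ambComul.rTensor _
    (TensorProduct.map (LinearMap.inl K H (TensorAlgebra K M)) j z)) =
    TensorProduct.map (LinearMap.inl K H (TensorAlgebra K M))
      (TensorProduct.map (LinearMap.inl K H (TensorAlgebra K M)) j)
      (TensorProduct.assoc K _ _ _ ((Coalgebra.comul (R := K)).rTensor _ z)) := by
  induction z using TensorProduct.induction_on with
  | zero => simp
  | tmul x y =>
    simp only [TensorProduct.map_tmul, LinearMap.rTensor_tmul, ambComul_apply, LinearMap.inl_apply,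
      map_zero, add_zero]
    induction Coalgebra.comul (R := K) x using TensorProduct.induction_on with
    | zero => simp
    | tmul a b => simp
    | add a b ha hb => simp only [TensorProduct.add_tmul, map_add, ha, hb]
  | add x y hx hy => simp only [map_add, hx, hy]

theorem amb_rT (z : TensorAlgebra K M ⊗[K] Y) : TensorProduct.assoc K _ _ _ (P.ambComul.rTensor _
    (TensorProduct.map (LinearMap.inr K H (TensorAlgebra K M)) j z)) =
    TensorProduct.map (LinearMap.inl K H (TensorAlgebra K M))
      (TensorProduct.map (LinearMap.inr K H (TensorAlgebra K M)) j)
      (TensorProduct.assoc K _ _ _ (P.tL.rTensor _ z)) +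
    TensorProduct.map (LinearMap.inr K H (TensorAlgebra K M))
      (TensorProduct.map (LinearMap.inr K H (TensorAlgebra K M)) j)
      (TensorProduct.assoc K _ _ _ (tDec.rTensor _ z)) +
    TensorProduct.map (LinearMap.inr K H (TensorAlgebra K M))
      (TensorProduct.map (LinearMap.inl K H (TensorAlgebra K M)) j)
      (TensorProduct.assoc K _ _ _ (P.tR.rTensor _ z)) := by
  induction z using TensorProduct.induction_on with
  | zero => simp
  | tmul x y =>
    simp only [TensorProduct.map_tmul, LinearMap.rTensor_tmul, ambComul_apply, LinearMap.inr_apply,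
      map_zero, zero_add, TensorProduct.add_tmul, map_add]
    congr 1
    · congr 1
      · induction P.tL x using TensorProduct.induction_on with
        | zero => simp
        | tmul a b => simp
        | add a b ha hb => simp only [TensorProduct.add_tmul, map_add, ha, hb]
      · induction tDec x using TensorProduct.induction_on with
        | zero => simp
        | tmul a b => simp
        | add a b ha hb => simp only [TensorProduct.add_tmul, map_add, ha, hb]
    · induction P.tR x using TensorProduct.induction_on with
      | zero => simp
      | tmul a b => simp
      | add a b ha hb => simp only [TensorProduct.add_tmul, map_add, ha, hb]
  | add x y hx hy => simp only [map_add, hx, hy]; abel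

theorem amb_lH (z : Y ⊗[K] H) : P.ambComul.lTensor _
    (TensorProduct.map j (LinearMap.inl K H (TensorAlgebra K M)) z) =
    TensorProduct.map j (TensorProduct.map (LinearMap.inl K H (TensorAlgebra K M))
      (LinearMap.inl K H (TensorAlgebra K M))) ((Coalgebra.comul (R := K)).lTensor _ z) := by
  induction z using TensorProduct.induction_on with
  | zero => simp
  | tmul x y => simp [ambComul_apply]
  | add x y hx hy => simp only [map_add, hx, hy]

theorem amb_lT (z : Y ⊗[K] TensorAlgebra K M) : P.ambComul.lTensor _
    (TensorProduct.map j (LinearMap.inr K H (TensorAlgebra K M)) z) =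
    TensorProduct.map j (TensorProduct.map (LinearMap.inl K H (TensorAlgebra K M))
      (LinearMap.inr K H (TensorAlgebra K M))) (P.tL.lTensor _ z) +
    TensorProduct.map j (TensorProduct.map (LinearMap.inr K H (TensorAlgebra K M))
      (LinearMap.inr K H (TensorAlgebra K M))) (tDec.lTensor _ z) +
    TensorProduct.map j (TensorProduct.map (LinearMap.inr K H (TensorAlgebra K M))
      (LinearMap.inl K H (TensorAlgebra K M))) (P.tR.lTensor _ z) := by
  induction z using TensorProduct.induction_on with
  | zero => simp
  | tmul x y => simp [ambComul_apply, TensorProduct.tmul_add]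
  | add x y hx hy => simp only [map_add, hx, hy]; abel

end

theorem ambComul_coassoc (a : H × TensorAlgebra K M) (ha : a ∈ P.cotSubmodule) :
    TensorProduct.assoc K _ _ _ (P.ambComul.rTensor _ (P.ambComul a)) =
      P.ambComul.lTensor _ (P.ambComul a) := by
  obtain ⟨-, h⟩ := (P.mem_cotSubmodule a).1 ha
  have h' : TensorProduct.assoc K _ _ _ (P.tR.rTensor _ (tDec a.2)) =
    P.tL.lTensor _ (tDec a.2) := sub_eq_zero.1 h
  conv_lhs => rw [ambComul_apply]
  conv_rhs => rw [ambComul_apply]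
  simp only [map_add, amb_rH, amb_rT, amb_lH, amb_lT, h', tL_coassoc, tR_coassoc, tL_tR,
    tL_tDec, tDec_tR, tDec_coassoc, Coalgebra.coassoc_apply]
  abel

theorem ambCounit_left (a : H × TensorAlgebra K M) (ha : a ∈ P.cotSubmodule) :
    (ambCounit K H M).rTensor _ (P.ambComul a) = 1 ⊗ₜ a := by
  apply (TensorProduct.lid K _).injective
  rw [ambComul_apply]
  simp only [map_add, counit_rH, counit_rT, tL_counit, tPlus_of_aug ((P.mem_cotSubmodule a).1 ha).1,
    Coalgebra.rTensor_counit_comul]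
  simp

theorem ambCounit_right (a : H × TensorAlgebra K M) (ha : a ∈ P.cotSubmodule) :
    (ambCounit K H M).lTensor _ (P.ambComul a) = a ⊗ₜ 1 := by
  apply (TensorProduct.rid K _).injective
  rw [ambComul_apply]
  simp only [map_add, counit_lH, counit_lT, tR_counit, tPlus_of_aug ((P.mem_cotSubmodule a).1 ha).1,
    Coalgebra.lTensor_counit_comul]
  simp

/-- The cotensor coalgebra `Cot_H(M) = H ⊕ M ⊕ (M □ M) ⊕ ⋯`. -/
def Cot : Type _ := P.cotSubmodule

instance : AddCommGroup P.Cot := inferInstanceAs (AddCommGroup P.cotSubmodule)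
instance : Module K P.Cot := inferInstanceAs (Module K P.cotSubmodule)
instance : Coalgebra K P.Cot :=
  subCoalgebra P.ambComul (ambCounit K H M) P.cotSubmodule P.ambComul_mem P.ambComul_coassoc
    P.ambCounit_left P.ambCounit_right

/-- The inclusion of the cotensor coalgebra in `H × T(M)`. -/
def cotVal : P.Cot →ₗ[K] H × TensorAlgebra K M := P.cotSubmodule.subtype

theorem cotVal_injective : Function.Injective P.cotVal := P.cotSubmodule.injective_subtype

theorem map_comul_cot (a : P.Cot) :
    TensorProduct.map P.cotVal P.cotVal (Coalgebra.comul (R := K) a) = P.ambComul (P.cotVal a) :=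
  map_subComul P.ambComul P.cotSubmodule P.ambComul_mem a

theorem counit_cot (a : P.Cot) :
    Coalgebra.counit (R := K) a = Coalgebra.counit (R := K) (P.cotVal a).1 := rfl

section
variable {C : Type*} [AddCommGroup C] [Module K C]

/-- Corestriction of a linear map to the cotensor coalgebra. -/
def cotMk (g : C →ₗ[K] H × TensorAlgebra K M) (hg : ∀ c, g c ∈ P.cotSubmodule) : C →ₗ[K] P.Cot :=
  g.codRestrict P.cotSubmodule hg

theorem cotVal_cotMk (g : C →ₗ[K] H × TensorAlgebra K M) (hg : ∀ c, g c ∈ P.cotSubmodule) (c : C) :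
    P.cotVal (P.cotMk g hg c) = g c := rfl

theorem cotVal_comp_cotMk (g : C →ₗ[K] H × TensorAlgebra K M) (hg : ∀ c, g c ∈ P.cotSubmodule) :
    P.cotVal ∘ₗ P.cotMk g hg = g := rfl

end

end HopfBimodule

section Step

variable {K M C : Type*} [Field K] [AddCommGroup M] [Module K M] [AddCommGroup C] [Module K C]

/-- The operator `t ⊗ c ↦ ∑ t f(c₁) ⊗ c₂` on `T(M) ⊗ C`. -/
def stepE (Δ : C →ₗ[K] C ⊗[K] C) (f : C →ₗ[K] M) :
    TensorAlgebra K M ⊗[K] C →ₗ[K] TensorAlgebra K M ⊗[K] C :=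
  (LinearMap.mul' K (TensorAlgebra K M)).rTensor C ∘ₗ
    (TensorProduct.assoc K _ _ _).symm.toLinearMap ∘ₗ
    ((TensorAlgebra.ι K ∘ₗ f).rTensor C ∘ₗ Δ).lTensor (TensorAlgebra K M)

theorem stepE_tmul (Δ : C →ₗ[K] C ⊗[K] C) (f : C →ₗ[K] M) (t : TensorAlgebra K M) (c : C) :
    stepE Δ f (t ⊗ₜ c) = t • (TensorAlgebra.ι K ∘ₗ f).rTensor C (Δ c) := by
  have : ∀ w : TensorAlgebra K M ⊗[K] C, (LinearMap.mul' K (TensorAlgebra K M)).rTensor C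
      ((TensorProduct.assoc K _ _ _).symm (t ⊗ₜ w)) = t • w := by
    intro w
    induction w using TensorProduct.induction_on with
    | zero => simp
    | tmul x y => simp [TensorProduct.smul_tmul']
    | add x y hx hy => rw [TensorProduct.tmul_add, map_add, map_add, hx, hy, smul_add]
  simp [stepE, this]

theorem stepE_smul (Δ : C →ₗ[K] C ⊗[K] C) (f : C →ₗ[K] M) (t : TensorAlgebra K M)
    (z : TensorAlgebra K M ⊗[K] C) : stepE Δ f (t • z) = t • stepE Δ f z := by
  induction z using TensorProduct.induction_on with
  | zero => simp
  | tmul x y => rw [TensorProduct.smul_tmul', stepE_tmul, stepE_tmul, smul_assoc]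
  | add x y hx hy => rw [smul_add, map_add, map_add, hx, hy, smul_add]

theorem stepE_pow_smul (Δ : C →ₗ[K] C ⊗[K] C) (f : C →ₗ[K] M) (n : ℕ) (t : TensorAlgebra K M)
    (z : TensorAlgebra K M ⊗[K] C) :
    (stepE Δ f ^ n) (t • z) = t • (stepE Δ f ^ n) z := by
  induction n generalizing z with
  | zero => simp
  | succ n ih => rw [pow_succ, Module.End.mul_apply, Module.End.mul_apply, stepE_smul, ih]

/-- Local nilpotency: for each `c`, the sums `∑ f(c₁) ⊗ ⋯ ⊗ f(cₙ) ⊗ cₙ₊₁` vanish for large `n`. -/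
def LocNil (Δ : C →ₗ[K] C ⊗[K] C) (f : C →ₗ[K] M) : Prop :=
  ∀ c, ∃ n, (stepE Δ f ^ n) (1 ⊗ₜ c) = 0

theorem LocNil.all {Δ : C →ₗ[K] C ⊗[K] C} {f : C →ₗ[K] M} (h : LocNil Δ f)
    (z : TensorAlgebra K M ⊗[K] C) : ∃ n, (stepE Δ f ^ n) z = 0 := by
  induction z using TensorProduct.induction_on with
  | zero => exact ⟨0, map_zero _⟩
  | tmul x y =>
    obtain ⟨n, hn⟩ := h y
    refine ⟨n, ?_⟩
    have : x ⊗ₜ[K] y = x • ((1 : TensorAlgebra K M) ⊗ₜ[K] y) := by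
      simp [TensorProduct.smul_tmul']
    rw [this, stepE_pow_smul, hn, smul_zero]
  | add x y hx hy =>
    obtain ⟨n, hn⟩ := hx
    obtain ⟨m, hm⟩ := hy
    refine ⟨m + n, ?_⟩
    rw [map_add, pow_add, Module.End.mul_apply, hn, map_zero, zero_add, ← pow_add, add_comm,
      pow_add, Module.End.mul_apply, hm, map_zero]

theorem LocNil.bijective {Δ : C →ₗ[K] C ⊗[K] C} {f : C →ₗ[K] M} (h : LocNil Δ f) :
    Function.Bijective (LinearMap.id - stepE Δ f :
      TensorAlgebra K M ⊗[K] C →ₗ[K] TensorAlgebra K M ⊗[K] C) := by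
  constructor
  · rw [← LinearMap.ker_eq_bot, LinearMap.ker_eq_bot']
    intro z hz
    have hz' : stepE Δ f z = z := (sub_eq_zero.1 hz).symm
    obtain ⟨n, hn⟩ := h.all z
    have : ∀ n, (stepE Δ f ^ n) z = z := by
      intro n
      induction n with
      | zero => rfl
      | succ n ih => rw [pow_succ, Module.End.mul_apply, hz', ih]
    rw [← this n, hn]
  · intro z
    obtain ⟨n, hn⟩ := h.all z
    refine ⟨∑ k ∈ Finset.range n, (stepE Δ f ^ k) z, ?_⟩
    have : ∀ n, (LinearMap.id - stepE Δ f :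
        TensorAlgebra K M ⊗[K] C →ₗ[K] TensorAlgebra K M ⊗[K] C)
        (∑ k ∈ Finset.range n, (stepE Δ f ^ k) z) =
        z - (stepE Δ f ^ n) z := by
      intro n
      induction n with
      | zero => simp
      | succ n ih =>
        rw [Finset.sum_range_succ, map_add, ih, pow_succ', Module.End.mul_apply]
        simp
    rw [this, hn, sub_zero]

/-- The action map `T(M) ⊗ X → X`. -/
def smulMap (X : Type*) [AddCommGroup X] [Module K X] [Module (TensorAlgebra K M) X]
    [IsScalarTower K (TensorAlgebra K M) X] : TensorAlgebra K M ⊗[K] X →ₗ[K] X :=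
  TensorProduct.lift (Algebra.lsmul K K (A := TensorAlgebra K M) X).toLinearMap

@[simp] theorem smulMap_tmul (X : Type*) [AddCommGroup X] [Module K X]
    [Module (TensorAlgebra K M) X] [IsScalarTower K (TensorAlgebra K M) X]
    (t : TensorAlgebra K M) (x : X) : smulMap (K := K) (M := M) X (t ⊗ₜ x) = t • x := rfl

theorem LocNil.eq_zero {Δ : C →ₗ[K] C ⊗[K] C} {f : C →ₗ[K] M} (h : LocNil Δ f)
    {X : Type*} [AddCommGroup X] [Module K X]
    [Module (TensorAlgebra K M) X] [IsScalarTower K (TensorAlgebra K M) X] (Z : C →ₗ[K] X)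
    (hZ : ∀ c, Z c = smulMap X (TensorProduct.map (TensorAlgebra.ι K ∘ₗ f) Z (Δ c))) (c : C) :
    Z c = 0 := by
  have hsm : ∀ (t : TensorAlgebra K M) (w : TensorAlgebra K M ⊗[K] C),
      smulMap X (Z.lTensor _ (t • w)) = t • smulMap X (Z.lTensor _ w) := by
    intro t w
    induction w using TensorProduct.induction_on with
    | zero => simp
    | tmul x y => simp [TensorProduct.smul_tmul', smul_smul]
    | add x y hx hy => simp only [smul_add, map_add, hx, hy]
  have key : ∀ z, smulMap X (Z.lTensor _ (stepE Δ f z)) = smulMap X (Z.lTensor _ z) := by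
    intro z
    induction z using TensorProduct.induction_on with
    | zero => simp
    | tmul t c =>
      rw [stepE_tmul, hsm, LinearMap.lTensor_tmul, smulMap_tmul, hZ c,
        ← LinearMap.lTensor_comp_rTensor]
      rfl
    | add x y hx hy => simp only [map_add, hx, hy]
  have key2 : ∀ n z, smulMap X (Z.lTensor _ ((stepE Δ f ^ n) z)) =
      smulMap X (Z.lTensor _ z) := by
    intro n z
    induction n with
    | zero => rfl
    | succ n ih => rw [pow_succ', Module.End.mul_apply, key, ih]
  obtain ⟨n, hn⟩ := h c
  have := key2 n (1 ⊗ₜ c)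
  rw [hn, map_zero, map_zero] at this
  simpa using this.symm

theorem aug_smulMap (f : C →ₗ[K] M) (g : C →ₗ[K] TensorAlgebra K M) (w : C ⊗[K] C) :
    TensorAlgebra.algebraMapInv
      (smulMap _ (TensorProduct.map (TensorAlgebra.ι K ∘ₗ f) g w)) = 0 := by
  induction w using TensorProduct.induction_on with
  | zero => simp
  | tmul x y => simp [TensorAlgebra.algebraMapInv]
  | add x y hx hy => simp only [map_add, hx, hy, add_zero]

theorem map_sub_right' {A B C D : Type*} [AddCommGroup A] [Module K A] [AddCommGroup B] [Module K B]
    [AddCommGroup C] [Module K C] [AddCommGroup D] [Module K D]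
    (f : A →ₗ[K] C) (g g' : B →ₗ[K] D) :
    TensorProduct.map f (g - g') = TensorProduct.map f g - TensorProduct.map f g' := by
  ext a b
  simp [TensorProduct.tmul_sub]

end Step

namespace HopfBimodule

variable {K H M : Type*} [Field K] [Ring H] [HopfAlgebra K H] [AddCommGroup M] [Module K M]
  (P : HopfBimodule K H M)
  {C : Type*} [AddCommGroup C] [Module K C] [Coalgebra K C]

section GF
variable {f : C →ₗ[K] M} (h : LocNil Coalgebra.comul f)

/-- `c ↦ ε(c) 1 + ∑_{n ≥ 1} ∑ f(c₁) ⊗ ⋯ ⊗ f(cₙ)`. -/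
def expG : C →ₗ[K] TensorAlgebra K M :=
  (TensorProduct.rid K _).toLinearMap ∘ₗ (Coalgebra.counit (R := K)).lTensor _ ∘ₗ
    (LinearEquiv.ofBijective _ h.bijective).symm.toLinearMap ∘ₗ TensorProduct.mk K _ _ 1

/-- `c ↦ ∑_{n ≥ 1} ∑ f(c₁) ⊗ ⋯ ⊗ f(cₙ)`. -/
def expF : C →ₗ[K] TensorAlgebra K M := tPlus ∘ₗ expG h

theorem expG_eq (c : C) : expG h c = algebraMap K _ (Coalgebra.counit (R := K) c) +
    smulMap _ (TensorProduct.map (TensorAlgebra.ι K ∘ₗ f) (expG h) (Coalgebra.comul c)) := by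
  set S := (LinearEquiv.ofBijective _ h.bijective).symm with hS
  have hS1 : ∀ z, S z = z + S (stepE Coalgebra.comul f z) := by
    intro z
    apply (LinearEquiv.ofBijective _ h.bijective).injective
    rw [map_add, hS, LinearEquiv.apply_symm_apply, LinearEquiv.apply_symm_apply]
    simp
  have hS2 : ∀ (t : TensorAlgebra K M) z, S (t • z) = t • S z := by
    intro t z
    apply (LinearEquiv.ofBijective _ h.bijective).injective
    rw [hS, LinearEquiv.apply_symm_apply]
    have h2 : ∀ u, (LinearEquiv.ofBijective _ h.bijective) (t • u) =
        t • (LinearEquiv.ofBijective _ h.bijective) u := by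
      intro u
      simp only [LinearEquiv.ofBijective_apply, LinearMap.sub_apply, LinearMap.id_apply,
        stepE_smul, smul_sub]
    rw [h2, LinearEquiv.apply_symm_apply]
  set R := (TensorProduct.rid K _).toLinearMap ∘ₗ
    (Coalgebra.counit (R := K) (A := C)).lTensor (TensorAlgebra K M) ∘ₗ S.toLinearMap with hR
  have hR1 : ∀ c, expG h c = R (1 ⊗ₜ c) := fun c => rfl
  have hR2 : ∀ t c, R (t ⊗ₜ c) = t * expG h c := by
    intro t c
    have : t ⊗ₜ[K] c = t • ((1 : TensorAlgebra K M) ⊗ₜ[K] c) := by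
      simp [TensorProduct.smul_tmul']
    rw [this, hR1]
    simp only [hR, LinearMap.comp_apply, LinearEquiv.coe_coe]
    rw [hS2, lTensor_t_smul, rid_t_smul]
  have hR3 : ∀ w : C ⊗[K] C, R ((TensorAlgebra.ι K ∘ₗ f).rTensor C w) =
      smulMap _ (TensorProduct.map (TensorAlgebra.ι K ∘ₗ f) (expG h) w) := by
    intro w
    induction w using TensorProduct.induction_on with
    | zero => simp
    | tmul x y => simp [hR2]
    | add x y hx hy => simp only [map_add, hx, hy]
  rw [hR1, ← hR3]
  have e1 : ∀ z, R z = TensorProduct.rid K _ ((Coalgebra.counit (R := K)).lTensor _ (S z)) :=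
    fun z => rfl
  rw [e1, hS1, map_add, map_add, ← e1, stepE_tmul, one_smul]
  congr 1
  simp [Algebra.algebraMap_eq_smul_one]

theorem aug_expG (c : C) :
    TensorAlgebra.algebraMapInv (expG h c) = Coalgebra.counit (R := K) c := by
  rw [expG_eq, map_add, aug_smulMap, add_zero, TensorAlgebra.algebraMap_leftInverse]

theorem expF_eq (c : C) : expF h c =
    smulMap _ (TensorProduct.map (TensorAlgebra.ι K ∘ₗ f) (expG h) (Coalgebra.comul c)) := by
  rw [expF, LinearMap.comp_apply, tPlus, LinearMap.sub_apply, LinearMap.comp_apply,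
    AlgHom.toLinearMap_apply, AlgHom.toLinearMap_apply, aug_expG, Algebra.ofId_apply,
    LinearMap.id_apply, sub_eq_iff_eq_add', expG_eq h c]

theorem expG_eq_add (c : C) : expG h c = algebraMap K _ (Coalgebra.counit (R := K) c) +
    expF h c := by
  rw [expF_eq, ← expG_eq]

/-- `c ↦ ∑ F(c₁) ⊗ g(c₂)` satisfies the same recursion. -/
theorem conv_expF {Q : Type*} [AddCommGroup Q] [Module K Q] (g : C →ₗ[K] Q) (c : C) :
    TensorProduct.map (expF h) g (Coalgebra.comul (R := K) c) =
      TensorProduct.map (TensorAlgebra.ι K ∘ₗ f) g (Coalgebra.comul (R := K) c) +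
      smulMap (TensorAlgebra K M ⊗[K] Q) (TensorProduct.map (TensorAlgebra.ι K ∘ₗ f)
        (TensorProduct.map (expF h) g ∘ₗ Coalgebra.comul) (Coalgebra.comul (R := K) c)) := by
  have k1 : ∀ w : C ⊗[K] C, TensorProduct.map (expF h) g w =
      smulMap (TensorAlgebra K M ⊗[K] Q) (TensorProduct.map (TensorAlgebra.ι K ∘ₗ f)
        (TensorProduct.map (expG h) g) (TensorProduct.assoc K _ _ _
          ((Coalgebra.comul (R := K)).rTensor C w))) := by
    intro w
    induction w using TensorProduct.induction_on with
    | zero => simp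
    | tmul x y =>
      rw [TensorProduct.map_tmul, expF_eq, LinearMap.rTensor_tmul]
      induction Coalgebra.comul (R := K) x using TensorProduct.induction_on with
      | zero => simp
      | tmul a b => simp [TensorProduct.smul_tmul']
      | add a b ha hb => simp only [TensorProduct.add_tmul, map_add, ha, hb]
    | add x y hx hy => simp only [map_add, hx, hy]
  have k2 : ∀ w : C ⊗[K] C, TensorProduct.map (TensorAlgebra.ι K ∘ₗ f)
      (TensorProduct.map (expG h) g) ((Coalgebra.comul (R := K)).lTensor C w) =
      TensorProduct.map (TensorAlgebra.ι K ∘ₗ f) (TensorProduct.mk K _ _ 1 ∘ₗ g) w +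
      TensorProduct.map (TensorAlgebra.ι K ∘ₗ f)
        (TensorProduct.map (expF h) g ∘ₗ Coalgebra.comul) w := by
    have k3 : ∀ y : C, TensorProduct.map (expG h) g (Coalgebra.comul (R := K) y) =
        1 ⊗ₜ g y + TensorProduct.map (expF h) g (Coalgebra.comul (R := K) y) := by
      intro y
      have e : expG h = Algebra.linearMap K _ ∘ₗ Coalgebra.counit + expF h := by
        ext1 c; exact expG_eq_add h c
      rw [e, TensorProduct.map_add_left, LinearMap.add_apply]
      congr 1
      have : TensorProduct.map (Algebra.linearMap K (TensorAlgebra K M) ∘ₗ Coalgebra.counit) g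
          (Coalgebra.comul (R := K) y) =
          TensorProduct.map (Algebra.linearMap K (TensorAlgebra K M)) g
            ((Coalgebra.counit (R := K)).rTensor C (Coalgebra.comul (R := K) y)) := by
        generalize Coalgebra.comul (R := K) y = w
        induction w using TensorProduct.induction_on with
        | zero => simp
        | tmul x y => simp
        | add x y hx hy => simp only [map_add, hx, hy]
      rw [this, Coalgebra.rTensor_counit_comul]
      simp
    intro w
    induction w using TensorProduct.induction_on with
    | zero => simp
    | tmul x y => simp [k3, TensorProduct.tmul_add]
    | add x y hx hy => simp only [map_add, hx, hy]; abel
  rw [k1, Coalgebra.coassoc_apply, k2, map_add]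
  congr 1
  generalize Coalgebra.comul (R := K) c = w
  induction w using TensorProduct.induction_on with
  | zero => simp
  | tmul x y => simp [TensorProduct.smul_tmul']
  | add x y hx hy => simp only [map_add, hx, hy]

theorem tDec_expF (c : C) :
    tDec (expF h c) = TensorProduct.map (expF h) (expF h) (Coalgebra.comul (R := K) c) := by
  rw [← sub_eq_zero]
  refine h.eq_zero (tDec ∘ₗ expF h - TensorProduct.map (expF h) (expF h) ∘ₗ Coalgebra.comul) ?_ c
  intro c
  have k : ∀ w : C ⊗[K] C, tDec (smulMap _ (TensorProduct.map (TensorAlgebra.ι K ∘ₗ f)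
      (expG h) w)) = TensorProduct.map (TensorAlgebra.ι K ∘ₗ f) (expF h) w +
      smulMap _ (TensorProduct.map (TensorAlgebra.ι K ∘ₗ f) (tDec ∘ₗ expF h) w) := by
    intro w
    induction w using TensorProduct.induction_on with
    | zero => simp
    | tmul x y => simp [expF, tDec_tPlus]
    | add x y hx hy => simp only [map_add, hx, hy]; abel
  rw [LinearMap.sub_apply, LinearMap.comp_apply, LinearMap.comp_apply, expF_eq, k, conv_expF,
    map_sub_right', LinearMap.sub_apply, map_sub]
  abel

theorem tProj_expF (c : C) : tProj (expF h c) = f c := by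
  have k : ∀ w : C ⊗[K] C, tProj (smulMap _ (TensorProduct.map (TensorAlgebra.ι K ∘ₗ f)
      (expG h) w)) = f (TensorProduct.rid K _ ((Coalgebra.counit (R := K)).lTensor C w)) := by
    intro w
    induction w using TensorProduct.induction_on with
    | zero => simp
    | tmul x y => simp [aug_expG]
    | add x y hx hy => simp only [map_add, hx, hy]
  rw [expF_eq, k, Coalgebra.lTensor_counit_comul]
  simp

end GF

section Lift

variable (f₀ : C →ₗc[K] H) (f : C →ₗ[K] M)

theorem tL_expF
    (hl : ∀ c, P.lcoact (f c) = TensorProduct.map f₀.toLinearMap f (Coalgebra.comul (R := K) c))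
    (h : LocNil Coalgebra.comul f) (c : C) : P.tL (expF h c) =
    TensorProduct.map f₀.toLinearMap (expF h) (Coalgebra.comul (R := K) c) := by
  have k1 : ∀ w : C ⊗[K] C, P.tL (smulMap _ (TensorProduct.map (TensorAlgebra.ι K ∘ₗ f)
      (expG h) w)) = TensorProduct.map f₀.toLinearMap
        (smulMap _ ∘ₗ TensorProduct.map (TensorAlgebra.ι K ∘ₗ f) (expG h))
        (TensorProduct.assoc K _ _ _ ((Coalgebra.comul (R := K)).rTensor C w)) := by
    intro w
    induction w using TensorProduct.induction_on with
    | zero => simp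
    | tmul x y =>
      simp only [TensorProduct.map_tmul, LinearMap.comp_apply, smulMap_tmul, smul_eq_mul, tL_ι_mul,
        hl, LinearMap.rTensor_tmul]
      induction Coalgebra.comul (R := K) x using TensorProduct.induction_on with
      | zero => simp
      | tmul a b => simp
      | add a b ha hb => simp only [TensorProduct.add_tmul, map_add, ha, hb]
    | add x y hx hy => simp only [map_add, hx, hy]
  rw [expF_eq, k1, Coalgebra.coassoc_apply]
  rw [← LinearMap.comp_apply, LinearMap.map_comp_lTensor]
  congr 2
  ext1 c
  simp [expF_eq]

theorem tR_expF
    (hr : ∀ c, P.rcoact (f c) = TensorProduct.map f f₀.toLinearMap (Coalgebra.comul (R := K) c))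
    (h : LocNil Coalgebra.comul f) (c : C) : P.tR (expF h c) =
    TensorProduct.map (expF h) f₀.toLinearMap (Coalgebra.comul (R := K) c) := by
  rw [← sub_eq_zero]
  refine h.eq_zero (P.tR ∘ₗ expF h -
    TensorProduct.map (expF h) f₀.toLinearMap ∘ₗ Coalgebra.comul) ?_ c
  intro c
  have k : ∀ w : C ⊗[K] C, P.tR (smulMap _ (TensorProduct.map (TensorAlgebra.ι K ∘ₗ f)
      (expG h) w)) =
      TensorProduct.map (TensorAlgebra.ι K ∘ₗ f) f₀.toLinearMap (Coalgebra.comul (R := K)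
        (TensorProduct.rid K _ ((Coalgebra.counit (R := K)).lTensor C w))) +
      smulMap _ (TensorProduct.map (TensorAlgebra.ι K ∘ₗ f) (P.tR ∘ₗ expF h) w) := by
    intro w
    induction w using TensorProduct.induction_on with
    | zero => simp
    | tmul x y =>
      have e : (TensorAlgebra.ι K).rTensor H (TensorProduct.map f f₀.toLinearMap
          (Coalgebra.comul (R := K) x)) = TensorProduct.map (TensorAlgebra.ι K ∘ₗ f)
          f₀.toLinearMap (Coalgebra.comul (R := K) x) := by
        rw [← LinearMap.comp_apply, LinearMap.rTensor_comp_map]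
      simp only [TensorProduct.map_tmul, LinearMap.comp_apply, smulMap_tmul, smul_eq_mul, tR_ι_mul,
        hr, aug_expG, LinearMap.lTensor_tmul, TensorProduct.rid_tmul, map_smul, e, expF, tR_tPlus]
    | add x y hx hy => simp only [map_add, hx, hy]; abel
  rw [LinearMap.sub_apply, LinearMap.comp_apply, LinearMap.comp_apply, expF_eq, k, conv_expF,
    map_sub_right', LinearMap.sub_apply, map_sub, Coalgebra.lTensor_counit_comul]
  simp only [TensorProduct.rid_tmul, one_smul]
  abel

theorem expF_mem
    (hl : ∀ c, P.lcoact (f c) = TensorProduct.map f₀.toLinearMap f (Coalgebra.comul (R := K) c))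
    (hr : ∀ c, P.rcoact (f c) = TensorProduct.map f f₀.toLinearMap (Coalgebra.comul (R := K) c))
    (h : LocNil Coalgebra.comul f) (c : C) :
    (f₀.toLinearMap.prod (expF h)) c ∈ P.cotSubmodule := by
  rw [mem_cotSubmodule]
  refine ⟨aug_tPlus _, ?_⟩
  simp only [junction, LinearMap.sub_apply, LinearMap.comp_apply, LinearEquiv.coe_coe]
  have k1 : ∀ w : C ⊗[K] C, TensorProduct.assoc K _ _ _ (P.tR.rTensor _
      (TensorProduct.map (expF h) (expF h) w)) = TensorProduct.map (expF h)
        (TensorProduct.map f₀.toLinearMap (expF h)) (TensorProduct.assoc K _ _ _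
          ((Coalgebra.comul (R := K)).rTensor C w)) := by
    intro w
    induction w using TensorProduct.induction_on with
    | zero => simp
    | tmul x y =>
      simp only [TensorProduct.map_tmul, LinearMap.rTensor_tmul, P.tR_expF f₀ f hr h]
      induction Coalgebra.comul (R := K) x using TensorProduct.induction_on with
      | zero => simp
      | tmul a b => simp
      | add a b ha hb => simp only [TensorProduct.add_tmul, map_add, ha, hb]
    | add x y hx hy => simp only [map_add, hx, hy]
  have k2 : ∀ w : C ⊗[K] C, P.tL.lTensor _
      (TensorProduct.map (expF h) (expF h) w) = TensorProduct.map (expF h)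
        (TensorProduct.map f₀.toLinearMap (expF h))
          ((Coalgebra.comul (R := K)).lTensor C w) := by
    intro w
    induction w using TensorProduct.induction_on with
    | zero => simp
    | tmul x y => simp [P.tL_expF f₀ f hl h]
    | add x y hx hy => simp only [map_add, hx, hy]
  rw [show ((f₀.toLinearMap.prod (expF h)) c).2 = expF h c from rfl, tDec_expF, k1, k2,
    Coalgebra.coassoc_apply, sub_self]

/-- The universal property of the cotensor coalgebra (existence): `c ↦ f₀(c) + ∑_{n ≥ 1}
∑ f(c₁) □ ⋯ □ f(cₙ)` is a coalgebra map `C → Cot_H(M)`. -/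
def cotLift
    (hl : ∀ c, P.lcoact (f c) = TensorProduct.map f₀.toLinearMap f (Coalgebra.comul (R := K) c))
    (hr : ∀ c, P.rcoact (f c) = TensorProduct.map f f₀.toLinearMap (Coalgebra.comul (R := K) c))
    (h : LocNil Coalgebra.comul f) : C →ₗc[K] P.Cot where
  toLinearMap := P.cotMk (f₀.toLinearMap.prod (expF h)) (P.expF_mem f₀ f hl hr h)
  counit_comp := by
    ext c
    rw [LinearMap.comp_apply, counit_cot, cotVal_cotMk]
    exact CoalgHomClass.counit_comp_apply f₀ c
  map_comp_comul := by
    ext c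
    apply map_injective P.cotVal_injective P.cotVal_injective
    rw [LinearMap.comp_apply, LinearMap.comp_apply, map_comul_cot, cotVal_cotMk, ambComul_apply,
      ← LinearMap.comp_apply (TensorProduct.map P.cotVal P.cotVal), ← TensorProduct.map_comp,
      cotVal_comp_cotMk]
    have e : f₀.toLinearMap.prod (expF h) = LinearMap.inl K H _ ∘ₗ f₀.toLinearMap +
          LinearMap.inr K _ _ ∘ₗ expF h := by
      ext1 c
      simp
    have e2 : Coalgebra.comul (R := K) (f₀ c) =
      TensorProduct.map f₀.toLinearMap f₀.toLinearMap (Coalgebra.comul (R := K) c) :=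
      (CoalgHomClass.map_comp_comul_apply f₀ c).symm
    have e3 : (f₀.toLinearMap.prod (expF h)) c = (f₀ c, expF h c) := rfl
    rw [e3, tDec_expF, P.tL_expF f₀ f hl h, P.tR_expF f₀ f hr h, e2, e]
    simp only [TensorProduct.map_add_left, TensorProduct.map_add_right, LinearMap.add_apply,
      TensorProduct.map_comp, LinearMap.comp_apply]
    abel

theorem cotVal_cotLift
    (hl : ∀ c, P.lcoact (f c) = TensorProduct.map f₀.toLinearMap f (Coalgebra.comul (R := K) c))
    (hr : ∀ c, P.rcoact (f c) = TensorProduct.map f f₀.toLinearMap (Coalgebra.comul (R := K) c))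
    (h : LocNil Coalgebra.comul f) (c : C) :
    P.cotVal (P.cotLift f₀ f hl hr h c) = (f₀ c, expF h c) := rfl

end Lift

end HopfBimodule

section Aux

variable {K M : Type*} [Field K] [AddCommGroup M] [Module K M]

theorem locNil_of_injective {C C' : Type*} [AddCommGroup C] [Module K C] [AddCommGroup C']
    [Module K C'] {Δ : C →ₗ[K] C ⊗[K] C} {f : C →ₗ[K] M} {Δ' : C' →ₗ[K] C' ⊗[K] C'}
    {f' : C' →ₗ[K] M} (i : C →ₗ[K] C') (hi : Function.Injective i)
    (hΔ : ∀ c, TensorProduct.map i i (Δ c) = Δ' (i c)) (hf : f' ∘ₗ i = f)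
    (h : ∀ c, ∃ n, (stepE Δ' f' ^ n) (1 ⊗ₜ i c) = 0) : LocNil Δ f := by
  have key : ∀ z, i.lTensor _ (stepE Δ f z) = stepE Δ' f' (i.lTensor _ z) := by
    intro z
    induction z using TensorProduct.induction_on with
    | zero => simp
    | tmul t c =>
      rw [stepE_tmul, lTensor_t_smul, LinearMap.lTensor_tmul, stepE_tmul, ← hΔ, ← hf]
      congr 1
      generalize Δ c = w
      induction w using TensorProduct.induction_on with
      | zero => simp
      | tmul x y => simp
      | add x y hx hy => simp only [map_add, hx, hy]
    | add x y hx hy => simp only [map_add, hx, hy]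
  have key2 : ∀ n z, i.lTensor _ ((stepE Δ f ^ n) z) = (stepE Δ' f' ^ n) (i.lTensor _ z) := by
    intro n z
    induction n with
    | zero => rfl
    | succ n ih => rw [pow_succ', Module.End.mul_apply, key, ih, pow_succ', Module.End.mul_apply]
  intro c
  obtain ⟨n, hn⟩ := h (c)
  refine ⟨n, Module.Flat.lTensor_preserves_injective_linearMap i hi ?_⟩
  rw [key2, LinearMap.lTensor_tmul, hn, map_zero]

theorem nil_add {C : Type*} [AddCommGroup C] [Module K C] {Δ : C →ₗ[K] C ⊗[K] C} {f : C →ₗ[K] M}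
    {x y : TensorAlgebra K M ⊗[K] C} (hx : ∃ n, (stepE Δ f ^ n) x = 0)
    (hy : ∃ n, (stepE Δ f ^ n) y = 0) : ∃ n, (stepE Δ f ^ n) (x + y) = 0 := by
  obtain ⟨n, hn⟩ := hx
  obtain ⟨m, hm⟩ := hy
  refine ⟨m + n, ?_⟩
  rw [map_add, pow_add, Module.End.mul_apply, hn, map_zero, zero_add, ← pow_add, add_comm,
    pow_add, Module.End.mul_apply, hm, map_zero]

/-- A local nilpotency criterion through a grading. -/
theorem locNil_of_graded {C : Type*} [AddCommGroup C] [Module K C] {Δ : C →ₗ[K] C ⊗[K] C}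
    {f : C →ₗ[K] M} (D : ℕ → Submodule K C) (hD : ⨆ n, D n = ⊤)
    (h0 : ∀ c ∈ D 0, f.rTensor C (Δ c) = 0)
    (hs : ∀ n, ∀ c ∈ D (n + 1), f.rTensor C (Δ c) ∈
      LinearMap.range ((D n).subtype.lTensor M)) : LocNil Δ f := by
  have e : ∀ c, stepE Δ f (1 ⊗ₜ c) = (TensorAlgebra.ι K).rTensor C (f.rTensor C (Δ c)) := by
    intro c
    rw [stepE_tmul, one_smul, LinearMap.rTensor_comp]; rfl
  have key : ∀ n, ∀ c ∈ D n, (stepE Δ f ^ (n + 1)) (1 ⊗ₜ c) = 0 := by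
    intro n
    induction n with
    | zero => intro c hc; rw [zero_add, pow_one, e, h0 c hc, map_zero]
    | succ n ih =>
      intro c hc
      rw [pow_succ, Module.End.mul_apply, e]
      obtain ⟨y, hy⟩ := hs n c hc
      rw [← hy]
      clear hy
      induction y using TensorProduct.induction_on with
      | zero => simp
      | tmul m d =>
        rw [LinearMap.lTensor_tmul, LinearMap.rTensor_tmul]
        have : TensorAlgebra.ι K m ⊗ₜ[K] ((D n).subtype d) =
          TensorAlgebra.ι K m • ((1 : TensorAlgebra K M) ⊗ₜ[K] (d : C)) := by
          simp [TensorProduct.smul_tmul']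
        rw [this, stepE_pow_smul, ih d d.2, smul_zero]
      | add x y hx hy => simp only [map_add, hx, hy, add_zero]
  intro c
  have hc : c ∈ ⨆ n, D n := hD ▸ Submodule.mem_top
  refine Submodule.iSup_induction D (motive := fun c => ∃ n, (stepE Δ f ^ n) (1 ⊗ₜ c) = 0) hc
    (fun n x hx => ⟨n + 1, key n x hx⟩) ⟨0, by simp⟩ (fun x y hx hy => ?_)
  rw [TensorProduct.tmul_add]
  exact nil_add hx hy

end Aux

namespace HopfBimodule

variable {K H M : Type*} [Field K] [Ring H] [HopfAlgebra K H] [AddCommGroup M] [Module K M]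
  (P : HopfBimodule K H M)

/-- The grading of `H × T(M)`, with `H` in degree zero and `M^{⊗n}` in degree `n`. -/
def ambGr (K H M : Type*) [Field K] [Ring H] [HopfAlgebra K H] [AddCommGroup M]
    [Module K M] (n : ℕ) : Submodule K (H × TensorAlgebra K M) :=
  Submodule.prod (if n = 0 then ⊤ else ⊥)
    (LinearMap.range (TensorAlgebra.ι K : M →ₗ[K] TensorAlgebra K M) ^ n)

theorem range_ι_pow_succ_induction {n : ℕ} {p : TensorAlgebra K M → Prop} (x : TensorAlgebra K M)
    (hx : x ∈ LinearMap.range (TensorAlgebra.ι K : M →ₗ[K] TensorAlgebra K M) ^ (n + 1))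
    (hadd : ∀ x y, p x → p y → p (x + y))
    (hmul : ∀ m, ∀ t ∈ LinearMap.range (TensorAlgebra.ι K : M →ₗ[K] TensorAlgebra K M) ^ n,
      p (TensorAlgebra.ι K m * t)) : p x := by
  rw [pow_succ'] at hx
  refine Submodule.mul_induction_on hx ?_ hadd
  rintro _ ⟨m, rfl⟩ b hb
  exact hmul m b hb

theorem iSup_ambGr : ⨆ n, ambGr K H M n = ⊤ := by
  rw [eq_top_iff]
  rintro ⟨h, x⟩ -
  have e : (h, x) = (h, (0 : TensorAlgebra K M)) + ((0 : H), x) := by simp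
  rw [e]
  refine add_mem ?_ ?_
  · refine Submodule.mem_iSup_of_mem 0 ?_
    simp [ambGr]
  · have hx : x ∈ ⨆ n : ℕ, LinearMap.range (TensorAlgebra.ι K : M →ₗ[K] TensorAlgebra K M) ^ n := by
      rw [(DirectSum.Decomposition.isInternal
        ((LinearMap.range (TensorAlgebra.ι K : M →ₗ[K] TensorAlgebra K M) ^ ·) :
          ℕ → Submodule K _)).submodule_iSup_eq_top]
      trivial
    refine Submodule.iSup_induction _ (motive := fun x => ((0 : H), x) ∈ ⨆ n, ambGr K H M n) hx
      (fun n x hx => ?_) (zero_mem _) (fun x y hx hy => ?_)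
    · refine Submodule.mem_iSup_of_mem n ?_
      rw [ambGr, Submodule.mem_prod]
      exact ⟨zero_mem _, hx⟩
    · have : ((0 : H), x + y) = (0, x) + (0, y) := by simp
      rw [this]
      exact add_mem hx hy

theorem range_lTensor_of_comp {A B C : Type*} [AddCommGroup A] [Module K A] [AddCommGroup B]
    [Module K B] [AddCommGroup C] [Module K C] (D : Submodule K C) (g : B →ₗ[K] C)
    (hg : ∀ b, g b ∈ D) (z : A ⊗[K] B) :
    g.lTensor A z ∈ LinearMap.range (D.subtype.lTensor A) := by
  refine ⟨(g.codRestrict D hg).lTensor A z, ?_⟩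
  rw [← LinearMap.comp_apply, ← LinearMap.lTensor_comp]
  rfl

/-- the degree one projection `H × T(M) → M` -/
def ambProj (K H M : Type*) [Field K] [Ring H] [HopfAlgebra K H] [AddCommGroup M]
    [Module K M] : H × TensorAlgebra K M →ₗ[K] M :=
  tProj ∘ₗ LinearMap.snd K H (TensorAlgebra K M)

section
variable {Y : Type*} [AddCommGroup Y] [Module K Y] (j : Y →ₗ[K] H × TensorAlgebra K M)

theorem fst_rH (z : H ⊗[K] Y) : (LinearMap.fst K H (TensorAlgebra K M)).rTensor _
    (TensorProduct.map (LinearMap.inl K H (TensorAlgebra K M)) j z) = j.lTensor _ z := by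
  induction z using TensorProduct.induction_on with
  | zero => simp
  | tmul x y => simp
  | add x y hx hy => simp only [map_add, hx, hy]

theorem fst_rT (z : TensorAlgebra K M ⊗[K] Y) :
    (LinearMap.fst K H (TensorAlgebra K M)).rTensor _
    (TensorProduct.map (LinearMap.inr K H (TensorAlgebra K M)) j z) = 0 := by
  induction z using TensorProduct.induction_on with
  | zero => simp
  | tmul x y => simp
  | add x y hx hy => simp only [map_add, hx, hy, add_zero]

end

theorem fst_rTensor_ambComul (a : H × TensorAlgebra K M) :
    (LinearMap.fst K H (TensorAlgebra K M)).rTensor _ (P.ambComul a) =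
      (LinearMap.inl K H (TensorAlgebra K M)).lTensor H (Coalgebra.comul a.1) +
      (LinearMap.inr K H (TensorAlgebra K M)).lTensor H (P.tL a.2) := by
  rw [ambComul_apply]
  simp only [map_add, fst_rH, fst_rT, add_zero]

theorem ambProj_rTensor_ambComul (a : H × TensorAlgebra K M) :
    (ambProj K H M).rTensor _ (P.ambComul a) =
      (LinearMap.inr K H (TensorAlgebra K M)).lTensor M (tProj.rTensor _ (tDec a.2)) +
      (LinearMap.inl K H (TensorAlgebra K M)).lTensor M (tProj.rTensor _ (P.tR a.2)) := by
  rw [ambComul_apply, ambProj]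
  simp only [map_add, snd_rH, snd_rT, zero_add]

theorem tProj_rTensor_smul {X : Type*} [AddCommGroup X] [Module K X] (m : M)
    (z : TensorAlgebra K M ⊗[K] X) :
    tProj.rTensor X (TensorAlgebra.ι K m • z) = m ⊗ₜ
      TensorProduct.lid K _ (TensorAlgebra.algebraMapInv.toLinearMap.rTensor X z) := by
  induction z using TensorProduct.induction_on with
  | zero => simp
  | tmul x y =>
    rw [TensorProduct.smul_tmul', smul_eq_mul, LinearMap.rTensor_tmul, tProj_ι_mul,
      TensorProduct.smul_tmul, LinearMap.rTensor_tmul, TensorProduct.lid_tmul]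
    rfl
  | add x y hx hy => simp only [smul_add, map_add, hx, hy, TensorProduct.tmul_add]

theorem tProj_ι (m : M) : tProj (TensorAlgebra.ι K m) = m := by
  have := tProj_ι_mul m (1 : TensorAlgebra K M)
  rwa [mul_one, map_one, one_smul] at this

theorem tProj_tDec (m : M) (t : TensorAlgebra K M) :
    tProj.rTensor _ (tDec (TensorAlgebra.ι K m * t)) = m ⊗ₜ tPlus t := by
  rw [tDec_ι_mul, map_add, tProj_rTensor_smul, aug_rTensor_tDec, LinearMap.rTensor_tmul, tProj_ι]
  simp

theorem tProj_tR (x : TensorAlgebra K M) :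
    tProj.rTensor _ (P.tR x) = P.rcoact (tProj x) := by
  refine tExt (f := tProj.rTensor _ ∘ₗ P.tR) (g := P.rcoact ∘ₗ tProj) (by simp) ?_ x
  intro m t _
  have k : ∀ z : M ⊗[K] H, tProj.rTensor H ((TensorAlgebra.ι K).rTensor H z) = z := by
    intro z
    induction z using TensorProduct.induction_on with
    | zero => simp
    | tmul x y => simp [tProj_ι]
    | add x y hx hy => simp only [map_add, hx, hy]
  simp only [LinearMap.comp_apply, tR_ι_mul, map_add, map_smul, k, tProj_rTensor_smul,
    aug_rTensor_tR, tProj_ι_mul]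
  simp

theorem tProj_tL (x : TensorAlgebra K M) :
    tProj.lTensor _ (P.tL x) = P.lcoact (tProj x) := by
  refine tExt (f := tProj.lTensor _ ∘ₗ P.tL) (g := P.lcoact ∘ₗ tProj) (by simp) ?_ x
  intro m t _
  have k : ∀ z : H ⊗[K] M, tProj.lTensor H
      ((LinearMap.mulRight K t ∘ₗ TensorAlgebra.ι K).lTensor H z) =
      TensorAlgebra.algebraMapInv t • z := by
    intro z
    induction z using TensorProduct.induction_on with
    | zero => simp
    | tmul x y => simp
    | add x y hx hy => simp only [map_add, hx, hy, smul_add]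
  simp only [LinearMap.comp_apply, tL_ι_mul, k, tProj_ι_mul, map_smul]

theorem fst_ambComul_mem (n : ℕ) (a : H × TensorAlgebra K M) (ha : a ∈ ambGr K H M n) :
    (LinearMap.fst K H (TensorAlgebra K M)).rTensor _ (P.ambComul a) ∈
      LinearMap.range ((ambGr K H M n).subtype.lTensor H) := by
  rw [fst_rTensor_ambComul]
  obtain ⟨h, x⟩ := a
  rw [ambGr, Submodule.mem_prod] at ha
  obtain ⟨h1, h2⟩ := ha
  refine add_mem ?_ ?_
  · by_cases hn : n = 0
    · subst hn
      apply range_lTensor_of_comp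
      intro b
      simp [ambGr]
    · have : h = 0 := by simpa [hn] using h1
      simp [this]
  · cases n with
    | zero =>
      rw [pow_zero, Submodule.mem_one] at h2
      obtain ⟨r, rfl⟩ := h2
      simp [Algebra.algebraMap_eq_smul_one]
    | succ n =>
      dsimp only
      refine range_ι_pow_succ_induction (p := fun x =>
        (LinearMap.inr K H (TensorAlgebra K M)).lTensor H (P.tL x) ∈ LinearMap.range
          ((ambGr K H M (n + 1)).subtype.lTensor H)) x h2 (fun x y hx hy => ?_) (fun m t ht => ?_)
      · rw [map_add, map_add]; exact add_mem hx hy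
      · rw [tL_ι_mul, ← LinearMap.comp_apply, ← LinearMap.lTensor_comp]
        apply range_lTensor_of_comp
        intro b
        rw [ambGr, Submodule.mem_prod, pow_succ']
        exact ⟨zero_mem _, Submodule.mul_mem_mul ⟨b, rfl⟩ ht⟩

theorem proj_ambComul_zero (a : H × TensorAlgebra K M) (ha : a ∈ ambGr K H M 0) :
    (ambProj K H M).rTensor _ (P.ambComul a) = 0 := by
  rw [ambProj_rTensor_ambComul]
  obtain ⟨h, x⟩ := a
  rw [ambGr, Submodule.mem_prod, pow_zero, Submodule.mem_one] at ha
  obtain ⟨-, r, rfl⟩ := ha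
  simp [Algebra.algebraMap_eq_smul_one]

theorem proj_ambComul_mem (n : ℕ) (a : H × TensorAlgebra K M) (ha : a ∈ ambGr K H M (n + 1)) :
    (ambProj K H M).rTensor _ (P.ambComul a) ∈
      LinearMap.range ((ambGr K H M n).subtype.lTensor M) := by
  rw [ambProj_rTensor_ambComul]
  obtain ⟨h, x⟩ := a
  rw [ambGr, Submodule.mem_prod] at ha
  obtain ⟨-, h2⟩ := ha
  dsimp only at h2 ⊢
  refine range_ι_pow_succ_induction (p := fun x =>
    (LinearMap.inr K H (TensorAlgebra K M)).lTensor M (tProj.rTensor _ (tDec x)) +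
      (LinearMap.inl K H (TensorAlgebra K M)).lTensor M (tProj.rTensor _ (P.tR x)) ∈
      LinearMap.range ((ambGr K H M n).subtype.lTensor M)) x h2
    (fun x y hx hy => ?_) (fun m t ht => ?_)
  · simp only [map_add]
    rw [add_add_add_comm]
    exact add_mem hx hy
  · rw [tProj_tDec, tProj_tR, tProj_ι_mul]
    cases n with
    | zero =>
      rw [pow_zero, Submodule.mem_one] at ht
      obtain ⟨r, rfl⟩ := ht
      refine add_mem ?_ ?_
      · simp [Algebra.algebraMap_eq_smul_one, tPlus_one]
      · apply range_lTensor_of_comp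
        intro b
        simp [ambGr]
    | succ n =>
      have h1 : TensorAlgebra.algebraMapInv t = 0 := by
        refine range_ι_pow_succ_induction (p := fun t => TensorAlgebra.algebraMapInv t = 0) t ht
          (fun x y hx hy => ?_) (fun m t _ => algebraMapInv_ι_mul m t)
        rw [map_add, hx, hy, add_zero]
      rw [tPlus_of_aug h1, h1]
      refine add_mem ?_ ?_
      · refine ⟨m ⊗ₜ ⟨(0, t), ?_⟩, ?_⟩
        · rw [ambGr, Submodule.mem_prod]
          exact ⟨zero_mem _, ht⟩
        · simp
      · simp

/-- the degree one part of the multiplication: `a ⊗ b ↦ a₀.b₁ + a₁.b₀` -/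
def ambMulOne : (H × TensorAlgebra K M) ⊗[K] (H × TensorAlgebra K M) →ₗ[K] M :=
  TensorProduct.lift P.lact ∘ₗ TensorProduct.map (LinearMap.fst K H (TensorAlgebra K M))
    (ambProj K H M) +
  TensorProduct.lift P.ract ∘ₗ TensorProduct.map (ambProj K H M)
    (LinearMap.fst K H (TensorAlgebra K M))

/-- the comultiplication of a tensor product -/
def ambComul₂ : (H × TensorAlgebra K M) ⊗[K] (H × TensorAlgebra K M) →ₗ[K]
    ((H × TensorAlgebra K M) ⊗[K] (H × TensorAlgebra K M)) ⊗[K]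
      ((H × TensorAlgebra K M) ⊗[K] (H × TensorAlgebra K M)) :=
  (TensorProduct.tensorTensorTensorComm K _ _ _ _).toLinearMap ∘ₗ
    TensorProduct.map P.ambComul P.ambComul

theorem ambMulOne_rTensor (u v : (H × TensorAlgebra K M) ⊗[K] (H × TensorAlgebra K M)) :
    P.ambMulOne.rTensor _ (TensorProduct.tensorTensorTensorComm K _ _ _ _ (u ⊗ₜ v)) =
      TensorProduct.map₂ P.lact (TensorProduct.mk K (H × TensorAlgebra K M) (H × TensorAlgebra K M))
        ((LinearMap.fst K H (TensorAlgebra K M)).rTensor _ u) ((ambProj K H M).rTensor _ v) +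
      TensorProduct.map₂ P.ract (TensorProduct.mk K (H × TensorAlgebra K M) (H × TensorAlgebra K M))
        ((ambProj K H M).rTensor _ u) ((LinearMap.fst K H (TensorAlgebra K M)).rTensor _ v) := by
  induction u using TensorProduct.induction_on with
  | zero => simp
  | tmul x y =>
    induction v using TensorProduct.induction_on with
    | zero => simp
    | tmul z w => simp [ambMulOne]
    | add z w hz hw =>
      simp only [TensorProduct.tmul_add, map_add, hz, hw]; abel
  | add x y hx hy =>
    simp only [TensorProduct.add_tmul, map_add, hx, hy, LinearMap.add_apply]; abel

theorem ambMul_nil : ∀ (n p q : ℕ), p + q = n → ∀ a ∈ ambGr K H M p, ∀ b ∈ ambGr K H M q,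
    (stepE P.ambComul₂ P.ambMulOne ^ (n + 1)) (1 ⊗ₜ (a ⊗ₜ b)) = 0 := by
  have e : ∀ a b, stepE P.ambComul₂ P.ambMulOne (1 ⊗ₜ (a ⊗ₜ b)) =
      (TensorAlgebra.ι K).rTensor _ (TensorProduct.map₂ P.lact
        (TensorProduct.mk K (H × TensorAlgebra K M) (H × TensorAlgebra K M))
        ((LinearMap.fst K H (TensorAlgebra K M)).rTensor _ (P.ambComul a))
          ((ambProj K H M).rTensor _ (P.ambComul b))) +
      (TensorAlgebra.ι K).rTensor _ (TensorProduct.map₂ P.ract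
        (TensorProduct.mk K (H × TensorAlgebra K M) (H × TensorAlgebra K M))
        ((ambProj K H M).rTensor _ (P.ambComul a))
          ((LinearMap.fst K H (TensorAlgebra K M)).rTensor _ (P.ambComul b))) := by
    intro a b
    rw [stepE_tmul, one_smul, LinearMap.rTensor_comp, LinearMap.comp_apply, ambComul₂,
      LinearMap.comp_apply, TensorProduct.map_tmul, LinearEquiv.coe_coe, ambMulOne_rTensor, map_add]
  have step : ∀ (n p q : ℕ) (t : TensorAlgebra K M),
      (∀ a ∈ ambGr K H M p, ∀ b ∈ ambGr K H M q,
        (stepE P.ambComul₂ P.ambMulOne ^ n) (1 ⊗ₜ (a ⊗ₜ b)) = 0) →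
      ∀ a ∈ ambGr K H M p, ∀ b ∈ ambGr K H M q,
        (stepE P.ambComul₂ P.ambMulOne ^ n) (t ⊗ₜ (a ⊗ₜ b)) = 0 := by
    intro n p q t h a ha b hb
    have : t ⊗ₜ[K] (a ⊗ₜ[K] b) = t • ((1 : TensorAlgebra K M) ⊗ₜ[K] (a ⊗ₜ[K] b)) := by
      simp [TensorProduct.smul_tmul']
    rw [this, stepE_pow_smul, h a ha b hb, smul_zero]
  intro n
  induction n with
  | zero =>
    intro p q hpq a ha b hb
    obtain ⟨rfl, rfl⟩ : p = 0 ∧ q = 0 := by omega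
    rw [zero_add, pow_one, e, P.proj_ambComul_zero a ha, P.proj_ambComul_zero b hb]
    simp
  | succ n ih =>
    intro p q hpq a ha b hb
    rw [pow_succ, Module.End.mul_apply, e, map_add]
    have h1 : (stepE P.ambComul₂ P.ambMulOne ^ (n + 1)) ((TensorAlgebra.ι K).rTensor _
        (TensorProduct.map₂ P.lact
        (TensorProduct.mk K (H × TensorAlgebra K M) (H × TensorAlgebra K M))
        ((LinearMap.fst K H (TensorAlgebra K M)).rTensor _ (P.ambComul a))
          ((ambProj K H M).rTensor _ (P.ambComul b)))) = 0 := by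
      cases q with
      | zero => rw [P.proj_ambComul_zero b hb]; simp
      | succ q =>
        obtain ⟨y, hy⟩ := P.fst_ambComul_mem p a ha
        obtain ⟨z, hz⟩ := P.proj_ambComul_mem q b hb
        rw [← hy, ← hz]
        clear hy hz
        induction y using TensorProduct.induction_on with
        | zero => simp
        | add y y' h h' => simp only [map_add, LinearMap.add_apply, h, h', add_zero]
        | tmul h a' =>
          induction z using TensorProduct.induction_on with
          | zero => simp
          | add y y' h h' => simp only [map_add, h, h', add_zero]
          | tmul m b' =>
            simp only [LinearMap.lTensor_tmul, TensorProduct.map₂_apply_tmul,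
              TensorProduct.map_tmul, TensorProduct.mk_apply, LinearMap.rTensor_tmul]
            exact step _ p q _ (ih p q (by omega)) _ a'.2 _ b'.2
    have h2 : (stepE P.ambComul₂ P.ambMulOne ^ (n + 1)) ((TensorAlgebra.ι K).rTensor _
        (TensorProduct.map₂ P.ract
        (TensorProduct.mk K (H × TensorAlgebra K M) (H × TensorAlgebra K M))
        ((ambProj K H M).rTensor _ (P.ambComul a))
          ((LinearMap.fst K H (TensorAlgebra K M)).rTensor _ (P.ambComul b)))) = 0 := by
      cases p with
      | zero => rw [P.proj_ambComul_zero a ha]; simp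
      | succ p =>
        obtain ⟨y, hy⟩ := P.proj_ambComul_mem p a ha
        obtain ⟨z, hz⟩ := P.fst_ambComul_mem q b hb
        rw [← hy, ← hz]
        clear hy hz
        induction y using TensorProduct.induction_on with
        | zero => simp
        | add y y' h h' => simp only [map_add, LinearMap.add_apply, h, h', add_zero]
        | tmul h a' =>
          induction z using TensorProduct.induction_on with
          | zero => simp
          | add y y' h h' => simp only [map_add, h, h', add_zero]
          | tmul m b' =>
            simp only [LinearMap.lTensor_tmul, TensorProduct.map₂_apply_tmul,
              TensorProduct.map_tmul, TensorProduct.mk_apply, LinearMap.rTensor_tmul]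
            exact step _ p q _ (ih p q (by omega)) _ a'.2 _ b'.2
    rw [h1, h2, add_zero]

theorem ambMul_locNil : LocNil P.ambComul₂ P.ambMulOne := by
  intro c
  induction c using TensorProduct.induction_on with
  | zero => exact ⟨0, by simp⟩
  | add x y hx hy => rw [TensorProduct.tmul_add]; exact nil_add hx hy
  | tmul a b =>
    have ha : a ∈ ⨆ n, ambGr K H M n := by rw [iSup_ambGr]; trivial
    have hb : b ∈ ⨆ n, ambGr K H M n := by rw [iSup_ambGr]; trivial
    refine Submodule.iSup_induction _ (motive := fun a =>
      ∃ n, (stepE P.ambComul₂ P.ambMulOne ^ n) (1 ⊗ₜ (a ⊗ₜ b)) = 0) ha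
      (fun p a ha => ?_) ⟨0, by simp⟩ (fun x y hx hy => ?_)
    · refine Submodule.iSup_induction _ (motive := fun b =>
        ∃ n, (stepE P.ambComul₂ P.ambMulOne ^ n) (1 ⊗ₜ (a ⊗ₜ b)) = 0) hb
        (fun q b hb => ⟨_, P.ambMul_nil (p + q) p q rfl a ha b hb⟩) ⟨0, by simp⟩
        (fun x y hx hy => ?_)
      rw [TensorProduct.tmul_add, TensorProduct.tmul_add]
      exact nil_add hx hy
    · rw [TensorProduct.add_tmul, TensorProduct.tmul_add]
      exact nil_add hx hy

end HopfBimodule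

namespace HopfBimodule

variable {K H M : Type*} [Field K] [Ring H] [HopfAlgebra K H] [AddCommGroup M] [Module K M]
  (P : HopfBimodule K H M)

theorem lcoact_lact (h : H) (m : M) : P.lcoact (P.lact h m) =
    TensorProduct.map₂ (LinearMap.mul K H) P.lact (Coalgebra.comul (R := K) h) (P.lcoact m) := by
  have k : ∀ z : H ⊗[K] M, TensorProduct.map₂ (LinearMap.mul K H) P.ract z
      (Coalgebra.comul (R := K) (1 : H)) = z := by
    intro z
    rw [Bialgebra.comul_one, Algebra.TensorProduct.one_def]
    induction z using TensorProduct.induction_on with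
    | zero => simp
    | tmul x y => simp [P.ract_one]
    | add x y hx hy => simp only [map_add, LinearMap.add_apply, hx, hy]
  have := P.lcoact_act h m 1
  rwa [P.ract_one, k] at this

theorem lcoact_ract (m : M) (g : H) : P.lcoact (P.ract m g) =
    TensorProduct.map₂ (LinearMap.mul K H) P.ract (P.lcoact m) (Coalgebra.comul (R := K) g) := by
  have k : ∀ z : H ⊗[K] M, TensorProduct.map₂ (LinearMap.mul K H) P.lact
      (Coalgebra.comul (R := K) (1 : H)) z = z := by
    intro z
    rw [Bialgebra.comul_one, Algebra.TensorProduct.one_def]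
    induction z using TensorProduct.induction_on with
    | zero => simp
    | tmul x y => simp [P.one_lact]
    | add x y hx hy => simp only [map_add, hx, hy]
  have := P.lcoact_act 1 m g
  rwa [P.one_lact, k] at this

theorem rcoact_lact (h : H) (m : M) : P.rcoact (P.lact h m) =
    TensorProduct.map₂ P.lact (LinearMap.mul K H) (Coalgebra.comul (R := K) h) (P.rcoact m) := by
  have k : ∀ z : M ⊗[K] H, TensorProduct.map₂ P.ract (LinearMap.mul K H) z
      (Coalgebra.comul (R := K) (1 : H)) = z := by
    intro z
    rw [Bialgebra.comul_one, Algebra.TensorProduct.one_def]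
    induction z using TensorProduct.induction_on with
    | zero => simp
    | tmul x y => simp [P.ract_one]
    | add x y hx hy => simp only [map_add, LinearMap.add_apply, hx, hy]
  have := P.rcoact_act h m 1
  rwa [P.ract_one, k] at this

theorem rcoact_ract (m : M) (g : H) : P.rcoact (P.ract m g) =
    TensorProduct.map₂ P.ract (LinearMap.mul K H) (P.rcoact m) (Coalgebra.comul (R := K) g) := by
  have k : ∀ z : M ⊗[K] H, TensorProduct.map₂ P.lact (LinearMap.mul K H)
      (Coalgebra.comul (R := K) (1 : H)) z = z := by
    intro z
    rw [Bialgebra.comul_one, Algebra.TensorProduct.one_def]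
    induction z using TensorProduct.induction_on with
    | zero => simp
    | tmul x y => simp [P.one_lact]
    | add x y hx hy => simp only [map_add, hx, hy]
  have := P.rcoact_act 1 m g
  rwa [P.one_lact, k] at this

theorem fst_fst_ambComul (a : H × TensorAlgebra K M) :
    TensorProduct.map (LinearMap.fst K H (TensorAlgebra K M))
      (LinearMap.fst K H (TensorAlgebra K M)) (P.ambComul a) = Coalgebra.comul (R := K) a.1 := by
  rw [← LinearMap.lTensor_comp_rTensor, LinearMap.comp_apply, fst_rTensor_ambComul, map_add,
    ← LinearMap.comp_apply, ← LinearMap.lTensor_comp, ← LinearMap.comp_apply (g := LinearMap.lTensor _ _),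
    ← LinearMap.lTensor_comp]
  simp

theorem fst_proj_ambComul (a : H × TensorAlgebra K M) :
    TensorProduct.map (LinearMap.fst K H (TensorAlgebra K M)) (ambProj K H M) (P.ambComul a) =
      P.lcoact (ambProj K H M a) := by
  have e1 : ambProj K H M ∘ₗ LinearMap.inl K H (TensorAlgebra K M) = 0 := by
    ext; simp [ambProj]
  have e2 : ambProj K H M ∘ₗ LinearMap.inr K H (TensorAlgebra K M) = tProj := by
    ext; simp [ambProj]
  rw [← LinearMap.lTensor_comp_rTensor, LinearMap.comp_apply, fst_rTensor_ambComul, map_add,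
    ← LinearMap.comp_apply, ← LinearMap.lTensor_comp, ← LinearMap.comp_apply (g := LinearMap.lTensor _ _),
    ← LinearMap.lTensor_comp, e1, e2, tProj_tL]
  simp [ambProj]

theorem proj_fst_ambComul (a : H × TensorAlgebra K M) :
    TensorProduct.map (ambProj K H M) (LinearMap.fst K H (TensorAlgebra K M)) (P.ambComul a) =
      P.rcoact (ambProj K H M a) := by
  rw [← LinearMap.lTensor_comp_rTensor, LinearMap.comp_apply, ambProj_rTensor_ambComul, map_add,
    ← LinearMap.comp_apply, ← LinearMap.lTensor_comp, ← LinearMap.comp_apply (g := LinearMap.lTensor _ _),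
    ← LinearMap.lTensor_comp, tProj_tR]
  simp [ambProj]

theorem snd_snd_ambComul (a : H × TensorAlgebra K M) :
    TensorProduct.map (LinearMap.snd K H (TensorAlgebra K M))
      (LinearMap.snd K H (TensorAlgebra K M)) (P.ambComul a) = tDec a.2 := by
  rw [ambComul_apply]
  simp only [map_add]
  simp only [← LinearMap.comp_apply (TensorProduct.map _ _) (TensorProduct.map _ _),
    ← TensorProduct.map_comp, LinearMap.snd_comp_inl, LinearMap.snd_comp_inr]
  simp

/-- The projection `Cot_H(M) → H`, a coalgebra map. -/
def cotFst : P.Cot →ₗc[K] H where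
  toLinearMap := LinearMap.fst K H (TensorAlgebra K M) ∘ₗ P.cotVal
  counit_comp := rfl
  map_comp_comul := by
    ext a
    rw [LinearMap.comp_apply, TensorProduct.map_comp, LinearMap.comp_apply, map_comul_cot,
      fst_fst_ambComul]
    rfl

/-- The projection `Cot_H(M) → M`. -/
def cotProj : P.Cot →ₗ[K] M := ambProj K H M ∘ₗ P.cotVal

theorem cotFst_apply (a : P.Cot) : P.cotFst a = (P.cotVal a).1 := rfl

theorem cotProj_apply (a : P.Cot) : P.cotProj a = tProj (P.cotVal a).2 := rfl

theorem fst_fst_comul (a : P.Cot) : TensorProduct.map P.cotFst.toLinearMap P.cotFst.toLinearMap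
    (Coalgebra.comul (R := K) a) = Coalgebra.comul (R := K) (P.cotFst a) :=
  CoalgHomClass.map_comp_comul_apply P.cotFst a

theorem fst_proj_comul (a : P.Cot) : TensorProduct.map P.cotFst.toLinearMap P.cotProj
    (Coalgebra.comul (R := K) a) = P.lcoact (P.cotProj a) := by
  change TensorProduct.map (LinearMap.fst K H (TensorAlgebra K M) ∘ₗ P.cotVal)
    (ambProj K H M ∘ₗ P.cotVal) _ = _
  rw [TensorProduct.map_comp, LinearMap.comp_apply, map_comul_cot, fst_proj_ambComul]
  rfl

theorem proj_fst_comul (a : P.Cot) : TensorProduct.map P.cotProj P.cotFst.toLinearMap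
    (Coalgebra.comul (R := K) a) = P.rcoact (P.cotProj a) := by
  change TensorProduct.map (ambProj K H M ∘ₗ P.cotVal)
    (LinearMap.fst K H (TensorAlgebra K M) ∘ₗ P.cotVal) _ = _
  rw [TensorProduct.map_comp, LinearMap.comp_apply, map_comul_cot, proj_fst_ambComul]
  rfl

section Unique

theorem tPlus_eq (t : TensorAlgebra K M) : tPlus t = TensorAlgebra.ι K (tProj t) +
    LinearMap.mul' K _ ((TensorAlgebra.ι K ∘ₗ tProj).rTensor _ (tDec t)) := by
  refine tExt (f := tPlus) (g := TensorAlgebra.ι K ∘ₗ tProj +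
    LinearMap.mul' K _ ∘ₗ (TensorAlgebra.ι K ∘ₗ tProj).rTensor _ ∘ₗ tDec) (by simp [tPlus_one])
    ?_ t
  intro m t _
  simp only [LinearMap.add_apply, LinearMap.comp_apply, LinearMap.rTensor_comp, tProj_tDec,
    tProj_ι_mul, tPlus_ι_mul, LinearMap.rTensor_tmul, LinearMap.mul'_apply]
  simp [tPlus, mul_sub, Algebra.algebraMap_eq_smul_one]

theorem eq_zero_of_rec {C : Type*} [AddCommGroup C] [Module K C] (Δ : C →ₗ[K] C ⊗[K] C)
    (φ : C →ₗ[K] M) (Z : C →ₗ[K] TensorAlgebra K M)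
    (hZ : ∀ c, Z c = LinearMap.mul' K _ (TensorProduct.map (TensorAlgebra.ι K ∘ₗ φ) Z (Δ c))) :
    ∀ c, Z c = 0 := by
  have key : ∀ (n : ℕ) c, GradedRing.proj ((LinearMap.range
      (TensorAlgebra.ι K : M →ₗ[K] TensorAlgebra K M) ^ ·) : ℕ → Submodule K _) n (Z c) = 0 := by
    intro n
    induction n with
    | zero =>
      intro c
      rw [hZ]
      generalize Δ c = w
      induction w using TensorProduct.induction_on with
      | zero => simp
      | add x y hx hy => simp only [map_add, hx, hy, add_zero]
      | tmul x y =>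
        rw [TensorProduct.map_tmul, LinearMap.mul'_apply, GradedRing.proj_apply,
          DirectSum.coe_decompose_mul_of_left_mem_of_not_le (i := 1)
            ((LinearMap.range (TensorAlgebra.ι K : M →ₗ[K] TensorAlgebra K M) ^ ·) :
              ℕ → Submodule K _)]
        · rw [pow_one]; exact ⟨φ x, rfl⟩
        · simp
    | succ n ih =>
      intro c
      rw [hZ]
      generalize Δ c = w
      induction w using TensorProduct.induction_on with
      | zero => simp
      | add x y hx hy => simp only [map_add, hx, hy, add_zero]
      | tmul x y =>
        rw [TensorProduct.map_tmul, LinearMap.mul'_apply, GradedRing.proj_apply, add_comm n 1,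
          DirectSum.coe_decompose_mul_add_of_left_mem]
        · have := ih y
          rw [GradedRing.proj_apply] at this
          rw [this, mul_zero]
        · rw [pow_one]; exact ⟨φ x, rfl⟩
  intro c
  classical
  have := DirectSum.sum_support_decompose ((LinearMap.range
      (TensorAlgebra.ι K : M →ₗ[K] TensorAlgebra K M) ^ ·) : ℕ → Submodule K _) (Z c)
  rw [← this]
  exact Finset.sum_eq_zero fun n _ => key n c

/-- The universal property of the cotensor coalgebra (uniqueness). -/
theorem cot_hom_ext {C : Type*} [AddCommGroup C] [Module K C] [Coalgebra K C]
    {f g : C →ₗc[K] P.Cot} (h0 : ∀ c, P.cotFst (f c) = P.cotFst (g c))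
    (h1 : ∀ c, P.cotProj (f c) = P.cotProj (g c)) : f = g := by
  have main : ∀ (f : C →ₗc[K] P.Cot) c, (P.cotVal (f c)).2 = TensorAlgebra.ι K (P.cotProj (f c)) +
      LinearMap.mul' K _ (TensorProduct.map (TensorAlgebra.ι K ∘ₗ P.cotProj ∘ₗ f.toLinearMap)
        (LinearMap.snd K H _ ∘ₗ P.cotVal ∘ₗ f.toLinearMap) (Coalgebra.comul (R := K) c)) := by
    intro f c
    have hm := ((P.mem_cotSubmodule _).1 (f c).2).1
    change TensorAlgebra.algebraMapInv (P.cotVal (f c)).2 = 0 at hm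
    conv_lhs => rw [← tPlus_of_aug hm, tPlus_eq]
    congr 2
    rw [← snd_snd_ambComul, ← map_comul_cot, ← CoalgHomClass.map_comp_comul_apply]
    generalize Coalgebra.comul (R := K) c = w
    induction w using TensorProduct.induction_on with
    | zero => simp
    | tmul x y => simp [cotProj, ambProj]
    | add x y hx hy => simp only [map_add, hx, hy]
  have hφ : P.cotProj ∘ₗ f.toLinearMap = P.cotProj ∘ₗ g.toLinearMap := LinearMap.ext h1
  have hz := eq_zero_of_rec Coalgebra.comul (P.cotProj ∘ₗ g.toLinearMap)
    (LinearMap.snd K H _ ∘ₗ P.cotVal ∘ₗ f.toLinearMap -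
      LinearMap.snd K H _ ∘ₗ P.cotVal ∘ₗ g.toLinearMap) (by
    intro c
    rw [map_sub_right', LinearMap.sub_apply, LinearMap.sub_apply, map_sub]
    have e1 := main f c
    have e2 := main g c
    rw [hφ, h1] at e1
    change (P.cotVal (f c)).2 - (P.cotVal (g c)).2 = _
    rw [e1, e2]
    abel)
  ext c
  apply P.cotVal_injective
  refine Prod.ext (h0 c) ?_
  exact sub_eq_zero.1 (hz c)

end Unique

/-- The inclusion `H → Cot_H(M)`, a coalgebra map. -/
def cotInclH : H →ₗc[K] P.Cot where
  toLinearMap := P.cotMk (LinearMap.inl K H (TensorAlgebra K M)) (fun h => by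
    rw [mem_cotSubmodule]; simp)
  counit_comp := rfl
  map_comp_comul := by
    ext h
    apply map_injective P.cotVal_injective P.cotVal_injective
    rw [LinearMap.comp_apply, LinearMap.comp_apply, map_comul_cot, cotVal_cotMk, ambComul_apply,
      ← LinearMap.comp_apply (TensorProduct.map P.cotVal P.cotVal), ← TensorProduct.map_comp,
      cotVal_comp_cotMk]
    simp

/-- The inclusion `M → Cot_H(M)`. -/
def cotInclM : M →ₗ[K] P.Cot :=
  P.cotMk (LinearMap.inr K H (TensorAlgebra K M) ∘ₗ TensorAlgebra.ι K) (fun m => by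
    rw [mem_cotSubmodule]; simp [junction, tDec_ι, TensorAlgebra.algebraMapInv])

theorem cotVal_cotInclH (h : H) : P.cotVal (P.cotInclH h) = (h, 0) := rfl

theorem cotVal_cotInclM (m : M) : P.cotVal (P.cotInclM m) = (0, TensorAlgebra.ι K m) := rfl

section Mul

/-- `a ⊗ b ↦ a₀ b₀` -/
def cotMul₀ : P.Cot ⊗[K] P.Cot →ₗc[K] H :=
  (Bialgebra.mulCoalgHom K H).comp (Coalgebra.TensorProduct.map P.cotFst P.cotFst)

/-- `a ⊗ b ↦ a₀.b₁ + a₁.b₀` -/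
def cotMul₁ : P.Cot ⊗[K] P.Cot →ₗ[K] M :=
  TensorProduct.lift P.lact ∘ₗ TensorProduct.map P.cotFst.toLinearMap P.cotProj +
  TensorProduct.lift P.ract ∘ₗ TensorProduct.map P.cotProj P.cotFst.toLinearMap

theorem cotMul₀_tmul (a b : P.Cot) : P.cotMul₀ (a ⊗ₜ b) = P.cotFst a * P.cotFst b := rfl

theorem cotMul₁_tmul (a b : P.Cot) : P.cotMul₁ (a ⊗ₜ b) =
    P.lact (P.cotFst a) (P.cotProj b) + P.ract (P.cotProj a) (P.cotFst b) := rfl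

theorem cotMul_left (c : P.Cot ⊗[K] P.Cot) : P.lcoact (P.cotMul₁ c) =
    TensorProduct.map P.cotMul₀.toLinearMap P.cotMul₁ (Coalgebra.comul (R := K) c) := by
  have k : ∀ u v : P.Cot ⊗[K] P.Cot, TensorProduct.map P.cotMul₀.toLinearMap P.cotMul₁
      (TensorProduct.AlgebraTensorModule.tensorTensorTensorComm K K K K _ _ _ _ (u ⊗ₜ v)) =
      TensorProduct.map₂ (LinearMap.mul K H) P.lact
        (TensorProduct.map P.cotFst.toLinearMap P.cotFst.toLinearMap u)
        (TensorProduct.map P.cotFst.toLinearMap P.cotProj v) +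
      TensorProduct.map₂ (LinearMap.mul K H) P.ract
        (TensorProduct.map P.cotFst.toLinearMap P.cotProj u)
        (TensorProduct.map P.cotFst.toLinearMap P.cotFst.toLinearMap v) := by
    intro u v
    induction u using TensorProduct.induction_on with
    | zero => simp
    | tmul x y =>
      induction v using TensorProduct.induction_on with
      | zero => simp
      | tmul z w =>
        simp [cotMul₀_tmul, cotMul₁_tmul, TensorProduct.tmul_add]
      | add z w hz hw => simp only [TensorProduct.tmul_add, map_add, hz, hw]; abel
    | add x y hx hy =>
      simp only [TensorProduct.add_tmul, map_add, hx, hy, LinearMap.add_apply]; abel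
  induction c using TensorProduct.induction_on with
  | zero => simp
  | tmul a b =>
    rw [TensorProduct.comul_tmul, k, cotMul₁_tmul, map_add, lcoact_lact, lcoact_ract,
      fst_fst_comul, fst_proj_comul, fst_fst_comul, fst_proj_comul]
  | add x y hx hy => simp only [map_add, hx, hy]

theorem cotMul_right (c : P.Cot ⊗[K] P.Cot) : P.rcoact (P.cotMul₁ c) =
    TensorProduct.map P.cotMul₁ P.cotMul₀.toLinearMap (Coalgebra.comul (R := K) c) := by
  have k : ∀ u v : P.Cot ⊗[K] P.Cot, TensorProduct.map P.cotMul₁ P.cotMul₀.toLinearMap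
      (TensorProduct.AlgebraTensorModule.tensorTensorTensorComm K K K K _ _ _ _ (u ⊗ₜ v)) =
      TensorProduct.map₂ P.lact (LinearMap.mul K H)
        (TensorProduct.map P.cotFst.toLinearMap P.cotFst.toLinearMap u)
        (TensorProduct.map P.cotProj P.cotFst.toLinearMap v) +
      TensorProduct.map₂ P.ract (LinearMap.mul K H)
        (TensorProduct.map P.cotProj P.cotFst.toLinearMap u)
        (TensorProduct.map P.cotFst.toLinearMap P.cotFst.toLinearMap v) := by
    intro u v
    induction u using TensorProduct.induction_on with
    | zero => simp
    | tmul x y =>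
      induction v using TensorProduct.induction_on with
      | zero => simp
      | tmul z w =>
        simp [cotMul₀_tmul, cotMul₁_tmul, TensorProduct.add_tmul]
      | add z w hz hw => simp only [TensorProduct.tmul_add, map_add, hz, hw]; abel
    | add x y hx hy =>
      simp only [TensorProduct.add_tmul, map_add, hx, hy, LinearMap.add_apply]; abel
  induction c using TensorProduct.induction_on with
  | zero => simp
  | tmul a b =>
    rw [TensorProduct.comul_tmul, k, cotMul₁_tmul, map_add, rcoact_lact, rcoact_ract,
      fst_fst_comul, proj_fst_comul, fst_fst_comul, proj_fst_comul]
  | add x y hx hy => simp only [map_add, hx, hy]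

theorem cotMul_locNil : LocNil (Coalgebra.comul (R := K) (A := P.Cot ⊗[K] P.Cot)) P.cotMul₁ := by
  refine locNil_of_injective (Δ' := P.ambComul₂) (f' := P.ambMulOne)
    (TensorProduct.map P.cotVal P.cotVal) (map_injective P.cotVal_injective P.cotVal_injective)
    ?_ ?_ (fun c => P.ambMul_locNil _)
  · have k : ∀ u v : P.Cot ⊗[K] P.Cot, TensorProduct.map (TensorProduct.map P.cotVal P.cotVal)
        (TensorProduct.map P.cotVal P.cotVal)
        (TensorProduct.AlgebraTensorModule.tensorTensorTensorComm K K K K _ _ _ _ (u ⊗ₜ v)) =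
        TensorProduct.tensorTensorTensorComm K _ _ _ _
          (TensorProduct.map P.cotVal P.cotVal u ⊗ₜ TensorProduct.map P.cotVal P.cotVal v) := by
      intro u v
      induction u using TensorProduct.induction_on with
      | zero => simp
      | tmul x y =>
        induction v using TensorProduct.induction_on with
        | zero => simp
        | tmul z w => simp
        | add z w hz hw => simp only [TensorProduct.tmul_add, map_add, hz, hw]
      | add x y hx hy => simp only [TensorProduct.add_tmul, map_add, hx, hy]
    intro c
    induction c using TensorProduct.induction_on with
    | zero => simp
    | tmul a b =>
      rw [TensorProduct.comul_tmul, k, map_comul_cot, map_comul_cot, TensorProduct.map_tmul,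
        ambComul₂, LinearMap.comp_apply, TensorProduct.map_tmul, LinearEquiv.coe_coe]
    | add x y hx hy => simp only [map_add, hx, hy]
  · ext a b
    rfl

/-- The multiplication of the cotensor Hopf algebra: the unique coalgebra map
`Cot_H(M) ⊗ Cot_H(M) → Cot_H(M)` with components `a ⊗ b ↦ a₀ b₀` in `H` and
`a ⊗ b ↦ a₀.b₁ + a₁.b₀` in `M`. -/
def cotMul : P.Cot ⊗[K] P.Cot →ₗc[K] P.Cot :=
  P.cotLift P.cotMul₀ P.cotMul₁ P.cotMul_left P.cotMul_right P.cotMul_locNil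

theorem cotFst_cotMul (c : P.Cot ⊗[K] P.Cot) : P.cotFst (P.cotMul c) = P.cotMul₀ c := rfl

theorem cotProj_cotMul (c : P.Cot ⊗[K] P.Cot) : P.cotProj (P.cotMul c) = P.cotMul₁ c :=
  tProj_expF P.cotMul_locNil c

instance : One P.Cot := ⟨P.cotInclH 1⟩
instance : Mul P.Cot := ⟨fun a b => P.cotMul (a ⊗ₜ b)⟩

theorem cot_one_def : (1 : P.Cot) = P.cotInclH 1 := rfl

theorem cot_mul_def (a b : P.Cot) : a * b = P.cotMul (a ⊗ₜ b) := rfl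

theorem cotFst_one : P.cotFst (1 : P.Cot) = 1 := rfl

theorem cotProj_one : P.cotProj (1 : P.Cot) = 0 := by
  rw [cotProj_apply, cot_one_def, cotVal_cotInclH]; simp

theorem cotFst_mul (a b : P.Cot) : P.cotFst (a * b) = P.cotFst a * P.cotFst b := rfl

theorem cotProj_mul (a b : P.Cot) : P.cotProj (a * b) =
    P.lact (P.cotFst a) (P.cotProj b) + P.ract (P.cotProj a) (P.cotFst b) := by
  rw [cot_mul_def, cotProj_cotMul, cotMul₁_tmul]

/-- the unit as a coalgebra map -/
def cotUnit : K →ₗc[K] P.Cot := P.cotInclH.comp (Bialgebra.unitBialgHom K H : K →ₗc[K] H)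

theorem cotUnit_one : P.cotUnit 1 = 1 := by
  change P.cotInclH (algebraMap K H 1) = P.cotInclH 1
  rw [map_one]

theorem cot_mul_assoc (a b c : P.Cot) : a * b * c = a * (b * c) := by
  have e : P.cotMul.comp (Coalgebra.TensorProduct.map P.cotMul (CoalgHom.id K P.Cot)) =
      (P.cotMul.comp (Coalgebra.TensorProduct.map (CoalgHom.id K P.Cot) P.cotMul)).comp
        (Coalgebra.TensorProduct.assoc K K P.Cot P.Cot P.Cot).toCoalgHom := by
    have t : ∀ a b c, P.cotMul.comp (Coalgebra.TensorProduct.map P.cotMul (CoalgHom.id K P.Cot))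
        ((a ⊗ₜ b) ⊗ₜ c) = a * b * c := fun _ _ _ => rfl
    have t' : ∀ a b c, (P.cotMul.comp (Coalgebra.TensorProduct.map (CoalgHom.id K P.Cot)
        P.cotMul)).comp (Coalgebra.TensorProduct.assoc K K P.Cot P.Cot P.Cot).toCoalgHom
        ((a ⊗ₜ b) ⊗ₜ c) = a * (b * c) := fun _ _ _ => rfl
    apply P.cot_hom_ext
    · intro z
      induction z using TensorProduct.induction_on with
      | zero => simp
      | tmul x c =>
        induction x using TensorProduct.induction_on with
        | zero => simp
        | tmul a b => rw [t, t']; simp only [cotFst_mul, mul_assoc]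
        | add x y hx hy => simp only [TensorProduct.add_tmul, map_add, hx, hy]
      | add x y hx hy => simp only [map_add, hx, hy]
    · intro z
      induction z using TensorProduct.induction_on with
      | zero => simp
      | tmul x c =>
        induction x using TensorProduct.induction_on with
        | zero => simp
        | tmul a b =>
          rw [t, t']
          simp only [cotFst_mul, cotProj_mul, map_add, LinearMap.add_apply, P.mul_lact, P.ract_mul,
            P.lact_ract, add_assoc]
        | add x y hx hy => simp only [TensorProduct.add_tmul, map_add, hx, hy]
      | add x y hx hy => simp only [map_add, hx, hy]
  exact DFunLike.congr_fun e ((a ⊗ₜ b) ⊗ₜ c)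

theorem cot_one_mul (a : P.Cot) : 1 * a = a := by
  have e : (P.cotMul.comp (Coalgebra.TensorProduct.map P.cotUnit (CoalgHom.id K P.Cot))).comp
      (Coalgebra.TensorProduct.lid K P.Cot).symm.toCoalgHom = CoalgHom.id K P.Cot := by
    have t : ∀ a, (P.cotMul.comp (Coalgebra.TensorProduct.map P.cotUnit (CoalgHom.id K P.Cot))).comp
        (Coalgebra.TensorProduct.lid K P.Cot).symm.toCoalgHom a = 1 * a := by
      intro a
      rw [← cotUnit_one]; rfl
    apply P.cot_hom_ext
    · intro a
      rw [t, cotFst_mul, cotFst_one, one_mul]; rfl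
    · intro a
      rw [t, cotProj_mul, cotFst_one, cotProj_one, P.one_lact]; simp
  have := DFunLike.congr_fun e a
  rw [← cotUnit_one]
  exact this

theorem cot_mul_one (a : P.Cot) : a * 1 = a := by
  have e : (P.cotMul.comp (Coalgebra.TensorProduct.map (CoalgHom.id K P.Cot) P.cotUnit)).comp
      (Coalgebra.TensorProduct.rid K K P.Cot).symm.toCoalgHom = CoalgHom.id K P.Cot := by
    have t : ∀ a, (P.cotMul.comp (Coalgebra.TensorProduct.map (CoalgHom.id K P.Cot) P.cotUnit)).comp
        (Coalgebra.TensorProduct.rid K K P.Cot).symm.toCoalgHom a = a * 1 := by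
      intro a
      rw [← cotUnit_one]; rfl
    apply P.cot_hom_ext
    · intro a
      rw [t, cotFst_mul, cotFst_one, mul_one]; rfl
    · intro a
      rw [t, cotProj_mul, cotFst_one, cotProj_one, P.ract_one]; simp
  have := DFunLike.congr_fun e a
  rw [← cotUnit_one]
  exact this

instance : Ring P.Cot :=
  { (inferInstance : AddCommGroup P.Cot), (inferInstance : Mul P.Cot),
    (inferInstance : One P.Cot) with
    mul_assoc := P.cot_mul_assoc
    one_mul := P.cot_one_mul
    mul_one := P.cot_mul_one
    left_distrib := fun a b c => by
      simp only [cot_mul_def, TensorProduct.tmul_add, map_add]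
    right_distrib := fun a b c => by
      simp only [cot_mul_def, TensorProduct.add_tmul, map_add]
    zero_mul := fun a => by
      rw [cot_mul_def, TensorProduct.zero_tmul, map_zero]
    mul_zero := fun a => by
      rw [cot_mul_def, TensorProduct.tmul_zero, map_zero] }

instance : Algebra K P.Cot :=
  Algebra.ofModule
    (fun r a b => by
      rw [cot_mul_def, cot_mul_def, ← TensorProduct.smul_tmul', map_smul])
    (fun r a b => by
      rw [cot_mul_def, cot_mul_def, TensorProduct.tmul_smul, map_smul])

theorem map_cotMul_comm (u v : P.Cot ⊗[K] P.Cot) :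
    TensorProduct.map P.cotMul.toLinearMap P.cotMul.toLinearMap
      (TensorProduct.AlgebraTensorModule.tensorTensorTensorComm K K K K _ _ _ _ (u ⊗ₜ v)) =
      u * v := by
  induction u using TensorProduct.induction_on with
  | zero => rw [TensorProduct.zero_tmul, LinearEquiv.map_zero, LinearMap.map_zero, zero_mul]
  | tmul x y =>
    induction v using TensorProduct.induction_on with
    | zero => rw [TensorProduct.tmul_zero, LinearEquiv.map_zero, LinearMap.map_zero, mul_zero]
    | tmul z w =>
      rw [Algebra.TensorProduct.tmul_mul_tmul]
      rfl
    | add z w hz hw =>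
      rw [TensorProduct.tmul_add, LinearEquiv.map_add, LinearMap.map_add, hz, hw, mul_add]
  | add x y hx hy =>
    rw [TensorProduct.add_tmul, LinearEquiv.map_add, LinearMap.map_add, hx, hy, add_mul]

/-- The cotensor Hopf algebra, as a bialgebra. -/
instance : Bialgebra K P.Cot :=
  Bialgebra.mk' K P.Cot
    (by
      rw [cot_one_def]
      exact (CoalgHomClass.counit_comp_apply P.cotInclH 1).trans (Bialgebra.counit_one))
    (fun {a b} => by
      rw [cot_mul_def]
      exact (CoalgHomClass.counit_comp_apply P.cotMul (a ⊗ₜ b)).trans (by simp [mul_comm]))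
    (by
      rw [cot_one_def]
      refine (CoalgHomClass.map_comp_comul_apply P.cotInclH 1).symm.trans ?_
      rw [Bialgebra.comul_one]
      rfl)
    (fun {a b} => by
      rw [cot_mul_def]
      refine (CoalgHomClass.map_comp_comul_apply P.cotMul (a ⊗ₜ b)).symm.trans ?_
      rw [TensorProduct.comul_tmul]
      exact P.map_cotMul_comm _ _)

end Mul

end HopfBimodule

namespace HopfBimodule

variable {K H M : Type*} [Field K] [Ring H] [HopfAlgebra K H] [AddCommGroup M] [Module K M]
  (P : HopfBimodule K H M)

/-- The subalgebra of the cotensor Hopf algebra generated by `H` and `M`. -/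
def qsymSubalgebra : Subalgebra K P.Cot :=
  Algebra.adjoin K (Set.range P.cotInclH ∪ Set.range P.cotInclM)

theorem comul_cotInclH (h : H) : Coalgebra.comul (R := K) (P.cotInclH h) =
    TensorProduct.map P.cotInclH.toLinearMap P.cotInclH.toLinearMap
      (Coalgebra.comul (R := K) h) :=
  (CoalgHomClass.map_comp_comul_apply P.cotInclH h).symm

theorem comul_cotInclM (m : M) : Coalgebra.comul (R := K) (P.cotInclM m) =
    TensorProduct.map P.cotInclH.toLinearMap P.cotInclM (P.lcoact m) +
      TensorProduct.map P.cotInclM P.cotInclH.toLinearMap (P.rcoact m) := by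
  apply map_injective P.cotVal_injective P.cotVal_injective
  rw [map_comul_cot, cotVal_cotInclM, ambComul_apply, map_add]
  simp only [← LinearMap.comp_apply (TensorProduct.map P.cotVal P.cotVal),
    ← TensorProduct.map_comp]
  rw [tL_ι, tR_ι, tDec_ι]
  simp only [map_zero, zero_add, add_zero]
  congr 1
  · rw [← LinearMap.comp_apply, LinearMap.map_comp_lTensor]
    rfl
  · rw [← LinearMap.comp_apply, LinearMap.map_comp_rTensor]
    rfl

theorem map_mem_range {A B : Type*} [AddCommGroup A] [Module K A] [AddCommGroup B] [Module K B]
    {f : A →ₗ[K] P.Cot} {g : B →ₗ[K] P.Cot} (hf : ∀ a, f a ∈ P.qsymSubalgebra)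
    (hg : ∀ b, g b ∈ P.qsymSubalgebra) (z : A ⊗[K] B) : TensorProduct.map f g z ∈
      (Algebra.TensorProduct.map P.qsymSubalgebra.val P.qsymSubalgebra.val).range := by
  induction z using TensorProduct.induction_on with
  | zero => rw [map_zero]; exact zero_mem _
  | tmul x y => exact ⟨(⟨f x, hf x⟩ : P.qsymSubalgebra) ⊗ₜ (⟨g y, hg y⟩ : P.qsymSubalgebra), rfl⟩
  | add x y hx hy => rw [map_add]; exact add_mem hx hy

theorem cotInclH_mem (h : H) : P.cotInclH h ∈ P.qsymSubalgebra :=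
  Algebra.subset_adjoin (Or.inl ⟨h, rfl⟩)

theorem cotInclM_mem (m : M) : P.cotInclM m ∈ P.qsymSubalgebra :=
  Algebra.subset_adjoin (Or.inr ⟨m, rfl⟩)

theorem comul_mem_qsym (a : P.Cot) (ha : a ∈ Subalgebra.toSubmodule P.qsymSubalgebra) :
    Coalgebra.comul (R := K) a ∈ LinearMap.range (TensorProduct.map
      (Subalgebra.toSubmodule P.qsymSubalgebra).subtype
      (Subalgebra.toSubmodule P.qsymSubalgebra).subtype) := by
  have h : P.qsymSubalgebra ≤ ((Algebra.TensorProduct.map P.qsymSubalgebra.val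
      P.qsymSubalgebra.val).range).comap (Bialgebra.comulAlgHom K P.Cot) := by
    refine Algebra.adjoin_le ?_
    rintro _ (⟨h, rfl⟩ | ⟨m, rfl⟩)
    · refine Subalgebra.mem_comap .. |>.2 ?_
      rw [Bialgebra.comulAlgHom_apply]
      rw [comul_cotInclH]
      exact P.map_mem_range P.cotInclH_mem P.cotInclH_mem _
    · refine Subalgebra.mem_comap .. |>.2 ?_
      rw [Bialgebra.comulAlgHom_apply]
      rw [comul_cotInclM]
      exact add_mem (P.map_mem_range P.cotInclH_mem P.cotInclM_mem _)
        (P.map_mem_range P.cotInclM_mem P.cotInclH_mem _)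
  exact h ha

/-- The quantum symmetric algebra `S_H(M)`: the subalgebra of `Cot_H(M)` generated by `H` and
`M`. -/
def QSym : Type _ := P.qsymSubalgebra

instance : Ring P.QSym := inferInstanceAs (Ring P.qsymSubalgebra)
instance : Algebra K P.QSym := inferInstanceAs (Algebra K P.qsymSubalgebra)

/-- The inclusion `S_H(M) → Cot_H(M)`, an algebra map. -/
def qsymVal : P.QSym →ₐ[K] P.Cot := P.qsymSubalgebra.val

theorem qsymVal_injective : Function.Injective P.qsymVal := Subtype.val_injective

instance : Coalgebra K P.QSym :=
  subCoalgebra (Coalgebra.comul (R := K) (A := P.Cot)) Coalgebra.counit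
    (Subalgebra.toSubmodule P.qsymSubalgebra) P.comul_mem_qsym
    (fun a _ => Coalgebra.coassoc_apply a)
    (fun a _ => Coalgebra.rTensor_counit_comul a) (fun a _ => Coalgebra.lTensor_counit_comul a)

theorem map_comul_qsym (a : P.QSym) : Algebra.TensorProduct.map P.qsymVal P.qsymVal
    (Coalgebra.comul (R := K) a) = Coalgebra.comul (R := K) (P.qsymVal a) :=
  map_subComul _ (Subalgebra.toSubmodule P.qsymSubalgebra) P.comul_mem_qsym a

theorem counit_qsym (a : P.QSym) : Coalgebra.counit (R := K) a =
    Coalgebra.counit (R := K) (P.qsymVal a) := rfl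

theorem map_qsymVal_injective :
    Function.Injective (Algebra.TensorProduct.map P.qsymVal P.qsymVal) :=
  map_injective (f := P.qsymVal.toLinearMap) (g := P.qsymVal.toLinearMap)
    P.qsymVal_injective P.qsymVal_injective

instance : Bialgebra K P.QSym :=
  Bialgebra.mk' K P.QSym
    (by rw [counit_qsym, map_one, Bialgebra.counit_one])
    (fun {a b} => by simp only [counit_qsym, map_mul, Bialgebra.counit_mul])
    (P.map_qsymVal_injective (by
      rw [map_comul_qsym, map_one, Bialgebra.comul_one, map_one]))
    (fun {a b} => P.map_qsymVal_injective (by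
      rw [map_comul_qsym, map_mul P.qsymVal, Bialgebra.comul_mul,
        map_mul (Algebra.TensorProduct.map P.qsymVal P.qsymVal), map_comul_qsym, map_comul_qsym]))

/-- The degree `n` part of `S_H(M)`. -/
def qsymGr (n : ℕ) : Submodule K P.QSym :=
  (ambGr K H M n).comap (P.cotVal ∘ₗ P.qsymVal.toLinearMap)

end HopfBimodule

/-- A Hopf algebra `H` with a decomposition `H = ⨁ Hₙ` is a graded Hopf algebra if
`Hₘ Hₙ ⊆ Hₘ₊ₙ` and `1 ∈ H₀` (both contained in `GradedAlgebra 𝒜`), `Δ(Hₙ) ⊆ ∑_{i+j=n} Hᵢ ⊗ Hⱼ`,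
`ε(Hₙ) = 0` for `n > 0`, and `S(Hₙ) ⊆ Hₙ`. -/
class GradedHopf {K H : Type*} [Field K] [Ring H] [HopfAlgebra K H] (𝒜 : ℕ → Submodule K H)
    [GradedAlgebra 𝒜] : Prop where
  comul_mem : ∀ n, ∀ x ∈ 𝒜 n, Coalgebra.comul (R := K) x ∈
    ⨆ (i : ℕ) (j : ℕ) (_ : i + j = n),
      LinearMap.range (TensorProduct.map (𝒜 i).subtype (𝒜 j).subtype)
  counit_eq_zero : ∀ n, 0 < n → ∀ x ∈ 𝒜 n, Coalgebra.counit (R := K) x = 0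
  antipode_mem : ∀ n, ∀ x ∈ 𝒜 n, HopfAlgebra.antipode K x ∈ 𝒜 n

section Graded

variable {K H : Type*} [Field K] [Ring H] [HopfAlgebra K H] (𝒜 : ℕ → Submodule K H)
  [GradedAlgebra 𝒜]

/-- The projection `H → Hₙ`. -/
def grProj (n : ℕ) : H →ₗ[K] 𝒜 n :=
  DirectSum.component K ℕ (fun i => 𝒜 i) n ∘ₗ (DirectSum.decomposeLinearEquiv 𝒜).toLinearMap

theorem grProj_same (n : ℕ) : grProj 𝒜 n ∘ₗ (𝒜 n).subtype = LinearMap.id := by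
  ext x
  exact DirectSum.decompose_of_mem_same 𝒜 x.2

theorem grProj_ne {m n : ℕ} (h : m ≠ n) : grProj 𝒜 n ∘ₗ (𝒜 m).subtype = 0 := by
  ext x
  exact DirectSum.decompose_of_mem_ne 𝒜 x.2 h

/-- The subalgebra `H₀`. -/
def Deg0 : Type _ := SetLike.GradeZero.subalgebra 𝒜

instance : Ring (Deg0 𝒜) := inferInstanceAs (Ring (SetLike.GradeZero.subalgebra 𝒜))
instance : Algebra K (Deg0 𝒜) := inferInstanceAs (Algebra K (SetLike.GradeZero.subalgebra 𝒜))

/-- The inclusion `H₀ → H`. -/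
def in0Alg : Deg0 𝒜 →ₐ[K] H := (SetLike.GradeZero.subalgebra 𝒜).val

/-- The inclusion `H₀ → H` as a linear map. -/
def in0 : Deg0 𝒜 →ₗ[K] H := (in0Alg 𝒜).toLinearMap

theorem in0_injective : Function.Injective (in0 𝒜) := Subtype.val_injective

theorem in0_mem (x : Deg0 𝒜) : in0 𝒜 x ∈ 𝒜 0 := x.2

theorem in0_mul (x y : Deg0 𝒜) : in0 𝒜 (x * y) = in0 𝒜 x * in0 𝒜 y := map_mul (in0Alg 𝒜) x y

theorem in0_one : in0 𝒜 1 = 1 := map_one (in0Alg 𝒜)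

/-- An element of `H₀`. -/
def mk0 (x : H) (hx : x ∈ 𝒜 0) : Deg0 𝒜 := ⟨x, hx⟩

theorem in0_mk0 (x : H) (hx : x ∈ 𝒜 0) : in0 𝒜 (mk0 𝒜 x hx) = x := rfl

/-- The projection `H → H₀`. -/
def pr0 : H →ₗ[K] Deg0 𝒜 where
  toFun x := mk0 𝒜 (grProj 𝒜 0 x) (grProj 𝒜 0 x).2
  map_add' x y := in0_injective 𝒜 (by simp only [map_add, in0_mk0, Submodule.coe_add])
  map_smul' r x := in0_injective 𝒜 (by
    simp only [map_smul, in0_mk0, Submodule.coe_smul, RingHom.id_apply])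

theorem pr0_same : pr0 𝒜 ∘ₗ in0 𝒜 = LinearMap.id := by
  ext x
  apply in0_injective
  exact DirectSum.decompose_of_mem_same 𝒜 x.2

theorem pr0_ne : pr0 𝒜 ∘ₗ (𝒜 1).subtype = 0 := by
  ext x
  apply in0_injective
  rw [LinearMap.zero_apply, map_zero]
  exact DirectSum.decompose_of_mem_ne 𝒜 x.2 one_ne_zero

theorem grProj_in0 : grProj 𝒜 1 ∘ₗ in0 𝒜 = 0 := by
  ext x
  exact DirectSum.decompose_of_mem_ne 𝒜 x.2 zero_ne_one

variable [GradedHopf 𝒜]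

theorem comul_mem_zero (x : H) (hx : x ∈ Subalgebra.toSubmodule (SetLike.GradeZero.subalgebra 𝒜)) :
    Coalgebra.comul (R := K) x ∈ LinearMap.range (TensorProduct.map
      (Subalgebra.toSubmodule (SetLike.GradeZero.subalgebra 𝒜)).subtype
      (Subalgebra.toSubmodule (SetLike.GradeZero.subalgebra 𝒜)).subtype) := by
  have hle : (⨆ (i : ℕ) (j : ℕ) (_ : i + j = 0),
      LinearMap.range (TensorProduct.map (𝒜 i).subtype (𝒜 j).subtype)) ≤
      LinearMap.range (TensorProduct.map (𝒜 0).subtype (𝒜 0).subtype) := by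
    refine iSup_le fun i => iSup_le fun j => iSup_le fun hij => ?_
    obtain ⟨rfl, rfl⟩ : i = 0 ∧ j = 0 := by omega
    exact le_rfl
  exact hle (GradedHopf.comul_mem 0 x hx)

instance instCoalgebraZero : Coalgebra K (Deg0 𝒜) :=
  subCoalgebra (Coalgebra.comul (R := K) (A := H)) Coalgebra.counit
    (Subalgebra.toSubmodule (SetLike.GradeZero.subalgebra 𝒜)) (comul_mem_zero 𝒜)
    (fun a _ => Coalgebra.coassoc_apply a)
    (fun a _ => Coalgebra.rTensor_counit_comul a) (fun a _ => Coalgebra.lTensor_counit_comul a)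

theorem map_comul_zero (x : Deg0 𝒜) : TensorProduct.map (in0 𝒜) (in0 𝒜)
    (Coalgebra.comul (R := K) x) = Coalgebra.comul (R := K) (in0 𝒜 x) :=
  map_subComul _ _ (comul_mem_zero 𝒜) x

theorem counit_zero (x : Deg0 𝒜) :
    Coalgebra.counit (R := K) x = Coalgebra.counit (R := K) (in0 𝒜 x) := rfl

theorem map_zero_zero_mul (u v : Deg0 𝒜 ⊗[K] Deg0 𝒜) :
    TensorProduct.map (in0 𝒜) (in0 𝒜) (u * v) =
      TensorProduct.map (in0 𝒜) (in0 𝒜) u * TensorProduct.map (in0 𝒜) (in0 𝒜) v :=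
  map_mul (Algebra.TensorProduct.map (in0Alg 𝒜) (in0Alg 𝒜)) u v

instance instBialgebraZero : Bialgebra K (Deg0 𝒜) :=
  Bialgebra.mk' K (Deg0 𝒜)
    (by rw [counit_zero, in0_one, Bialgebra.counit_one])
    (fun {a b} => by simp only [counit_zero, in0_mul, Bialgebra.counit_mul])
    (by
      apply map_injective (in0_injective 𝒜) (in0_injective 𝒜)
      rw [map_comul_zero, Algebra.TensorProduct.one_def, TensorProduct.map_tmul, in0_one,
        Bialgebra.comul_one]
      rfl)
    (fun {a b} => by
      apply map_injective (in0_injective 𝒜) (in0_injective 𝒜)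
      rw [map_zero_zero_mul, map_comul_zero, map_comul_zero, map_comul_zero, in0_mul,
        Bialgebra.comul_mul])

/-- The restriction of the antipode to `H₀`. -/
def antipodeZero : Deg0 𝒜 →ₗ[K] Deg0 𝒜 :=
  pr0 𝒜 ∘ₗ HopfAlgebra.antipode K ∘ₗ in0 𝒜

theorem in0_pr0 (x : H) (hx : x ∈ 𝒜 0) : in0 𝒜 (pr0 𝒜 x) = x :=
  DirectSum.decompose_of_mem_same 𝒜 hx

theorem in0_antipodeZero (x : Deg0 𝒜) :
    in0 𝒜 (antipodeZero 𝒜 x) = HopfAlgebra.antipode K (in0 𝒜 x) :=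
  in0_pr0 𝒜 _ (GradedHopf.antipode_mem 0 _ (in0_mem 𝒜 x))

/-- `H₀` is a Hopf subalgebra of `H`. -/
instance instHopfAlgebraZero : HopfAlgebra K (Deg0 𝒜) where
  antipode := antipodeZero 𝒜
  mul_antipode_rTensor_comul := by
    ext x
    have k : ∀ z : Deg0 𝒜 ⊗[K] Deg0 𝒜,
        in0 𝒜 (LinearMap.mul' K (Deg0 𝒜) ((antipodeZero 𝒜).rTensor _ z)) =
        LinearMap.mul' K H ((HopfAlgebra.antipode K).rTensor H
          (TensorProduct.map (in0 𝒜) (in0 𝒜) z)) := by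
      intro z
      induction z using TensorProduct.induction_on with
      | zero => simp
      | tmul x y => simp [in0_mul, in0_antipodeZero]
      | add x y hx hy => simp only [map_add, hx, hy]
    apply in0_injective
    simp only [LinearMap.comp_apply]
    rw [k, map_comul_zero, HopfAlgebra.mul_antipode_rTensor_comul_apply]
    rfl
  mul_antipode_lTensor_comul := by
    ext x
    have k : ∀ z : Deg0 𝒜 ⊗[K] Deg0 𝒜,
        in0 𝒜 (LinearMap.mul' K (Deg0 𝒜) ((antipodeZero 𝒜).lTensor _ z)) =
        LinearMap.mul' K H ((HopfAlgebra.antipode K).lTensor H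
          (TensorProduct.map (in0 𝒜) (in0 𝒜) z)) := by
      intro z
      induction z using TensorProduct.induction_on with
      | zero => simp
      | tmul x y => simp [in0_mul, in0_antipodeZero]
      | add x y hx hy => simp only [map_add, hx, hy]
    apply in0_injective
    simp only [LinearMap.comp_apply]
    rw [k, map_comul_zero, HopfAlgebra.mul_antipode_lTensor_comul_apply]
    rfl

/-- The left action of `H₀` on `H₁` by multiplication. -/
def actL : Deg0 𝒜 →ₗ[K] 𝒜 1 →ₗ[K] 𝒜 1 :=
  LinearMap.mk₂ K (fun h m => ⟨in0 𝒜 h * m, by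
    have := SetLike.mul_mem_graded (A := 𝒜) (in0_mem 𝒜 h) m.2; rwa [zero_add] at this⟩)
    (fun _ _ _ => Subtype.ext (add_mul _ _ _)) (fun _ _ _ => Subtype.ext (smul_mul_assoc _ _ _))
    (fun _ _ _ => Subtype.ext (mul_add _ _ _)) (fun _ _ _ => Subtype.ext (mul_smul_comm _ _ _))

/-- The right action of `H₀` on `H₁` by multiplication. -/
def actR : 𝒜 1 →ₗ[K] Deg0 𝒜 →ₗ[K] 𝒜 1 :=
  LinearMap.mk₂ K (fun m h => ⟨(m : H) * in0 𝒜 h, by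
    have := SetLike.mul_mem_graded (A := 𝒜) m.2 (in0_mem 𝒜 h); rwa [add_zero] at this⟩)
    (fun _ _ _ => Subtype.ext (add_mul _ _ _)) (fun _ _ _ => Subtype.ext (smul_mul_assoc _ _ _))
    (fun _ _ _ => Subtype.ext (mul_add _ _ _)) (fun _ _ _ => Subtype.ext (mul_smul_comm _ _ _))

/-- The component `ρ_l : H₁ → H₀ ⊗ H₁` of `Δ`. -/
def coactL : 𝒜 1 →ₗ[K] Deg0 𝒜 ⊗[K] 𝒜 1 :=
  TensorProduct.map (pr0 𝒜) (grProj 𝒜 1) ∘ₗ Coalgebra.comul ∘ₗ (𝒜 1).subtype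

/-- The component `ρ_r : H₁ → H₁ ⊗ H₀` of `Δ`. -/
def coactR : 𝒜 1 →ₗ[K] 𝒜 1 ⊗[K] Deg0 𝒜 :=
  TensorProduct.map (grProj 𝒜 1) (pr0 𝒜) ∘ₗ Coalgebra.comul ∘ₗ (𝒜 1).subtype

theorem proj01_01 (z : Deg0 𝒜 ⊗[K] 𝒜 1) : TensorProduct.map (pr0 𝒜) (grProj 𝒜 1)
    (TensorProduct.map (in0 𝒜) (𝒜 1).subtype z) = z := by
  rw [← LinearMap.comp_apply, ← TensorProduct.map_comp, pr0_same, grProj_same,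
    TensorProduct.map_id, LinearMap.id_apply]

theorem proj10_10 (z : 𝒜 1 ⊗[K] Deg0 𝒜) : TensorProduct.map (grProj 𝒜 1) (pr0 𝒜)
    (TensorProduct.map (𝒜 1).subtype (in0 𝒜) z) = z := by
  rw [← LinearMap.comp_apply, ← TensorProduct.map_comp, pr0_same, grProj_same,
    TensorProduct.map_id, LinearMap.id_apply]

theorem proj01_10 (z : 𝒜 1 ⊗[K] Deg0 𝒜) : TensorProduct.map (pr0 𝒜) (grProj 𝒜 1)
    (TensorProduct.map (𝒜 1).subtype (in0 𝒜) z) = 0 := by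
  rw [← LinearMap.comp_apply, ← TensorProduct.map_comp, pr0_ne,
    TensorProduct.map_zero_left, LinearMap.zero_apply]

theorem proj10_01 (z : Deg0 𝒜 ⊗[K] 𝒜 1) : TensorProduct.map (grProj 𝒜 1) (pr0 𝒜)
    (TensorProduct.map (in0 𝒜) (𝒜 1).subtype z) = 0 := by
  rw [← LinearMap.comp_apply, ← TensorProduct.map_comp, grProj_in0,
    TensorProduct.map_zero_left, LinearMap.zero_apply]

/-- `Δ(m) = ρ_l(m) + ρ_r(m)` for `m ∈ H₁`. -/
theorem coact_add (m : 𝒜 1) : TensorProduct.map (in0 𝒜) (𝒜 1).subtype (coactL 𝒜 m) +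
    TensorProduct.map (𝒜 1).subtype (in0 𝒜) (coactR 𝒜 m) =
      Coalgebra.comul (R := K) (m : H) := by
  have h := GradedHopf.comul_mem 1 (m : H) m.2
  have hle : (⨆ (i : ℕ) (j : ℕ) (_ : i + j = 1),
      LinearMap.range (TensorProduct.map (𝒜 i).subtype (𝒜 j).subtype)) ≤
      LinearMap.range (TensorProduct.map (in0 𝒜) (𝒜 1).subtype) ⊔
        LinearMap.range (TensorProduct.map (𝒜 1).subtype (in0 𝒜)) := by
    refine iSup_le fun i => iSup_le fun j => iSup_le fun hij => ?_
    obtain ⟨rfl, rfl⟩ | ⟨rfl, rfl⟩ : (i = 0 ∧ j = 1) ∨ (i = 1 ∧ j = 0) := by omega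
    · exact le_sup_left
    · exact le_sup_right
  replace h := hle h
  obtain ⟨_, ⟨u, rfl⟩, _, ⟨v, rfl⟩, huv⟩ := Submodule.mem_sup.1 h
  simp only [coactL, coactR, LinearMap.comp_apply, Submodule.subtype_apply]
  rw [← huv]
  simp only [map_add, proj01_01, proj01_10, proj10_10, proj10_01, map_zero, add_zero, zero_add]

theorem eq_of_components {u u' : Deg0 𝒜 ⊗[K] 𝒜 1} {v v' : 𝒜 1 ⊗[K] Deg0 𝒜}
    (h : TensorProduct.map (in0 𝒜) (𝒜 1).subtype u +
      TensorProduct.map (𝒜 1).subtype (in0 𝒜) v =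
      TensorProduct.map (in0 𝒜) (𝒜 1).subtype u' +
      TensorProduct.map (𝒜 1).subtype (in0 𝒜) v') : u = u' ∧ v = v' := by
  constructor
  · have := congrArg (TensorProduct.map (pr0 𝒜) (grProj 𝒜 1)) h
    simpa only [map_add, proj01_01, proj01_10, add_zero] using this
  · have := congrArg (TensorProduct.map (grProj 𝒜 1) (pr0 𝒜)) h
    simpa only [map_add, proj10_10, proj10_01, zero_add] using this

theorem eq_of_components₃ {u u' : Deg0 𝒜 ⊗[K] (Deg0 𝒜 ⊗[K] 𝒜 1)} {v v' : Deg0 𝒜 ⊗[K] (𝒜 1 ⊗[K] Deg0 𝒜)}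
    {w w' : 𝒜 1 ⊗[K] (Deg0 𝒜 ⊗[K] Deg0 𝒜)}
    (h : TensorProduct.map (in0 𝒜) (TensorProduct.map (in0 𝒜) (𝒜 1).subtype) u +
      TensorProduct.map (in0 𝒜) (TensorProduct.map (𝒜 1).subtype (in0 𝒜)) v +
      TensorProduct.map (𝒜 1).subtype (TensorProduct.map (in0 𝒜) (in0 𝒜)) w =
      TensorProduct.map (in0 𝒜) (TensorProduct.map (in0 𝒜) (𝒜 1).subtype) u' +
      TensorProduct.map (in0 𝒜) (TensorProduct.map (𝒜 1).subtype (in0 𝒜)) v' +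
      TensorProduct.map (𝒜 1).subtype (TensorProduct.map (in0 𝒜) (in0 𝒜)) w') :
    u = u' ∧ v = v' ∧ w = w' := by
  refine ⟨?_, ?_, ?_⟩
  · have := congrArg (TensorProduct.map (pr0 𝒜)
      (TensorProduct.map (pr0 𝒜) (grProj 𝒜 1))) h
    simpa only [map_add, ← LinearMap.comp_apply (TensorProduct.map _ _) (TensorProduct.map _ _),
      ← TensorProduct.map_comp, grProj_same, pr0_same, pr0_ne, grProj_in0,
      TensorProduct.map_zero_left, TensorProduct.map_zero_right, TensorProduct.map_id,
      LinearMap.id_apply, LinearMap.zero_apply, add_zero, zero_add] using this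
  · have := congrArg (TensorProduct.map (pr0 𝒜)
      (TensorProduct.map (grProj 𝒜 1) (pr0 𝒜))) h
    simpa only [map_add, ← LinearMap.comp_apply (TensorProduct.map _ _) (TensorProduct.map _ _),
      ← TensorProduct.map_comp, grProj_same, pr0_same, pr0_ne, grProj_in0,
      TensorProduct.map_zero_left, TensorProduct.map_zero_right, TensorProduct.map_id,
      LinearMap.id_apply, LinearMap.zero_apply, add_zero, zero_add] using this
  · have := congrArg (TensorProduct.map (grProj 𝒜 1)
      (TensorProduct.map (pr0 𝒜) (pr0 𝒜))) h
    simpa only [map_add, ← LinearMap.comp_apply (TensorProduct.map _ _) (TensorProduct.map _ _),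
      ← TensorProduct.map_comp, grProj_same, pr0_same, pr0_ne, grProj_in0,
      TensorProduct.map_zero_left, TensorProduct.map_zero_right, TensorProduct.map_id,
      LinearMap.id_apply, LinearMap.zero_apply, add_zero, zero_add] using this

section
variable {Y : Type*} [AddCommGroup Y] [Module K Y] (j : Y →ₗ[K] H)

theorem comul_rTensor_zero (z : Deg0 𝒜 ⊗[K] Y) : TensorProduct.assoc K H H H
    ((Coalgebra.comul (R := K)).rTensor H (TensorProduct.map (in0 𝒜) j z)) =
    TensorProduct.map (in0 𝒜) (TensorProduct.map (in0 𝒜) j)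
      (TensorProduct.assoc K _ _ _ ((Coalgebra.comul (R := K)).rTensor Y z)) := by
  induction z using TensorProduct.induction_on with
  | zero => simp
  | tmul x y =>
    simp only [TensorProduct.map_tmul, LinearMap.rTensor_tmul, Submodule.subtype_apply,
      ← map_comul_zero]
    induction Coalgebra.comul (R := K) x using TensorProduct.induction_on with
    | zero => simp
    | tmul a b => simp
    | add a b ha hb => simp only [TensorProduct.add_tmul, map_add, ha, hb]
  | add x y hx hy => simp only [map_add, hx, hy]

theorem comul_rTensor_one (z : 𝒜 1 ⊗[K] Y) : TensorProduct.assoc K H H H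
    ((Coalgebra.comul (R := K)).rTensor H (TensorProduct.map (𝒜 1).subtype j z)) =
    TensorProduct.map (in0 𝒜) (TensorProduct.map (𝒜 1).subtype j)
      (TensorProduct.assoc K _ _ _ ((coactL 𝒜).rTensor Y z)) +
    TensorProduct.map (𝒜 1).subtype (TensorProduct.map (in0 𝒜) j)
      (TensorProduct.assoc K _ _ _ ((coactR 𝒜).rTensor Y z)) := by
  induction z using TensorProduct.induction_on with
  | zero => simp
  | tmul x y =>
    simp only [TensorProduct.map_tmul, LinearMap.rTensor_tmul, Submodule.subtype_apply,
      ← coact_add, TensorProduct.add_tmul, map_add]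
    congr 1
    · induction coactL 𝒜 x using TensorProduct.induction_on with
      | zero => simp
      | tmul a b => simp
      | add a b ha hb => simp only [TensorProduct.add_tmul, map_add, ha, hb]
    · induction coactR 𝒜 x using TensorProduct.induction_on with
      | zero => simp
      | tmul a b => simp
      | add a b ha hb => simp only [TensorProduct.add_tmul, map_add, ha, hb]
  | add x y hx hy => simp only [map_add, hx, hy]; abel

theorem comul_lTensor_zero (z : Y ⊗[K] Deg0 𝒜) : (Coalgebra.comul (R := K)).lTensor H
    (TensorProduct.map j (in0 𝒜) z) =
    TensorProduct.map j (TensorProduct.map (in0 𝒜) (in0 𝒜))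
      ((Coalgebra.comul (R := K)).lTensor Y z) := by
  induction z using TensorProduct.induction_on with
  | zero => simp
  | tmul x y => simp [map_comul_zero]
  | add x y hx hy => simp only [map_add, hx, hy]

theorem comul_lTensor_one (z : Y ⊗[K] 𝒜 1) : (Coalgebra.comul (R := K)).lTensor H
    (TensorProduct.map j (𝒜 1).subtype z) =
    TensorProduct.map j (TensorProduct.map (in0 𝒜) (𝒜 1).subtype)
      ((coactL 𝒜).lTensor Y z) +
    TensorProduct.map j (TensorProduct.map (𝒜 1).subtype (in0 𝒜))
      ((coactR 𝒜).lTensor Y z) := by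
  induction z using TensorProduct.induction_on with
  | zero => simp
  | tmul x y => simp [← coact_add, TensorProduct.tmul_add]
  | add x y hx hy => simp only [map_add, hx, hy]; abel

end

theorem coact_coassoc (m : 𝒜 1) :
    TensorProduct.assoc K _ _ _ ((Coalgebra.comul (R := K)).rTensor _ (coactL 𝒜 m)) =
      (coactL 𝒜).lTensor _ (coactL 𝒜 m) ∧
    TensorProduct.assoc K _ _ _ ((coactL 𝒜).rTensor _ (coactR 𝒜 m)) =
      (coactR 𝒜).lTensor _ (coactL 𝒜 m) ∧
    TensorProduct.assoc K _ _ _ ((coactR 𝒜).rTensor _ (coactR 𝒜 m)) =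
      (Coalgebra.comul (R := K)).lTensor _ (coactR 𝒜 m) := by
  have h := Coalgebra.coassoc_apply (R := K) (m : H)
  rw [← coact_add, map_add, map_add, map_add, comul_rTensor_zero, comul_rTensor_one,
    comul_lTensor_zero, comul_lTensor_one, ← add_assoc] at h
  exact eq_of_components₃ 𝒜 h

theorem mapAct (h g : Deg0 𝒜 ⊗[K] Deg0 𝒜) (z : Deg0 𝒜 ⊗[K] 𝒜 1) :
    TensorProduct.map (in0 𝒜) (𝒜 1).subtype (TensorProduct.map₂ (LinearMap.mul K (Deg0 𝒜))
      (actR 𝒜) (TensorProduct.map₂ (LinearMap.mul K (Deg0 𝒜)) (actL 𝒜) h z) g) =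
    TensorProduct.map (in0 𝒜) (in0 𝒜) h *
      TensorProduct.map (in0 𝒜) (𝒜 1).subtype z *
      TensorProduct.map (in0 𝒜) (in0 𝒜) g := by
  induction h using TensorProduct.induction_on with
  | zero => simp
  | add x y hx hy => simp only [add_mul, map_add, hx, hy, LinearMap.add_apply]
  | tmul a b =>
    induction g using TensorProduct.induction_on with
    | zero => simp
    | add x y hx hy => simp only [mul_add, map_add, hx, hy]
    | tmul c d =>
      induction z using TensorProduct.induction_on with
      | zero => simp
      | add x y hx hy => simp only [add_mul, mul_add, map_add, hx, hy, LinearMap.add_apply]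
      | tmul e f => simp [actL, actR, in0_mul]

theorem mapAct' (h g : Deg0 𝒜 ⊗[K] Deg0 𝒜) (z : 𝒜 1 ⊗[K] Deg0 𝒜) :
    TensorProduct.map (𝒜 1).subtype (in0 𝒜) (TensorProduct.map₂ (actR 𝒜)
      (LinearMap.mul K (Deg0 𝒜)) (TensorProduct.map₂ (actL 𝒜) (LinearMap.mul K (Deg0 𝒜)) h z) g) =
    TensorProduct.map (in0 𝒜) (in0 𝒜) h *
      TensorProduct.map (𝒜 1).subtype (in0 𝒜) z *
      TensorProduct.map (in0 𝒜) (in0 𝒜) g := by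
  induction h using TensorProduct.induction_on with
  | zero => simp
  | add x y hx hy => simp only [add_mul, map_add, hx, hy, LinearMap.add_apply]
  | tmul a b =>
    induction g using TensorProduct.induction_on with
    | zero => simp
    | add x y hx hy => simp only [mul_add, map_add, hx, hy]
    | tmul c d =>
      induction z using TensorProduct.induction_on with
      | zero => simp
      | add x y hx hy => simp only [add_mul, mul_add, map_add, hx, hy, LinearMap.add_apply]
      | tmul e f => simp [actL, actR, in0_mul]

theorem coact_act (h : Deg0 𝒜) (m : 𝒜 1) (g : Deg0 𝒜) :
    coactL 𝒜 (actR 𝒜 (actL 𝒜 h m) g) =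
      TensorProduct.map₂ (LinearMap.mul K (Deg0 𝒜)) (actR 𝒜)
        (TensorProduct.map₂ (LinearMap.mul K (Deg0 𝒜)) (actL 𝒜) (Coalgebra.comul (R := K) h)
          (coactL 𝒜 m)) (Coalgebra.comul (R := K) g) ∧
    coactR 𝒜 (actR 𝒜 (actL 𝒜 h m) g) =
      TensorProduct.map₂ (actR 𝒜) (LinearMap.mul K (Deg0 𝒜))
        (TensorProduct.map₂ (actL 𝒜) (LinearMap.mul K (Deg0 𝒜)) (Coalgebra.comul (R := K) h)
          (coactR 𝒜 m)) (Coalgebra.comul (R := K) g) := by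
  apply eq_of_components
  rw [coact_add, mapAct, mapAct', ← add_mul, ← mul_add, coact_add, map_comul_zero, map_comul_zero,
    ← Bialgebra.comul_mul, ← Bialgebra.comul_mul]
  rfl

theorem counit_one_eq : (Coalgebra.counit (R := K) (A := H)) ∘ₗ (𝒜 1).subtype = 0 := by
  ext x
  exact GradedHopf.counit_eq_zero 1 one_pos (x : H) x.2

theorem coactL_counit (m : 𝒜 1) :
    TensorProduct.lid K _ ((Coalgebra.counit (R := K)).rTensor _ (coactL 𝒜 m)) = m := by
  apply (𝒜 1).injective_subtype
  have k : ∀ z : Deg0 𝒜 ⊗[K] 𝒜 1, (𝒜 1).subtype (TensorProduct.lid K _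
      ((Coalgebra.counit (R := K)).rTensor _ z)) = TensorProduct.lid K _
      ((Coalgebra.counit (R := K)).rTensor _
        (TensorProduct.map (in0 𝒜) (𝒜 1).subtype z)) := by
    intro z
    induction z using TensorProduct.induction_on with
    | zero => simp
    | tmul x y => simp [counit_zero]
    | add x y hx hy => simp only [map_add, hx, hy]
  have k2 : (Coalgebra.counit (R := K)).rTensor _
      (TensorProduct.map (𝒜 1).subtype (in0 𝒜) (coactR 𝒜 m)) = 0 := by
    rw [← LinearMap.comp_apply, LinearMap.rTensor_comp_map, counit_one_eq,
      TensorProduct.map_zero_left, LinearMap.zero_apply]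
  have h := Coalgebra.rTensor_counit_comul (R := K) (m : H)
  rw [← coact_add, map_add, k2, add_zero] at h
  rw [k, h]
  simp

theorem coactR_counit (m : 𝒜 1) :
    TensorProduct.rid K _ ((Coalgebra.counit (R := K)).lTensor _ (coactR 𝒜 m)) = m := by
  apply (𝒜 1).injective_subtype
  have k : ∀ z : 𝒜 1 ⊗[K] Deg0 𝒜, (𝒜 1).subtype (TensorProduct.rid K _
      ((Coalgebra.counit (R := K)).lTensor _ z)) = TensorProduct.rid K _
      ((Coalgebra.counit (R := K)).lTensor _
        (TensorProduct.map (𝒜 1).subtype (in0 𝒜) z)) := by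
    intro z
    induction z using TensorProduct.induction_on with
    | zero => simp
    | tmul x y => simp [counit_zero]
    | add x y hx hy => simp only [map_add, hx, hy]
  have k2 : (Coalgebra.counit (R := K)).lTensor _
      (TensorProduct.map (in0 𝒜) (𝒜 1).subtype (coactL 𝒜 m)) = 0 := by
    rw [← LinearMap.comp_apply, LinearMap.lTensor_comp_map, counit_one_eq,
      TensorProduct.map_zero_right, LinearMap.zero_apply]
  have h := Coalgebra.lTensor_counit_comul (R := K) (m : H)
  rw [← coact_add, map_add, k2, zero_add] at h
  rw [k, h]
  simp

/-- The couple `(H₀, H₁)` associated to a graded Hopf algebra `H`: `H₀` acts on `H₁` by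
multiplication, and the coactions are determined by `Δ(m) = ρ_l(m) + ρ_r(m)`. -/
def couple : HopfBimodule K (Deg0 𝒜) (𝒜 1) where
  lact := actL 𝒜
  ract := actR 𝒜
  lcoact := coactL 𝒜
  rcoact := coactR 𝒜
  one_lact m := Subtype.ext (one_mul (m : H))
  mul_lact g h m := Subtype.ext (mul_assoc (in0 𝒜 g) (in0 𝒜 h) (m : H))
  ract_one m := Subtype.ext (mul_one (m : H))
  ract_mul m g h := Subtype.ext (mul_assoc (m : H) (in0 𝒜 g) (in0 𝒜 h)).symm
  lact_ract h m g := Subtype.ext (mul_assoc (in0 𝒜 h) (m : H) (in0 𝒜 g))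
  lcoact_counit := coactL_counit 𝒜
  rcoact_counit := coactR_counit 𝒜
  lcoact_coassoc m := (coact_coassoc 𝒜 m).1
  rcoact_coassoc m := (coact_coassoc 𝒜 m).2.2
  lcoact_rcoact m := (coact_coassoc 𝒜 m).2.1
  lcoact_act h m g := (coact_act 𝒜 h m g).1
  rcoact_act h m g := (coact_act 𝒜 h m g).2

end Graded

section Conv

variable {K C A : Type*} [Field K] [AddCommGroup C] [Module K C] [Coalgebra K C] [Ring A]
  [Algebra K A]

/-- In the convolution algebra, `1 - ν` is invertible if `ν` is locally nilpotent. -/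
theorem isUnit_one_sub (ν : WithConv (C →ₗ[K] A))
    (h : LocNil (Coalgebra.comul (R := K)) ν.ofConv) : IsUnit (1 - ν) := by
  have hZ : ∀ Z : WithConv (C →ₗ[K] A), Z = ν * Z → Z = 0 := by
    intro Z hZ
    let _ : Module (TensorAlgebra K A) A :=
      Module.compHom A (TensorAlgebra.lift K (LinearMap.id : A →ₗ[K] A)).toRingHom
    have hs : ∀ (t : TensorAlgebra K A) (a : A),
        t • a = TensorAlgebra.lift K (LinearMap.id : A →ₗ[K] A) t * a := fun _ _ => rfl
    have : IsScalarTower K (TensorAlgebra K A) A := ⟨fun r t a => by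
      rw [hs, hs, map_smul, smul_mul_assoc]⟩
    have := h.eq_zero Z.ofConv (fun c => by
      have e := congrArg (fun F : WithConv (C →ₗ[K] A) => F.ofConv c) hZ
      refine e.trans ?_
      change LinearMap.mul' K A (TensorProduct.map ν.ofConv Z.ofConv (Coalgebra.comul (R := K) c))
        = _
      generalize Coalgebra.comul (R := K) c = w
      induction w using TensorProduct.induction_on with
      | zero => simp
      | tmul x y => simp [hs]
      | add x y hx hy => simp only [map_add, hx, hy])
    exact WithConv.ext (LinearMap.ext this)
  set R : WithConv (C →ₗ[K] A) := WithConv.toConv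
    ((TensorAlgebra.lift K (LinearMap.id : A →ₗ[K] A)).toLinearMap ∘ₗ HopfBimodule.expG h) with hR
  have hR1 : R = 1 + ν * R := by
    apply WithConv.ext
    ext c
    change TensorAlgebra.lift K (LinearMap.id : A →ₗ[K] A) (HopfBimodule.expG h c) =
      algebraMap K A (Coalgebra.counit (R := K) c) +
      LinearMap.mul' K A (TensorProduct.map ν.ofConv R.ofConv (Coalgebra.comul (R := K) c))
    rw [HopfBimodule.expG_eq, map_add, AlgHom.commutes]
    congr 1
    generalize Coalgebra.comul (R := K) c = w
    induction w using TensorProduct.induction_on with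
    | zero => simp
    | tmul x y => simp [hR]
    | add x y hx hy => simp only [map_add, hx, hy]
  have h1 : (1 - ν) * R = 1 := by
    rw [sub_mul, one_mul, sub_eq_iff_eq_add]; exact hR1
  have h2 : R * (1 - ν) = 1 := by
    rw [← sub_eq_zero]
    apply hZ
    have : (1 - ν) * (R * (1 - ν) - 1) = 0 := by
      rw [mul_sub, ← mul_assoc, h1, one_mul, mul_one, sub_self]
    rw [sub_mul, one_mul, sub_eq_zero] at this
    exact this
  exact ⟨⟨1 - ν, R, h1, h2⟩, rfl⟩

end Conv

section Fil

variable {K M : Type*} [Field K] [AddCommGroup M] [Module K M]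

/-- The filtration `⨁_{i ≤ n} M^{⊗i}`. -/
def tFil (K M : Type*) [Field K] [AddCommGroup M] [Module K M] (n : ℕ) :
    Submodule K (TensorAlgebra K M) :=
  (1 ⊔ LinearMap.range (TensorAlgebra.ι K : M →ₗ[K] TensorAlgebra K M)) ^ n

theorem tFil_mono (n : ℕ) : tFil K M n ≤ tFil K M (n + 1) := by
  rw [tFil, tFil, pow_succ]
  exact le_mul_of_one_le_right' le_sup_left

theorem one_mem_tFil (n : ℕ) : (1 : TensorAlgebra K M) ∈ tFil K M n := by
  induction n with
  | zero => rw [tFil, pow_zero]; exact Submodule.one_le.1 le_rfl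
  | succ n ih => exact tFil_mono n ih

theorem ι_mul_mem_tFil {n : ℕ} (m : M) {t : TensorAlgebra K M} (ht : t ∈ tFil K M n) :
    TensorAlgebra.ι K m * t ∈ tFil K M (n + 1) := by
  rw [tFil, pow_succ']
  exact Submodule.mul_mem_mul (Submodule.mem_sup_right ⟨m, rfl⟩) ht

theorem tFil_induction {n : ℕ} {p : TensorAlgebra K M → Prop} (x : TensorAlgebra K M)
    (hx : x ∈ tFil K M (n + 1)) (hadd : ∀ x y, p x → p y → p (x + y))
    (hn : ∀ t ∈ tFil K M n, p t)
    (hmul : ∀ m, ∀ t ∈ tFil K M n, p (TensorAlgebra.ι K m * t)) : p x := by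
  rw [tFil, pow_succ'] at hx
  refine Submodule.mul_induction_on hx ?_ hadd
  intro a ha b hb
  obtain ⟨a1, h1, _, ⟨m, rfl⟩, rfl⟩ := Submodule.mem_sup.1 ha
  obtain ⟨r, rfl⟩ := Submodule.mem_one.1 h1
  rw [add_mul]
  refine hadd _ _ (hn _ ?_) (hmul m b hb)
  rw [← Algebra.smul_def]
  exact Submodule.smul_mem _ _ hb

theorem tFil_exhaust (x : TensorAlgebra K M) : ∃ n, x ∈ tFil K M n := by
  have mono : ∀ n k, tFil K M n ≤ tFil K M (n + k) := by
    intro n k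
    induction k with
    | zero => exact le_rfl
    | succ k ih => exact ih.trans (tFil_mono _)
  induction x using tInd with
  | h1 => exact ⟨0, one_mem_tFil 0⟩
  | hadd x y hx hy =>
    obtain ⟨n, hn⟩ := hx
    obtain ⟨k, hk⟩ := hy
    exact ⟨n + k, add_mem (mono n k hn) (add_comm k n ▸ mono k n hk)⟩
  | hsmul r x hx => exact hx.imp fun n hn => Submodule.smul_mem _ r hn
  | hmul m x hx => exact hx.elim fun n hn => ⟨n + 1, ι_mul_mem_tFil m hn⟩

theorem tFil_zero {x : TensorAlgebra K M} (hx : x ∈ tFil K M 0) : ∃ r : K, r • 1 = x := by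
  rw [tFil, pow_zero, Submodule.mem_one] at hx
  exact hx.imp fun r hr => by rw [← hr, Algebra.algebraMap_eq_smul_one]

theorem range_lTensor_mono {A B : Type*} [AddCommGroup A] [Module K A] [AddCommGroup B]
    [Module K B] {D D' : Submodule K B} (h : D ≤ D') :
    LinearMap.range (D.subtype.lTensor A) ≤ LinearMap.range (D'.subtype.lTensor A) := by
  rintro _ ⟨z, rfl⟩
  refine ⟨(Submodule.inclusion h).lTensor A z, ?_⟩
  rw [← LinearMap.comp_apply, ← LinearMap.lTensor_comp]
  rfl

theorem range_lTensor_smul {B : Type*} [AddCommGroup B] [Module K B] {D : Submodule K B}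
    (s : TensorAlgebra K M) {z : TensorAlgebra K M ⊗[K] B}
    (hz : z ∈ LinearMap.range (D.subtype.lTensor (TensorAlgebra K M))) :
    s • z ∈ LinearMap.range (D.subtype.lTensor (TensorAlgebra K M)) := by
  obtain ⟨z, rfl⟩ := hz
  exact ⟨s • z, lTensor_t_smul _ _ _⟩

theorem tDec_tFil (n : ℕ) : ∀ t ∈ tFil K M (n + 1), tDec t ∈
    LinearMap.range ((tFil K M n).subtype.lTensor (TensorAlgebra K M)) := by
  induction n with
  | zero =>
    intro t ht
    have : tDec t = 0 := by
      refine tFil_induction (p := fun t => tDec t = 0) t ht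
        (fun x y hx hy => by rw [map_add, hx, hy, add_zero]) (fun t ht => ?_) (fun m t ht => ?_)
      · obtain ⟨r, rfl⟩ := tFil_zero ht
        simp
      · obtain ⟨r, rfl⟩ := tFil_zero ht
        simp [tDec_ι]
    rw [this]
    exact zero_mem _
  | succ n ih =>
    intro t ht
    refine tFil_induction (p := fun t => tDec t ∈
      LinearMap.range ((tFil K M (n + 1)).subtype.lTensor (TensorAlgebra K M))) t ht
      (fun x y hx hy => by rw [map_add]; exact add_mem hx hy)
      (fun t ht => range_lTensor_mono (tFil_mono n) (ih t ht)) (fun m t ht => ?_)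
    rw [tDec_ι_mul]
    refine add_mem ⟨TensorAlgebra.ι K m ⊗ₜ ⟨tPlus t, ?_⟩, rfl⟩
      (range_lTensor_smul _ (range_lTensor_mono (tFil_mono n) (ih t ht)))
    have : tPlus t = t - TensorAlgebra.algebraMapInv t • 1 := by
      simp [tPlus, Algebra.ofId_apply, Algebra.algebraMap_eq_smul_one]
    rw [this]
    exact sub_mem ht (Submodule.smul_mem _ _ (one_mem_tFil _))

end Fil

namespace HopfBimodule

variable {K H M : Type*} [Field K] [Ring H] [HopfAlgebra K H] [AddCommGroup M] [Module K M]
  (P : HopfBimodule K H M)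

/-- The filtration of `H × T(M)` by degree. -/
def ambFil (K H M : Type*) [Field K] [Ring H] [HopfAlgebra K H] [AddCommGroup M] [Module K M]
    (n : ℕ) : Submodule K (H × TensorAlgebra K M) :=
  Submodule.prod ⊤ (tFil K M n)

theorem tL_tFil (n : ℕ) : ∀ t ∈ tFil K M n, P.tL t ∈
    LinearMap.range ((tFil K M n).subtype.lTensor H) := by
  induction n with
  | zero =>
    intro t ht
    obtain ⟨r, rfl⟩ := tFil_zero ht
    simp
  | succ n ih =>
    intro t ht
    refine tFil_induction (p := fun t => P.tL t ∈
      LinearMap.range ((tFil K M (n + 1)).subtype.lTensor H)) t ht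
      (fun x y hx hy => by rw [map_add]; exact add_mem hx hy)
      (fun t ht => range_lTensor_mono (tFil_mono n) (ih t ht)) (fun m t ht => ?_)
    rw [tL_ι_mul]
    exact range_lTensor_of_comp _ _ (fun b => ι_mul_mem_tFil b ht) _

theorem lTensor_inr_tFil {A : Type*} [AddCommGroup A] [Module K A] {n : ℕ}
    {z : A ⊗[K] TensorAlgebra K M}
    (hz : z ∈ LinearMap.range ((tFil K M n).subtype.lTensor A)) :
    (LinearMap.inr K H (TensorAlgebra K M)).lTensor A z ∈
      LinearMap.range ((ambFil K H M n).subtype.lTensor A) := by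
  obtain ⟨z, rfl⟩ := hz
  rw [← LinearMap.comp_apply, ← LinearMap.lTensor_comp]
  refine range_lTensor_of_comp _ _ (fun b => ?_) _
  rw [ambFil, Submodule.mem_prod]
  exact ⟨trivial, b.2⟩

theorem lTensor_inl_tFil {A : Type*} [AddCommGroup A] [Module K A] (n : ℕ) (z : A ⊗[K] H) :
    (LinearMap.inl K H (TensorAlgebra K M)).lTensor A z ∈
      LinearMap.range ((ambFil K H M n).subtype.lTensor A) := by
  refine range_lTensor_of_comp _ _ (fun b => ?_) _
  rw [ambFil, Submodule.mem_prod]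
  exact ⟨trivial, zero_mem _⟩

theorem fst_ambComul_fil {n : ℕ} {a : H × TensorAlgebra K M} (ha : a ∈ ambFil K H M n) :
    (LinearMap.fst K H (TensorAlgebra K M)).rTensor _ (P.ambComul a) ∈
      LinearMap.range ((ambFil K H M n).subtype.lTensor H) := by
  rw [fst_rTensor_ambComul]
  exact add_mem (lTensor_inl_tFil n _)
    (lTensor_inr_tFil (P.tL_tFil n a.2 ((Submodule.mem_prod.1 ha).2)))

theorem snd_rTensor_ambComul (a : H × TensorAlgebra K M) :
    (LinearMap.snd K H (TensorAlgebra K M)).rTensor _ (P.ambComul a) =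
      (LinearMap.inr K H (TensorAlgebra K M)).lTensor _ (tDec a.2) +
      (LinearMap.inl K H (TensorAlgebra K M)).lTensor _ (P.tR a.2) := by
  have e : LinearMap.snd K H (TensorAlgebra K M) =
    LinearMap.id ∘ₗ LinearMap.snd K H (TensorAlgebra K M) := rfl
  rw [ambComul_apply, e]
  simp only [map_add, snd_rH, snd_rT, zero_add, LinearMap.rTensor_id, LinearMap.id_apply]

theorem snd_ambComul_fil {n : ℕ} {a : H × TensorAlgebra K M} (ha : a ∈ ambFil K H M (n + 1)) :
    (LinearMap.snd K H (TensorAlgebra K M)).rTensor _ (P.ambComul a) ∈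
      LinearMap.range ((ambFil K H M n).subtype.lTensor (TensorAlgebra K M)) := by
  rw [snd_rTensor_ambComul]
  exact add_mem (lTensor_inr_tFil (tDec_tFil n a.2 ((Submodule.mem_prod.1 ha).2)))
    (lTensor_inl_tFil n _)

theorem snd_ambComul_fil_zero {a : H × TensorAlgebra K M} (ha : a ∈ ambFil K H M 0) :
    (LinearMap.snd K H (TensorAlgebra K M)).rTensor _ (P.ambComul a) = 0 := by
  rw [snd_rTensor_ambComul]
  obtain ⟨r, hr⟩ := tFil_zero (Submodule.mem_prod.1 ha).2
  rw [← hr]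
  simp

/-- The inclusion of `S_H(M)` in `H × T(M)`. -/
def qVal : P.QSym →ₗ[K] H × TensorAlgebra K M := P.cotVal ∘ₗ P.qsymVal.toLinearMap

theorem qVal_injective : Function.Injective P.qVal :=
  P.cotVal_injective.comp P.qsymVal_injective

theorem map_qVal_comul (x : P.QSym) : TensorProduct.map P.qVal P.qVal
    (Coalgebra.comul (R := K) x) = P.ambComul (P.qVal x) := by
  rw [qVal, TensorProduct.map_comp, LinearMap.comp_apply]
  have := P.map_comul_qsym x
  change TensorProduct.map P.qsymVal.toLinearMap P.qsymVal.toLinearMap _ = _ at this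
  rw [this, map_comul_cot]
  rfl

/-- The projection `S_H(M) → H`. -/
def qFst : P.QSym →ₗ[K] H := LinearMap.fst K H (TensorAlgebra K M) ∘ₗ P.qVal

/-- The component of positive degree. -/
def qSnd : P.QSym →ₗ[K] TensorAlgebra K M := LinearMap.snd K H (TensorAlgebra K M) ∘ₗ P.qVal

theorem map_qFst_comul (x : P.QSym) : TensorProduct.map P.qFst P.qFst
    (Coalgebra.comul (R := K) x) = Coalgebra.comul (R := K) (P.qFst x) := by
  rw [qFst, TensorProduct.map_comp, LinearMap.comp_apply, map_qVal_comul, fst_fst_ambComul]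
  rfl

theorem cotInclH_mul (g h : H) : P.cotInclH (g * h) = P.cotInclH g * P.cotInclH h := by
  have e : P.cotInclH.comp (Bialgebra.mulCoalgHom K H) =
      P.cotMul.comp (Coalgebra.TensorProduct.map P.cotInclH P.cotInclH) := by
    have t : ∀ g h, P.cotMul.comp (Coalgebra.TensorProduct.map P.cotInclH P.cotInclH) (g ⊗ₜ h) =
      P.cotInclH g * P.cotInclH h := fun _ _ => rfl
    have t' : ∀ g h, P.cotInclH.comp (Bialgebra.mulCoalgHom K H) (g ⊗ₜ h) =
      P.cotInclH (g * h) := fun _ _ => rfl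
    have z : ∀ h, P.cotProj (P.cotInclH h) = 0 := fun h => by
      rw [cotProj_apply, cotVal_cotInclH, map_zero]
    apply P.cot_hom_ext
    · intro c
      induction c using TensorProduct.induction_on with
      | zero => simp
      | tmul x y => rw [t, t', cotFst_mul]; rfl
      | add x y hx hy => simp only [map_add, hx, hy]
    · intro c
      induction c using TensorProduct.induction_on with
      | zero => simp
      | tmul x y => rw [t, t', cotProj_mul, z, z, z]; simp
      | add x y hx hy => simp only [map_add, hx, hy]
  exact DFunLike.congr_fun e (g ⊗ₜ h)

/-- The inclusion `H → S_H(M)` as a linear map. -/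
def qInclHLin : H →ₗ[K] P.QSym :=
  LinearMap.codRestrict (Subalgebra.toSubmodule P.qsymSubalgebra) P.cotInclH.toLinearMap
    P.cotInclH_mem

theorem qsymVal_qInclHLin (h : H) : P.qsymVal (P.qInclHLin h) = P.cotInclH h := rfl

/-- The inclusion `H → S_H(M)`, an algebra map. -/
def qInclH : H →ₐ[K] P.QSym :=
  AlgHom.ofLinearMap P.qInclHLin
    (P.qsymVal_injective (by rw [qsymVal_qInclHLin, map_one P.qsymVal]; rfl))
    (fun g h => P.qsymVal_injective (by
      rw [map_mul P.qsymVal, qsymVal_qInclHLin, qsymVal_qInclHLin, qsymVal_qInclHLin,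
        cotInclH_mul]))

theorem qVal_qInclH (h : H) : P.qVal (P.qInclH h) = (h, 0) := rfl

theorem qFst_qInclH (h : H) : P.qFst (P.qInclH h) = h := rfl

/-- The difference of the identity and the projection to `H`. -/
def qDiff : P.QSym →ₗ[K] P.QSym := LinearMap.id - P.qInclH.toLinearMap ∘ₗ P.qFst

theorem qDiff_eq_zero (x : P.QSym) (hx : P.qSnd x = 0) : P.qDiff x = 0 := by
  change x - P.qInclH (P.qFst x) = 0
  rw [sub_eq_zero]
  apply P.qVal_injective
  rw [qVal_qInclH]
  exact Prod.ext rfl hx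

theorem qDiff_rTensor {Y : Type*} [AddCommGroup Y] [Module K Y] (z : P.QSym ⊗[K] Y)
    (hz : P.qSnd.rTensor Y z = 0) : P.qDiff.rTensor Y z = 0 := by
  obtain ⟨w, rfl⟩ := mem_range_rTensor_ker P.qSnd hz
  rw [← LinearMap.comp_apply, ← LinearMap.rTensor_comp]
  have : P.qDiff ∘ₗ (LinearMap.ker P.qSnd).subtype = 0 := by
    ext1 x
    exact P.qDiff_eq_zero x x.2
  rw [this]; simp

/-- The filtration of `S_H(M)` by degree. -/
def qFil (n : ℕ) : Submodule K P.QSym := LinearMap.ker ((ambFil K H M n).mkQ ∘ₗ P.qVal)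

theorem mem_qFil {n : ℕ} {x : P.QSym} : x ∈ P.qFil n ↔ P.qVal x ∈ ambFil K H M n := by
  rw [qFil, LinearMap.mem_ker, LinearMap.comp_apply, Submodule.mkQ_apply,
    Submodule.Quotient.mk_eq_zero]

theorem mkQ_range {A : Type*} [AddCommGroup A] [Module K A] {n : ℕ}
    {z : A ⊗[K] (H × TensorAlgebra K M)}
    (hz : z ∈ LinearMap.range ((ambFil K H M n).subtype.lTensor A)) :
    (ambFil K H M n).mkQ.lTensor A z = 0 := by
  obtain ⟨z, rfl⟩ := hz
  rw [← LinearMap.comp_apply, ← LinearMap.lTensor_comp]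
  have : (ambFil K H M n).mkQ ∘ₗ (ambFil K H M n).subtype = 0 := by
    ext1 x
    simp
  rw [this]; simp

theorem qFst_comul_fil {n : ℕ} {x : P.QSym} (hx : x ∈ P.qFil n) :
    P.qFst.rTensor _ (Coalgebra.comul (R := K) x) ∈
      LinearMap.range ((P.qFil n).subtype.lTensor H) := by
  apply mem_range_lTensor_ker
  have h := mkQ_range (P.fst_ambComul_fil (P.mem_qFil.1 hx))
  rw [← map_qVal_comul, ← LinearMap.comp_apply (LinearMap.lTensor _ _),
    LinearMap.lTensor_comp_rTensor, ← LinearMap.comp_apply, ← TensorProduct.map_comp] at h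
  rw [← LinearMap.comp_apply (LinearMap.lTensor _ _), LinearMap.lTensor_comp_rTensor]
  exact h

theorem qDiff_comul_fil {n : ℕ} {x : P.QSym} (hx : x ∈ P.qFil (n + 1)) :
    P.qDiff.rTensor _ (Coalgebra.comul (R := K) x) ∈
      LinearMap.range ((P.qFil n).subtype.lTensor P.QSym) := by
  apply mem_range_lTensor_ker
  have h := mkQ_range (P.snd_ambComul_fil (P.mem_qFil.1 hx))
  rw [← map_qVal_comul, ← LinearMap.comp_apply (LinearMap.lTensor _ _),
    LinearMap.lTensor_comp_rTensor, ← LinearMap.comp_apply, ← TensorProduct.map_comp] at h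
  rw [← LinearMap.comp_apply (LinearMap.lTensor _ _), LinearMap.lTensor_comp_rTensor,
    ← LinearMap.rTensor_comp_lTensor]
  apply P.qDiff_rTensor
  rw [← LinearMap.comp_apply (LinearMap.rTensor _ _), LinearMap.rTensor_comp_lTensor]
  exact h

theorem qDiff_comul_fil_zero {x : P.QSym} (hx : x ∈ P.qFil 0) :
    P.qDiff.rTensor _ (Coalgebra.comul (R := K) x) = 0 := by
  apply P.qDiff_rTensor
  have h := P.snd_ambComul_fil_zero (P.mem_qFil.1 hx)
  apply Module.Flat.lTensor_preserves_injective_linearMap P.qVal P.qVal_injective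
  rw [map_zero]
  rw [← map_qVal_comul, ← LinearMap.comp_apply (LinearMap.rTensor _ _), LinearMap.rTensor_comp_map]
    at h
  rw [← LinearMap.comp_apply (LinearMap.lTensor _ _), LinearMap.lTensor_comp_rTensor]
  exact h

/-- The antipode of `H` on the degree zero part. -/
def qS0 : P.QSym →ₗ[K] P.QSym := P.qInclH.toLinearMap ∘ₗ HopfAlgebra.antipode K ∘ₗ P.qFst

theorem qG_mul_qS0 : WithConv.toConv (P.qInclH.toLinearMap ∘ₗ P.qFst) * WithConv.toConv P.qS0 =
    (1 : WithConv (P.QSym →ₗ[K] P.QSym)) := by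
  apply WithConv.ext
  ext x
  change LinearMap.mul' K P.QSym (TensorProduct.map (P.qInclH.toLinearMap ∘ₗ P.qFst) P.qS0
    (Coalgebra.comul (R := K) x)) = algebraMap K P.QSym (Coalgebra.counit (R := K) x)
  have k : ∀ z : P.QSym ⊗[K] P.QSym, LinearMap.mul' K P.QSym
      (TensorProduct.map (P.qInclH.toLinearMap ∘ₗ P.qFst) P.qS0 z) =
      P.qInclH (LinearMap.mul' K H ((HopfAlgebra.antipode K).lTensor H
        (TensorProduct.map P.qFst P.qFst z))) := by
    intro z
    induction z using TensorProduct.induction_on with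
    | zero => simp
    | tmul x y => simp [qS0]
    | add x y hx hy => simp only [map_add, hx, hy]
  rw [k, map_qFst_comul, HopfAlgebra.mul_antipode_lTensor_comul_apply, AlgHom.commutes]
  rfl

theorem qS0_mul_qG : WithConv.toConv P.qS0 * WithConv.toConv (P.qInclH.toLinearMap ∘ₗ P.qFst) =
    (1 : WithConv (P.QSym →ₗ[K] P.QSym)) := by
  apply WithConv.ext
  ext x
  change LinearMap.mul' K P.QSym (TensorProduct.map P.qS0 (P.qInclH.toLinearMap ∘ₗ P.qFst)
    (Coalgebra.comul (R := K) x)) = algebraMap K P.QSym (Coalgebra.counit (R := K) x)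
  have k : ∀ z : P.QSym ⊗[K] P.QSym, LinearMap.mul' K P.QSym
      (TensorProduct.map P.qS0 (P.qInclH.toLinearMap ∘ₗ P.qFst) z) =
      P.qInclH (LinearMap.mul' K H ((HopfAlgebra.antipode K).rTensor H
        (TensorProduct.map P.qFst P.qFst z))) := by
    intro z
    induction z using TensorProduct.induction_on with
    | zero => simp
    | tmul x y => simp [qS0]
    | add x y hx hy => simp only [map_add, hx, hy]
  rw [k, map_qFst_comul, HopfAlgebra.mul_antipode_rTensor_comul_apply, AlgHom.commutes]
  rfl

theorem conv_rTensor (s d : P.QSym →ₗ[K] P.QSym) (x : P.QSym) :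
    (WithConv.toConv s * WithConv.toConv d).ofConv.rTensor P.QSym (Coalgebra.comul (R := K) x) =
    (LinearMap.mul' K P.QSym).rTensor _ ((TensorProduct.assoc K _ _ _).symm
      (TensorProduct.map s (d.rTensor _ ∘ₗ Coalgebra.comul) (Coalgebra.comul (R := K) x))) := by
  have k1 : ∀ z : P.QSym ⊗[K] P.QSym,
      (WithConv.toConv s * WithConv.toConv d).ofConv.rTensor P.QSym z =
      (LinearMap.mul' K P.QSym).rTensor _ ((TensorProduct.assoc K _ _ _).symm
        (TensorProduct.map s (d.rTensor _) (TensorProduct.assoc K _ _ _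
          ((Coalgebra.comul (R := K)).rTensor _ z)))) := by
    intro z
    induction z using TensorProduct.induction_on with
    | zero => simp
    | tmul x y =>
      rw [LinearMap.rTensor_tmul, LinearMap.rTensor_tmul]
      change LinearMap.mul' K P.QSym (TensorProduct.map s d (Coalgebra.comul (R := K) x)) ⊗ₜ y = _
      generalize Coalgebra.comul (R := K) x = w
      induction w using TensorProduct.induction_on with
      | zero => simp
      | tmul a b => simp
      | add a b ha hb => simp only [TensorProduct.add_tmul, map_add, ha, hb]
    | add x y hx hy => simp only [map_add, hx, hy]
  rw [k1, Coalgebra.coassoc_apply, ← LinearMap.comp_apply (TensorProduct.map _ _),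
    LinearMap.map_comp_lTensor]

theorem conv_locNil : LocNil (Coalgebra.comul (R := K))
    (-(WithConv.toConv P.qS0 * WithConv.toConv P.qDiff)).ofConv := by
  have key : ∀ (W : Submodule K (P.QSym ⊗[K] P.QSym)) (n : ℕ) (x : P.QSym), x ∈ P.qFil n →
      (∀ (a : P.QSym), ∀ y ∈ P.qFil n, (LinearMap.mul' K P.QSym).rTensor _
        ((TensorProduct.assoc K _ _ _).symm
          (a ⊗ₜ P.qDiff.rTensor _ (Coalgebra.comul (R := K) y))) ∈ W) →
      (-(WithConv.toConv P.qS0 * WithConv.toConv P.qDiff)).ofConv.rTensor P.QSym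
        (Coalgebra.comul (R := K) x) ∈ W := by
    intro W n x hx hW
    have e : (-(WithConv.toConv P.qS0 * WithConv.toConv P.qDiff)).ofConv =
      -(WithConv.toConv P.qS0 * WithConv.toConv P.qDiff).ofConv := rfl
    rw [e, LinearMap.rTensor_neg, LinearMap.neg_apply]
    apply neg_mem
    rw [conv_rTensor]
    obtain ⟨w, hw⟩ := P.qFst_comul_fil hx
    have k : TensorProduct.map P.qS0 (P.qDiff.rTensor _ ∘ₗ Coalgebra.comul)
        (Coalgebra.comul (R := K) x) =
        TensorProduct.map (P.qInclH.toLinearMap ∘ₗ HopfAlgebra.antipode K)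
          (P.qDiff.rTensor _ ∘ₗ Coalgebra.comul)
          (P.qFst.rTensor _ (Coalgebra.comul (R := K) x)) := by
      generalize Coalgebra.comul (R := K) x = z
      induction z using TensorProduct.induction_on with
      | zero => simp
      | tmul x y => simp [qS0]
      | add x y hx hy => simp only [map_add, hx, hy]
    rw [k, ← hw]
    clear hw k
    induction w using TensorProduct.induction_on with
    | zero => simp
    | tmul a b =>
      rw [LinearMap.lTensor_tmul, TensorProduct.map_tmul]
      exact hW _ _ b.2
    | add a b ha hb => simp only [map_add]; exact add_mem ha hb
  refine locNil_of_graded P.qFil ?_ ?_ ?_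
  · rw [eq_top_iff]
    intro x _
    obtain ⟨n, hn⟩ := tFil_exhaust (P.qVal x).2
    refine Submodule.mem_iSup_of_mem n (P.mem_qFil.2 ?_)
    exact Submodule.mem_prod.2 ⟨trivial, hn⟩
  · intro x hx
    have := key ⊥ 0 x hx (fun a y hy => by
      rw [P.qDiff_comul_fil_zero hy]; simp)
    simpa using this
  · intro n x hx
    refine key _ (n + 1) x hx (fun a y hy => ?_)
    obtain ⟨w, hw⟩ := P.qDiff_comul_fil hy
    rw [← hw]
    clear hw
    induction w using TensorProduct.induction_on with
    | zero => simp
    | tmul b c => exact ⟨(a * b) ⊗ₜ c, by simp⟩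
    | add b c hb hc => simp only [map_add, TensorProduct.tmul_add]; exact add_mem hb hc

theorem isUnit_conv_id :
    IsUnit (WithConv.toConv LinearMap.id : WithConv (P.QSym →ₗ[K] P.QSym)) := by
  have h1 := isUnit_one_sub _ P.conv_locNil
  have e : (1 : WithConv (P.QSym →ₗ[K] P.QSym)) -
      -(WithConv.toConv P.qS0 * WithConv.toConv P.qDiff) =
      WithConv.toConv P.qS0 * WithConv.toConv LinearMap.id := by
    have : (WithConv.toConv LinearMap.id : WithConv (P.QSym →ₗ[K] P.QSym)) =
        WithConv.toConv (P.qInclH.toLinearMap ∘ₗ P.qFst) + WithConv.toConv P.qDiff := by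
      apply WithConv.ext
      ext x
      change x = P.qInclH (P.qFst x) + (x - P.qInclH (P.qFst x))
      abel
    rw [this, mul_add, qS0_mul_qG, sub_neg_eq_add]
  rw [e] at h1
  have hs : IsUnit (WithConv.toConv P.qS0 : WithConv (P.QSym →ₗ[K] P.QSym)) :=
    ⟨⟨_, _, P.qS0_mul_qG, P.qG_mul_qS0⟩, rfl⟩
  exact (hs.mul_left_iff).1 h1

/-- The quantum symmetric algebra is a Hopf algebra; its antipode is the convolution inverse of
the identity. -/
instance : HopfAlgebra K P.QSym where
  antipode := (P.isUnit_conv_id.unit⁻¹ : (WithConv (P.QSym →ₗ[K] P.QSym))ˣ).val.ofConv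
  mul_antipode_rTensor_comul := by
    have := congrArg WithConv.ofConv P.isUnit_conv_id.val_inv_mul
    exact this
  mul_antipode_lTensor_comul := by
    have := congrArg WithConv.ofConv P.isUnit_conv_id.mul_val_inv
    exact this

end HopfBimodule

/-- A Hopf pairing `ψ : H × B → K`: a bilinear map with
`ψ(1, b) = ε(b)`, `ψ(h, 1) = ε(h)`, `ψ(h, b c) = ∑ ψ(h₁, b) ψ(h₂, c)`,
`ψ(h g, b) = ∑ ψ(h, b₁) ψ(g, b₂)` and `ψ(S(h), b) = ψ(h, S(b))`. -/
structure IsHopfPairing {K H B : Type*} [Field K] [Ring H] [HopfAlgebra K H] [Ring B]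
    [HopfAlgebra K B] (ψ : H →ₗ[K] B →ₗ[K] K) : Prop where
  one_left : ∀ b, ψ 1 b = Coalgebra.counit (R := K) b
  one_right : ∀ h, ψ h 1 = Coalgebra.counit (R := K) h
  mul_right : ∀ h b c, ψ h (b * c) =
    LinearMap.mul' K K (TensorProduct.map (ψ.flip b) (ψ.flip c) (Coalgebra.comul (R := K) h))
  mul_left : ∀ h g b, ψ (h * g) b =
    LinearMap.mul' K K (TensorProduct.map (ψ h) (ψ g) (Coalgebra.comul (R := K) b))
  antipode : ∀ h b, ψ (HopfAlgebra.antipode K h) b = ψ h (HopfAlgebra.antipode K b)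

/-- A pairing of graded spaces is graded if `ψ(Hᵢ, Bⱼ) = 0` for `i ≠ j`. -/
def IsGradedPairing {K H B : Type*} [Field K] [Ring H] [HopfAlgebra K H] [Ring B]
    [HopfAlgebra K B] (𝒜 : ℕ → Submodule K H) (ℬ : ℕ → Submodule K B)
    (ψ : H →ₗ[K] B →ₗ[K] K) : Prop :=
  ∀ i j, i ≠ j → ∀ h ∈ 𝒜 i, ∀ b ∈ ℬ j, ψ h b = 0

namespace HopfBimodule

/-- The inclusion `M → S_H(M)`. -/
def qInclM {K H M : Type*} [Field K] [Ring H] [HopfAlgebra K H] [AddCommGroup M] [Module K M]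
    (P : HopfBimodule K H M) : M →ₗ[K] P.QSym :=
  LinearMap.codRestrict (Subalgebra.toSubmodule P.qsymSubalgebra) P.cotInclM P.cotInclM_mem

end HopfBimodule

section Canonical

variable {K H : Type*} [Field K] [Ring H] [HopfAlgebra K H] (𝒜 : ℕ → Submodule K H)
  [GradedAlgebra 𝒜] [GradedHopf 𝒜]

/-- `H` is generated as an algebra by `H₀` and `H₁`. -/
def GeneratedInDegreesZeroOne : Prop :=
  Algebra.adjoin K ((𝒜 0 : Set H) ∪ (𝒜 1 : Set H)) = ⊤

/-- The quantum symmetric algebra `S_{H₀}(H₁)` of the couple associated to `H`. -/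
abbrev AssocQSym : Type _ := (couple 𝒜).QSym

/-- `j` is the canonical map `j_H : H → S_{H₀}(H₁)`: a morphism of graded Hopf algebras whose
restriction to `H₀ ⊕ H₁` is the identity. -/
structure IsCanonicalMap (j : H →ₐc[K] AssocQSym 𝒜) : Prop where
  map_antipode : ∀ x, j (HopfAlgebra.antipode K x) = HopfAlgebra.antipode K (j x)
  map_degree : ∀ n, ∀ x ∈ 𝒜 n, j x ∈ (couple 𝒜).qsymGr n
  map_zero_part : ∀ x : Deg0 𝒜, j (in0 𝒜 x) = (couple 𝒜).qInclH x
  map_one_part : ∀ x : 𝒜 1, j (x : H) = (couple 𝒜).qInclM x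

end Canonical

end QuantumSymm

end

/-!
The coalgebra map `x ↦ x₀ + ∑_{n ≥ 1} ∑ (x₍₁₎)₁ ⊗ ⋯ ⊗ (x₍ₙ₎)₁` into the cotensor coalgebra
`Cot_{H₀}(H₁)`, given by the universal property from the projections `H → H₀` and `H → H₁`, exists
for every graded Hopf algebra `H` (`couple_lcoact_grProj`, `couple_rcoact_grProj`,
`locNil_grProj`). It preserves degrees (`expF_mem_range_pow`), hence restricts to the identity on
`H₀` and `H₁`, and it is multiplicative, since two coalgebra maps `H ⊗ H → Cot_{H₀}(H₁)` with the
same components in `H₀` and `H₁` are equal (`toCot_mul`). If `H` is generated by `H₀` and `H₁`, its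
image is therefore the subalgebra generated by `H₀` and `H₁`, which is the quantum symmetric
algebra, and it is the only canonical map.

Injectivity is where the pairing `ψ : H × B → K` enters (`injective_of_pairing`). For a coalgebra
map `j` on `H`, the kernel `J` is a coideal, `Δ(J) ⊆ J ⊗ H + H ⊗ J`; so the rule
`ψ(h, b c) = ∑ ψ(h₁, b) ψ(h₂, c)` shows that the elements `b` with `ψ(J, b) = 0` form a subalgebra
of `B`. If `j` is injective on `H₀` and on `H₁` and preserves degrees, then `J` consists of
elements without components in degrees `0` and `1`, so this subalgebra contains `B₀` and `B₁`, and
it is all of `B`. By non-degeneracy `J = 0`. The statement for `B` follows by exchanging the two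
arguments of `ψ`.
-/

open scoped TensorProduct

noncomputable section

namespace QuantumSymm

/-! ### Graded components of the structure maps -/

section Components

variable {K H : Type*} [Field K] [Ring H] [HopfAlgebra K H] (𝒜 : ℕ → Submodule K H)
  [GradedAlgebra 𝒜]

theorem in0_pr0_eq (x : H) : in0 𝒜 (pr0 𝒜 x) = grProj 𝒜 0 x := rfl

theorem grProj_coe_same {n : ℕ} (x : 𝒜 n) : grProj 𝒜 n (x : H) = x :=
  LinearMap.congr_fun (grProj_same 𝒜 n) x

theorem grProj_of_mem_ne {m n : ℕ} {x : H} (hx : x ∈ 𝒜 m) (h : m ≠ n) : grProj 𝒜 n x = 0 :=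
  LinearMap.congr_fun (grProj_ne 𝒜 h) ⟨x, hx⟩

theorem pr0_of_mem_ne {m : ℕ} {x : H} (hx : x ∈ 𝒜 m) (h : m ≠ 0) : pr0 𝒜 x = 0 := by
  apply in0_injective
  rw [in0_pr0_eq, grProj_of_mem_ne 𝒜 hx h, map_zero, Submodule.coe_zero]

theorem pr0_in0 (x : Deg0 𝒜) : pr0 𝒜 (in0 𝒜 x) = x := LinearMap.congr_fun (pr0_same 𝒜) x

theorem pr0_mul (x y : H) : pr0 𝒜 (x * y) = pr0 𝒜 x * pr0 𝒜 y := by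
  apply in0_injective
  rw [in0_mul]
  exact map_mul (GradedRing.projZeroRingHom 𝒜) x y

/-- Two linear maps agree if they agree on homogeneous elements. -/
theorem linearMap_ext_of_graded {X : Type*} [AddCommGroup X] [Module K X] {f g : H →ₗ[K] X}
    (h : ∀ n, ∀ x ∈ 𝒜 n, f x = g x) (x : H) : f x = g x := by
  induction x using DirectSum.Decomposition.inductionOn 𝒜 with
  | zero => rw [map_zero, map_zero]
  | homogeneous m => exact h _ _ m.2
  | add x y hx hy => rw [map_add, map_add, hx, hy]

/-- The degree one component of a product: `(x y)₁ = x₀ y₁ + x₁ y₀`. -/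
theorem grProj_one_mul (x y : H) : grProj 𝒜 1 (x * y) =
    actL 𝒜 (pr0 𝒜 x) (grProj 𝒜 1 y) + actR 𝒜 (grProj 𝒜 1 x) (pr0 𝒜 y) := by
  refine linearMap_ext_of_graded 𝒜 (f := grProj 𝒜 1 ∘ₗ LinearMap.mulRight K y)
    (g := (actL 𝒜).flip (grProj 𝒜 1 y) ∘ₗ pr0 𝒜 + (actR 𝒜).flip (pr0 𝒜 y) ∘ₗ grProj 𝒜 1)
    (fun m x hx => ?_) x
  refine linearMap_ext_of_graded 𝒜 (f := grProj 𝒜 1 ∘ₗ LinearMap.mulLeft K x)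
    (g := actL 𝒜 (pr0 𝒜 x) ∘ₗ grProj 𝒜 1 + actR 𝒜 (grProj 𝒜 1 x) ∘ₗ pr0 𝒜)
    (fun n y hy => ?_) y
  change grProj 𝒜 1 (x * y) =
    actL 𝒜 (pr0 𝒜 x) (grProj 𝒜 1 y) + actR 𝒜 (grProj 𝒜 1 x) (pr0 𝒜 y)
  have hxy : x * y ∈ 𝒜 (m + n) := SetLike.mul_mem_graded hx hy
  by_cases h01 : m = 0 ∧ n = 1
  · obtain ⟨rfl, rfl⟩ := h01
    rw [grProj_of_mem_ne 𝒜 hx zero_ne_one, map_zero, LinearMap.zero_apply, add_zero]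
    rw [zero_add] at hxy
    rw [grProj_coe_same 𝒜 ⟨x * y, hxy⟩, grProj_coe_same 𝒜 ⟨y, hy⟩]
    apply Subtype.ext
    change x * y = in0 𝒜 (pr0 𝒜 x) * y
    rw [show in0 𝒜 (pr0 𝒜 x) = x from DirectSum.decompose_of_mem_same 𝒜 hx]
  by_cases h10 : m = 1 ∧ n = 0
  · obtain ⟨rfl, rfl⟩ := h10
    rw [grProj_of_mem_ne 𝒜 hy zero_ne_one, map_zero, zero_add]
    rw [add_zero] at hxy
    rw [grProj_coe_same 𝒜 ⟨x * y, hxy⟩, grProj_coe_same 𝒜 ⟨x, hx⟩]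
    apply Subtype.ext
    change x * y = x * in0 𝒜 (pr0 𝒜 y)
    rw [show in0 𝒜 (pr0 𝒜 y) = y from DirectSum.decompose_of_mem_same 𝒜 hy]
  rw [grProj_of_mem_ne 𝒜 hxy (by omega)]
  have h1 : actL 𝒜 (pr0 𝒜 x) (grProj 𝒜 1 y) = 0 := by
    by_cases hm : m = 0
    · rw [grProj_of_mem_ne 𝒜 hy (by omega), map_zero]
    · rw [pr0_of_mem_ne 𝒜 hx hm, map_zero, LinearMap.zero_apply]
  have h2 : actR 𝒜 (grProj 𝒜 1 x) (pr0 𝒜 y) = 0 := by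
    by_cases hn : n = 0
    · rw [grProj_of_mem_ne 𝒜 hx (by omega), map_zero, LinearMap.zero_apply]
    · rw [pr0_of_mem_ne 𝒜 hy hn, map_zero]
  rw [h1, h2, add_zero]

variable [GradedHopf 𝒜]

/-- If `f` only sees degree `i` and `g` only sees degree `j`, then `(f ⊗ g) ∘ Δ` only sees degree
`i + j`. -/
theorem map_comul_eq_grProj {X Y : Type*} [AddCommGroup X] [Module K X] [AddCommGroup Y]
    [Module K Y] {i j : ℕ} {f : H →ₗ[K] X} {g : H →ₗ[K] Y}
    (hf : ∀ n, n ≠ i → ∀ x ∈ 𝒜 n, f x = 0) (hg : ∀ n, n ≠ j → ∀ x ∈ 𝒜 n, g x = 0) (x : H) :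
    TensorProduct.map f g (Coalgebra.comul (R := K) x) =
      TensorProduct.map f g (Coalgebra.comul (R := K) (grProj 𝒜 (i + j) x : H)) := by
  refine linearMap_ext_of_graded 𝒜 (f := TensorProduct.map f g ∘ₗ Coalgebra.comul)
    (g := TensorProduct.map f g ∘ₗ Coalgebra.comul ∘ₗ (𝒜 (i + j)).subtype ∘ₗ grProj 𝒜 (i + j))
    (fun n x hx => ?_) x
  change TensorProduct.map f g (Coalgebra.comul (R := K) x) =
    TensorProduct.map f g (Coalgebra.comul (R := K) (grProj 𝒜 (i + j) x : H))
  by_cases hn : n = i + j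
  · subst hn
    rw [grProj_coe_same 𝒜 ⟨x, hx⟩]
  · rw [grProj_of_mem_ne 𝒜 hx hn, Submodule.coe_zero, map_zero, map_zero]
    have hle : (⨆ (k : ℕ) (l : ℕ) (_ : k + l = n),
        LinearMap.range (TensorProduct.map (𝒜 k).subtype (𝒜 l).subtype)) ≤
        LinearMap.ker (TensorProduct.map f g) := by
      refine iSup_le fun k => iSup_le fun l => iSup_le fun hkl => ?_
      rw [LinearMap.range_le_ker_iff, ← TensorProduct.map_comp]
      by_cases hk : k = i
      · rw [show g ∘ₗ (𝒜 l).subtype = 0 from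
          LinearMap.ext fun y => hg l (by omega) y y.2, TensorProduct.map_zero_right]
      · rw [show f ∘ₗ (𝒜 k).subtype = 0 from
          LinearMap.ext fun y => hf k hk y y.2, TensorProduct.map_zero_left]
    exact hle (GradedHopf.comul_mem n x hx)

theorem comul_pr0 (x : H) : TensorProduct.map (pr0 𝒜) (pr0 𝒜) (Coalgebra.comul (R := K) x) =
    Coalgebra.comul (R := K) (pr0 𝒜 x) := by
  rw [map_comul_eq_grProj 𝒜 (i := 0) (j := 0) (fun n hn x hx => pr0_of_mem_ne 𝒜 hx hn)
    (fun n hn x hx => pr0_of_mem_ne 𝒜 hx hn), zero_add, ← in0_pr0_eq, ← map_comul_zero,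
    ← LinearMap.comp_apply, ← TensorProduct.map_comp, pr0_same, TensorProduct.map_id,
    LinearMap.id_apply]

theorem counit_pr0 (x : H) : Coalgebra.counit (R := K) (pr0 𝒜 x) = Coalgebra.counit (R := K) x := by
  refine linearMap_ext_of_graded 𝒜 (f := Coalgebra.counit ∘ₗ pr0 𝒜) (g := Coalgebra.counit)
    (fun n x hx => ?_) x
  change Coalgebra.counit (R := K) (pr0 𝒜 x) = Coalgebra.counit (R := K) x
  obtain rfl | hn := Nat.eq_zero_or_pos n
  · rw [counit_zero, in0_pr0 𝒜 x hx]
  · rw [pr0_of_mem_ne 𝒜 hx hn.ne', map_zero, GradedHopf.counit_eq_zero n hn x hx]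

/-- The projection `H → H₀` as a coalgebra map. -/
def pr0Hom : H →ₗc[K] Deg0 𝒜 where
  toLinearMap := pr0 𝒜
  counit_comp := LinearMap.ext (counit_pr0 𝒜)
  map_comp_comul := LinearMap.ext (comul_pr0 𝒜)

theorem couple_lcoact_grProj (x : H) : (couple 𝒜).lcoact (grProj 𝒜 1 x) =
    TensorProduct.map (pr0Hom 𝒜).toLinearMap (grProj 𝒜 1) (Coalgebra.comul (R := K) x) := by
  refine Eq.trans ?_ (map_comul_eq_grProj 𝒜 (i := 0) (j := 1)
    (fun n hn x hx => pr0_of_mem_ne 𝒜 hx hn) (fun n hn x hx => grProj_of_mem_ne 𝒜 hx hn) x).symm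
  rw [zero_add]
  rfl

theorem couple_rcoact_grProj (x : H) : (couple 𝒜).rcoact (grProj 𝒜 1 x) =
    TensorProduct.map (grProj 𝒜 1) (pr0Hom 𝒜).toLinearMap (Coalgebra.comul (R := K) x) := by
  refine Eq.trans ?_ (map_comul_eq_grProj 𝒜 (i := 1) (j := 0)
    (fun n hn x hx => grProj_of_mem_ne 𝒜 hx hn) (fun n hn x hx => pr0_of_mem_ne 𝒜 hx hn) x).symm
  rw [add_zero]
  rfl

theorem grProj_rTensor_comul_zero {x : H} (hx : x ∈ 𝒜 0) :
    (grProj 𝒜 1).rTensor H (Coalgebra.comul (R := K) x) = 0 := by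
  have hle : (⨆ (k : ℕ) (l : ℕ) (_ : k + l = 0),
      LinearMap.range (TensorProduct.map (𝒜 k).subtype (𝒜 l).subtype)) ≤
      LinearMap.ker ((grProj 𝒜 1).rTensor H) := by
    refine iSup_le fun k => iSup_le fun l => iSup_le fun hkl => ?_
    rw [LinearMap.range_le_ker_iff, LinearMap.rTensor_comp_map, grProj_ne 𝒜 (by omega),
      TensorProduct.map_zero_left]
  exact hle (GradedHopf.comul_mem 0 x hx)

theorem grProj_rTensor_comul_succ {n : ℕ} {x : H} (hx : x ∈ 𝒜 (n + 1)) :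
    (grProj 𝒜 1).rTensor H (Coalgebra.comul (R := K) x) ∈
      LinearMap.range ((𝒜 n).subtype.lTensor (𝒜 1)) := by
  have hle : (⨆ (k : ℕ) (l : ℕ) (_ : k + l = n + 1),
      LinearMap.range (TensorProduct.map (𝒜 k).subtype (𝒜 l).subtype)) ≤
      (LinearMap.range ((𝒜 n).subtype.lTensor (𝒜 1))).comap ((grProj 𝒜 1).rTensor H) := by
    refine iSup_le fun k => iSup_le fun l => iSup_le fun hkl => ?_
    rintro _ ⟨z, rfl⟩
    rw [Submodule.mem_comap, ← LinearMap.comp_apply, LinearMap.rTensor_comp_map]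
    by_cases hk : k = 1
    · subst hk
      obtain rfl : l = n := by omega
      rw [grProj_same]
      exact ⟨z, rfl⟩
    · rw [grProj_ne 𝒜 hk, TensorProduct.map_zero_left, LinearMap.zero_apply]
      exact zero_mem _
  exact hle (GradedHopf.comul_mem (n + 1) x hx)

theorem locNil_grProj : LocNil (Coalgebra.comul (R := K)) (grProj 𝒜 1) :=
  locNil_of_graded 𝒜 (DirectSum.Decomposition.isInternal 𝒜).submodule_iSup_eq_top
    (fun _ hx => grProj_rTensor_comul_zero 𝒜 hx) (fun _ _ hx => grProj_rTensor_comul_succ 𝒜 hx)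

end Components

/-! ### The map to the cotensor Hopf algebra -/

section ToCot

variable {K H : Type*} [Field K] [Ring H] [HopfAlgebra K H] (𝒜 : ℕ → Submodule K H)
  [GradedAlgebra 𝒜] [GradedHopf 𝒜]

theorem expF_of_mem_zero {x : H} (hx : x ∈ 𝒜 0) :
    HopfBimodule.expF (locNil_grProj 𝒜) x = 0 := by
  rw [HopfBimodule.expF_eq]
  have e : TensorProduct.map (TensorAlgebra.ι K ∘ₗ grProj 𝒜 1)
      (HopfBimodule.expG (locNil_grProj 𝒜)) = TensorProduct.map (TensorAlgebra.ι K)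
      (HopfBimodule.expG (locNil_grProj 𝒜)) ∘ₗ (grProj 𝒜 1).rTensor H := by
    rw [LinearMap.map_comp_rTensor]
  rw [e, LinearMap.comp_apply, grProj_rTensor_comul_zero 𝒜 hx, map_zero, map_zero]

/-- The map `x ↦ ∑_{n ≥ 1} ∑ (x₍₁₎)₁ ⊗ ⋯ ⊗ (x₍ₙ₎)₁` preserves degrees. -/
theorem expF_mem_range_pow (n : ℕ) {x : H} (hx : x ∈ 𝒜 n) :
    HopfBimodule.expF (locNil_grProj 𝒜) x ∈
      LinearMap.range (TensorAlgebra.ι K : 𝒜 1 →ₗ[K] TensorAlgebra K (𝒜 1)) ^ n := by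
  -- The recursion involves the map with the scalar term `ε(x) 1`, which lies in degree `0` too.
  have key : ∀ n, ∀ x ∈ 𝒜 n, HopfBimodule.expG (locNil_grProj 𝒜) x ∈
      LinearMap.range (TensorAlgebra.ι K : 𝒜 1 →ₗ[K] TensorAlgebra K (𝒜 1)) ^ n ∧
      HopfBimodule.expF (locNil_grProj 𝒜) x ∈
      LinearMap.range (TensorAlgebra.ι K : 𝒜 1 →ₗ[K] TensorAlgebra K (𝒜 1)) ^ n := by
    intro n
    induction n with
    | zero =>
      intro x hx
      rw [HopfBimodule.expG_eq_add, expF_of_mem_zero 𝒜 hx, add_zero, pow_zero]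
      exact ⟨Submodule.mem_one.2 ⟨_, rfl⟩, zero_mem _⟩
    | succ n ih =>
      intro x hx
      rw [HopfBimodule.expG_eq_add, GradedHopf.counit_eq_zero (n + 1) n.succ_pos x hx, map_zero,
        zero_add, and_self, HopfBimodule.expF_eq]
      have e : TensorProduct.map (TensorAlgebra.ι K ∘ₗ grProj 𝒜 1)
          (HopfBimodule.expG (locNil_grProj 𝒜)) = TensorProduct.map (TensorAlgebra.ι K)
          (HopfBimodule.expG (locNil_grProj 𝒜)) ∘ₗ (grProj 𝒜 1).rTensor H := by
        rw [LinearMap.map_comp_rTensor]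
      obtain ⟨w, hw⟩ := grProj_rTensor_comul_succ 𝒜 hx
      rw [e, LinearMap.comp_apply, ← hw]
      clear hw
      induction w using TensorProduct.induction_on with
      | zero => simp
      | tmul m y =>
        rw [LinearMap.lTensor_tmul, TensorProduct.map_tmul, smulMap_tmul, smul_eq_mul, pow_succ']
        exact Submodule.mul_mem_mul ⟨m, rfl⟩ (ih y y.2).1
      | add u v hu hv => simp only [map_add]; exact add_mem hu hv
  exact (key n x hx).2

/-- The coalgebra map `H → Cot_{H₀}(H₁)` with components the projections to `H₀` and `H₁`. -/
def toCot : H →ₗc[K] (couple 𝒜).Cot :=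
  (couple 𝒜).cotLift (pr0Hom 𝒜) (grProj 𝒜 1) (couple_lcoact_grProj 𝒜) (couple_rcoact_grProj 𝒜)
    (locNil_grProj 𝒜)

theorem cotVal_toCot (x : H) : (couple 𝒜).cotVal (toCot 𝒜 x) =
    (pr0 𝒜 x, HopfBimodule.expF (locNil_grProj 𝒜) x) := rfl

theorem cotFst_toCot (x : H) : (couple 𝒜).cotFst (toCot 𝒜 x) = pr0 𝒜 x := rfl

theorem cotProj_toCot (x : H) : (couple 𝒜).cotProj (toCot 𝒜 x) = grProj 𝒜 1 x :=
  HopfBimodule.tProj_expF (locNil_grProj 𝒜) x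

theorem toCot_mem_ambGr {n : ℕ} {x : H} (hx : x ∈ 𝒜 n) :
    (couple 𝒜).cotVal (toCot 𝒜 x) ∈ HopfBimodule.ambGr K (Deg0 𝒜) (𝒜 1) n := by
  rw [cotVal_toCot]
  refine Submodule.mem_prod.2 ⟨?_, expF_mem_range_pow 𝒜 n hx⟩
  split_ifs with hn
  · trivial
  · exact (Submodule.mem_bot K).2 (pr0_of_mem_ne 𝒜 hx hn)

theorem toCot_in0 (x : Deg0 𝒜) : toCot 𝒜 (in0 𝒜 x) = (couple 𝒜).cotInclH x := by
  apply (couple 𝒜).cotVal_injective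
  rw [cotVal_toCot, HopfBimodule.cotVal_cotInclH, pr0_in0, expF_of_mem_zero 𝒜 (in0_mem 𝒜 x)]

theorem toCot_coe_one (x : 𝒜 1) : toCot 𝒜 (x : H) = (couple 𝒜).cotInclM x := by
  apply (couple 𝒜).cotVal_injective
  rw [cotVal_toCot, HopfBimodule.cotVal_cotInclM, pr0_of_mem_ne 𝒜 x.2 one_ne_zero]
  -- In degree one the tensor component is determined by its image in `H₁`.
  have h := expF_mem_range_pow 𝒜 1 x.2
  rw [pow_one] at h
  obtain ⟨m, hm⟩ := h
  have h1 := HopfBimodule.tProj_expF (locNil_grProj 𝒜) (x : H)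
  rw [← hm, HopfBimodule.tProj_ι, grProj_coe_same] at h1
  rw [← hm, h1]

theorem toCot_mul (x y : H) : toCot 𝒜 (x * y) = toCot 𝒜 x * toCot 𝒜 y := by
  have e : (toCot 𝒜).comp (Bialgebra.mulCoalgHom K H) =
      (couple 𝒜).cotMul.comp (Coalgebra.TensorProduct.map (toCot 𝒜) (toCot 𝒜)) := by
    have t : ∀ x y, (couple 𝒜).cotMul.comp (Coalgebra.TensorProduct.map (toCot 𝒜) (toCot 𝒜))
      (x ⊗ₜ y) = toCot 𝒜 x * toCot 𝒜 y := fun _ _ => rfl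
    have t' : ∀ x y, (toCot 𝒜).comp (Bialgebra.mulCoalgHom K H) (x ⊗ₜ y) =
      toCot 𝒜 (x * y) := fun _ _ => rfl
    apply (couple 𝒜).cot_hom_ext
    · intro c
      induction c using TensorProduct.induction_on with
      | zero => simp only [map_zero]
      | tmul x y =>
        rw [t, t', HopfBimodule.cotFst_mul, cotFst_toCot, cotFst_toCot, cotFst_toCot, pr0_mul]
      | add x y hx hy => simp only [map_add, hx, hy]
    · intro c
      induction c using TensorProduct.induction_on with
      | zero => simp only [map_zero]
      | tmul x y =>
        rw [t, t', HopfBimodule.cotProj_mul, cotFst_toCot, cotFst_toCot, cotProj_toCot,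
          cotProj_toCot, cotProj_toCot, grProj_one_mul]
        rfl
      | add x y hx hy => simp only [map_add, hx, hy]
  exact DFunLike.congr_fun e (x ⊗ₜ y)

theorem toCot_one : toCot 𝒜 1 = 1 := by
  rw [← in0_one 𝒜, toCot_in0, HopfBimodule.cot_one_def]

/-- The coalgebra map `H → Cot_{H₀}(H₁)` as an algebra map. -/
def toCotAlg : H →ₐ[K] (couple 𝒜).Cot :=
  AlgHom.ofLinearMap (toCot 𝒜).toLinearMap (toCot_one 𝒜) (toCot_mul 𝒜)

end ToCot

/-! ### The canonical map to the quantum symmetric algebra -/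

/-- A morphism of bialgebras between Hopf algebras commutes with the antipodes: `f ∘ S` and `S ∘ f`
are both convolution inverse to `f`. -/
theorem bialgHom_map_antipode {K A B : Type*} [Field K] [Ring A] [HopfAlgebra K A] [Ring B]
    [HopfAlgebra K B] (f : A →ₐc[K] B) (x : A) :
    f (HopfAlgebra.antipode K x) = HopfAlgebra.antipode K (f x) := by
  let F : A →ₗ[K] B := (f : A →ₐ[K] B).toLinearMap
  have h1 : WithConv.toConv (F ∘ₗ HopfAlgebra.antipode K) * WithConv.toConv F = 1 := by
    apply WithConv.ext
    ext x
    change LinearMap.mul' K B (TensorProduct.map (F ∘ₗ HopfAlgebra.antipode K) F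
      (Coalgebra.comul (R := K) x)) = algebraMap K B (Coalgebra.counit (R := K) x)
    have k : ∀ z : A ⊗[K] A, LinearMap.mul' K B
        (TensorProduct.map (F ∘ₗ HopfAlgebra.antipode K) F z) =
        F (LinearMap.mul' K A ((HopfAlgebra.antipode K).rTensor A z)) := by
      intro z
      induction z using TensorProduct.induction_on with
      | zero => simp
      | tmul a b => simp [F]
      | add a b ha hb => simp only [map_add, ha, hb]
    rw [k, HopfAlgebra.mul_antipode_rTensor_comul_apply]
    exact (f : A →ₐ[K] B).commutes _
  have h2 : WithConv.toConv F * WithConv.toConv (HopfAlgebra.antipode K ∘ₗ F) = 1 := by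
    apply WithConv.ext
    ext x
    change LinearMap.mul' K B (TensorProduct.map F (HopfAlgebra.antipode K ∘ₗ F)
      (Coalgebra.comul (R := K) x)) = algebraMap K B (Coalgebra.counit (R := K) x)
    have e : TensorProduct.map F F (Coalgebra.comul (R := K) x) = Coalgebra.comul (R := K) (F x) :=
      CoalgHomClass.map_comp_comul_apply f x
    have e' : Coalgebra.counit (R := K) (F x) = Coalgebra.counit (R := K) x :=
      CoalgHomClass.counit_comp_apply f x
    rw [← LinearMap.lTensor_comp_map, LinearMap.comp_apply, e,
      HopfAlgebra.mul_antipode_lTensor_comul_apply, e']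
  exact LinearMap.congr_fun (congrArg WithConv.ofConv (left_inv_eq_right_inv h1 h2)) x

section CanonicalMap

variable {K H : Type*} [Field K] [Ring H] [HopfAlgebra K H] {𝒜 : ℕ → Submodule K H}
  [GradedAlgebra 𝒜] [GradedHopf 𝒜]

theorem toCotAlg_mem (h𝒜 : GeneratedInDegreesZeroOne 𝒜) (x : H) :
    toCotAlg 𝒜 x ∈ (couple 𝒜).qsymSubalgebra := by
  have hle : Algebra.adjoin K ((𝒜 0 : Set H) ∪ (𝒜 1 : Set H)) ≤
      (couple 𝒜).qsymSubalgebra.comap (toCotAlg 𝒜) := by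
    refine Algebra.adjoin_le (Set.union_subset (fun x hx => ?_) (fun x hx => ?_))
    · change toCot 𝒜 (in0 𝒜 (mk0 𝒜 x hx)) ∈ (couple 𝒜).qsymSubalgebra
      rw [toCot_in0]
      exact (couple 𝒜).cotInclH_mem _
    · change toCot 𝒜 ((⟨x, hx⟩ : 𝒜 1) : H) ∈ (couple 𝒜).qsymSubalgebra
      rw [toCot_coe_one]
      exact (couple 𝒜).cotInclM_mem _
  exact hle (h𝒜 ▸ Algebra.mem_top)

/-- The canonical map as an algebra map. -/
def toQSymAlg (h𝒜 : GeneratedInDegreesZeroOne 𝒜) : H →ₐ[K] AssocQSym 𝒜 :=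
  (toCotAlg 𝒜).codRestrict (couple 𝒜).qsymSubalgebra (toCotAlg_mem h𝒜)

theorem qsymVal_toQSymAlg (h𝒜 : GeneratedInDegreesZeroOne 𝒜) (x : H) :
    (couple 𝒜).qsymVal (toQSymAlg h𝒜 x) = toCot 𝒜 x := rfl

/-- The canonical map `j_H : H → S_{H₀}(H₁)`. -/
def toQSym (h𝒜 : GeneratedInDegreesZeroOne 𝒜) : H →ₐc[K] AssocQSym 𝒜 :=
  BialgHom.ofAlgHom (toQSymAlg h𝒜)
    (by
      apply AlgHom.ext
      intro x
      exact CoalgHomClass.counit_comp_apply (toCot 𝒜) x)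
    (by
      apply AlgHom.ext
      intro x
      apply (couple 𝒜).map_qsymVal_injective
      change _ = Algebra.TensorProduct.map (couple 𝒜).qsymVal (couple 𝒜).qsymVal
        (Coalgebra.comul (R := K) (toQSymAlg h𝒜 x))
      rw [HopfBimodule.map_comul_qsym, qsymVal_toQSymAlg,
        ← CoalgHomClass.map_comp_comul_apply (toCot 𝒜) x]
      change Algebra.TensorProduct.map (couple 𝒜).qsymVal (couple 𝒜).qsymVal
        (Algebra.TensorProduct.map (toQSymAlg h𝒜) (toQSymAlg h𝒜)
          (Coalgebra.comul (R := K) x)) = _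
      generalize Coalgebra.comul (R := K) x = z
      induction z using TensorProduct.induction_on with
      | zero => simp only [map_zero]
      | tmul a b => rfl
      | add a b ha hb => simp only [map_add, ha, hb])

theorem qsymVal_toQSym (h𝒜 : GeneratedInDegreesZeroOne 𝒜) (x : H) :
    (couple 𝒜).qsymVal (toQSym h𝒜 x) = toCot 𝒜 x := rfl

theorem isCanonicalMap_toQSym (h𝒜 : GeneratedInDegreesZeroOne 𝒜) :
    IsCanonicalMap 𝒜 (toQSym h𝒜) where
  map_antipode := bialgHom_map_antipode (toQSym h𝒜)
  map_degree _ _ hx := toCot_mem_ambGr 𝒜 hx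
  map_zero_part x := (couple 𝒜).qsymVal_injective (toCot_in0 𝒜 x)
  map_one_part x := (couple 𝒜).qsymVal_injective (toCot_coe_one 𝒜 x)

theorem IsCanonicalMap.eq (h𝒜 : GeneratedInDegreesZeroOne 𝒜) {j j' : H →ₐc[K] AssocQSym 𝒜}
    (hj : IsCanonicalMap 𝒜 j) (hj' : IsCanonicalMap 𝒜 j') : j = j' := by
  have e : (j : H →ₐ[K] AssocQSym 𝒜) = (j' : H →ₐ[K] AssocQSym 𝒜) := by
    refine AlgHom.ext_of_adjoin_eq_top h𝒜 ?_
    rintro x (hx | hx)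
    · exact (hj.map_zero_part (mk0 𝒜 x hx)).trans (hj'.map_zero_part (mk0 𝒜 x hx)).symm
    · exact (hj.map_one_part ⟨x, hx⟩).trans (hj'.map_one_part ⟨x, hx⟩).symm
  ext x
  exact DFunLike.congr_fun e x

theorem toQSym_surjective (h𝒜 : GeneratedInDegreesZeroOne 𝒜) :
    Function.Surjective (toQSym h𝒜) := by
  have hle : (couple 𝒜).qsymSubalgebra ≤ (toCotAlg 𝒜).range := by
    refine Algebra.adjoin_le (Set.union_subset ?_ ?_)
    · rintro _ ⟨x, rfl⟩
      exact ⟨in0 𝒜 x, toCot_in0 𝒜 x⟩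
    · rintro _ ⟨x, rfl⟩
      exact ⟨(x : H), toCot_coe_one 𝒜 x⟩
  intro y
  obtain ⟨x, hx⟩ := hle y.2
  exact ⟨x, (couple 𝒜).qsymVal_injective hx⟩

end CanonicalMap

/-! ### Injectivity from a Hopf pairing -/

section Pairing

variable {K H B : Type*} [Field K] [Ring H] [HopfAlgebra K H] [Ring B] [HopfAlgebra K B]

theorem IsHopfPairing.flip {ψ : H →ₗ[K] B →ₗ[K] K} (hψ : IsHopfPairing ψ) :
    IsHopfPairing ψ.flip where
  one_left := hψ.one_right
  one_right := hψ.one_left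
  mul_right b h g := hψ.mul_left h g b
  mul_left b c h := hψ.mul_right h b c
  antipode b h := (hψ.antipode h b).symm

theorem IsGradedPairing.flip {𝒜 : ℕ → Submodule K H} {ℬ : ℕ → Submodule K B}
    {ψ : H →ₗ[K] B →ₗ[K] K} (hψ : IsGradedPairing 𝒜 ℬ ψ) : IsGradedPairing ℬ 𝒜 ψ.flip :=
  fun i j hij b hb h hh => hψ j i hij.symm h hh b hb

/-- For a graded pairing, `ψ(h, b)` with `b` of degree `n` depends only on the degree `n` component
of `h`. -/
theorem IsGradedPairing.apply_eq_grProj {𝒜 : ℕ → Submodule K H} [GradedAlgebra 𝒜]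
    {ℬ : ℕ → Submodule K B} {ψ : H →ₗ[K] B →ₗ[K] K} (hψ : IsGradedPairing 𝒜 ℬ ψ) {n : ℕ} {b : B}
    (hb : b ∈ ℬ n) (h : H) : ψ h b = ψ (grProj 𝒜 n h : H) b := by
  refine linearMap_ext_of_graded 𝒜 (f := ψ.flip b)
    (g := ψ.flip b ∘ₗ (𝒜 n).subtype ∘ₗ grProj 𝒜 n) (fun m x hx => ?_) h
  change ψ x b = ψ (grProj 𝒜 n x : H) b
  obtain rfl | hmn := eq_or_ne m n
  · rw [grProj_coe_same 𝒜 ⟨x, hx⟩]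
  · rw [grProj_of_mem_ne 𝒜 hx hmn, Submodule.coe_zero, map_zero, LinearMap.zero_apply,
      hψ m n hmn x hx b hb]

/-- The right annihilator of the kernel of a coalgebra map is closed under multiplication. -/
theorem IsHopfPairing.apply_mul_eq_zero_of_ker {ψ : H →ₗ[K] B →ₗ[K] K} (hψ : IsHopfPairing ψ)
    {Q : Type*} [AddCommGroup Q] [Module K Q] [Coalgebra K Q] (j : H →ₗc[K] Q) {b c : B}
    (hb : ∀ h, j h = 0 → ψ h b = 0) (hc : ∀ h, j h = 0 → ψ h c = 0) (h : H) (hh : j h = 0) :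
    ψ h (b * c) = 0 := by
  -- A functional vanishing on the kernel of `j` factors through `j`.
  have fac : ∀ b : B, (∀ h, j h = 0 → ψ h b = 0) →
      ∃ u : Q →ₗ[K] K, u ∘ₗ j.toLinearMap = ψ.flip b := by
    intro b hb
    have : ψ.flip b ∈ (LinearMap.ker j.toLinearMap).dualAnnihilator :=
      (Submodule.mem_dualAnnihilator _).2 fun h hh => hb h hh
    rw [← LinearMap.range_dualMap_eq_dualAnnihilator_ker] at this
    exact this
  obtain ⟨u, hu⟩ := fac b hb
  obtain ⟨v, hv⟩ := fac c hc
  have e : TensorProduct.map j.toLinearMap j.toLinearMap (Coalgebra.comul (R := K) h) =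
      Coalgebra.comul (R := K) (j h) := CoalgHomClass.map_comp_comul_apply j h
  rw [hψ.mul_right, ← hu, ← hv, TensorProduct.map_comp, LinearMap.comp_apply, e, hh, map_zero,
    map_zero, map_zero]

/-- A coalgebra map on `H` whose kernel has no components in degrees `0` and `1` is injective, if
`H` has a left non-degenerate graded Hopf pairing with a graded Hopf algebra that is generated in
degrees `0` and `1`. -/
theorem injective_of_pairing {𝒜 : ℕ → Submodule K H} [GradedAlgebra 𝒜] {ℬ : ℕ → Submodule K B}
    [GradedAlgebra ℬ] (hℬ : GeneratedInDegreesZeroOne ℬ) {ψ : H →ₗ[K] B →ₗ[K] K}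
    (hψ : IsHopfPairing ψ) (hgr : IsGradedPairing 𝒜 ℬ ψ) (hsep : ψ.SeparatingLeft)
    {Q : Type*} [AddCommGroup Q] [Module K Q] [Coalgebra K Q] (j : H →ₗc[K] Q)
    (h0 : ∀ h, j h = 0 → grProj 𝒜 0 h = 0) (h1 : ∀ h, j h = 0 → grProj 𝒜 1 h = 0) :
    Function.Injective j := by
  have main : ∀ b : B, ∀ h, j h = 0 → ψ h b = 0 := by
    intro b
    have hb : b ∈ Algebra.adjoin K ((ℬ 0 : Set B) ∪ (ℬ 1 : Set B)) := hℬ ▸ Algebra.mem_top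
    induction hb using Algebra.adjoin_induction with
    | mem b hb =>
      intro h hh
      rcases hb with hb | hb
      · rw [hgr.apply_eq_grProj hb, h0 h hh, Submodule.coe_zero, map_zero, LinearMap.zero_apply]
      · rw [hgr.apply_eq_grProj hb, h1 h hh, Submodule.coe_zero, map_zero, LinearMap.zero_apply]
    | algebraMap r =>
      intro h hh
      rw [Algebra.algebraMap_eq_smul_one, map_smul, hψ.one_right,
        ← CoalgHomClass.counit_comp_apply j h, hh, map_zero, smul_zero]
    | add b c _ _ hb hc => intro h hh; rw [map_add, hb h hh, hc h hh, add_zero]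
    | mul b c _ _ hb hc => exact hψ.apply_mul_eq_zero_of_ker j hb hc
  exact (injective_iff_map_eq_zero j).2 fun h hh => hsep h fun b => main b h hh

theorem toQSym_injective {𝒜 : ℕ → Submodule K H} [GradedAlgebra 𝒜] [GradedHopf 𝒜]
    {ℬ : ℕ → Submodule K B} [GradedAlgebra ℬ] (h𝒜 : GeneratedInDegreesZeroOne 𝒜)
    (hℬ : GeneratedInDegreesZeroOne ℬ) {ψ : H →ₗ[K] B →ₗ[K] K} (hψ : IsHopfPairing ψ)
    (hgr : IsGradedPairing 𝒜 ℬ ψ) (hsep : ψ.SeparatingLeft) :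
    Function.Injective (toQSym h𝒜) := by
  have hinj : Function.Injective (toCot 𝒜) := by
    refine injective_of_pairing hℬ hψ hgr hsep (toCot 𝒜) (fun h hh => ?_) (fun h hh => ?_)
    · apply Subtype.ext
      rw [← in0_pr0_eq, ← cotFst_toCot, hh, map_zero, map_zero, Submodule.coe_zero]
    · rw [← cotProj_toCot, hh, map_zero]
  intro x y hxy
  apply hinj
  rw [← qsymVal_toQSym h𝒜, ← qsymVal_toQSym h𝒜, hxy]

end Pairing

end QuantumSymm

end

theorem theorem3p2 {K H B : Type*} [Field K] [Ring H] [HopfAlgebra K H] [Ring B] [HopfAlgebra K B]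
    (𝒜 : ℕ → Submodule K H) [GradedAlgebra 𝒜] [QuantumSymm.GradedHopf 𝒜]
    (ℬ : ℕ → Submodule K B) [GradedAlgebra ℬ] [QuantumSymm.GradedHopf ℬ]
    (h𝒜 : QuantumSymm.GeneratedInDegreesZeroOne 𝒜)
    (hℬ : QuantumSymm.GeneratedInDegreesZeroOne ℬ)
    (hψ : ∃ ψ : H →ₗ[K] B →ₗ[K] K, QuantumSymm.IsHopfPairing ψ ∧
      QuantumSymm.IsGradedPairing 𝒜 ℬ ψ ∧ ψ.SeparatingLeft ∧ ψ.SeparatingRight) :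
    (∃ jH : H →ₐc[K] QuantumSymm.AssocQSym 𝒜,
      QuantumSymm.IsCanonicalMap 𝒜 jH ∧
      (∀ j : H →ₐc[K] QuantumSymm.AssocQSym 𝒜, QuantumSymm.IsCanonicalMap 𝒜 j → j = jH) ∧
      Function.Bijective jH) ∧
    (∃ jB : B →ₐc[K] QuantumSymm.AssocQSym ℬ,
      QuantumSymm.IsCanonicalMap ℬ jB ∧
      (∀ j : B →ₐc[K] QuantumSymm.AssocQSym ℬ, QuantumSymm.IsCanonicalMap ℬ j → j = jB) ∧
      Function.Bijective jB) := by
  obtain ⟨ψ, hψ, hgr, hleft, hright⟩ := hψ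
  refine ⟨⟨QuantumSymm.toQSym h𝒜, QuantumSymm.isCanonicalMap_toQSym h𝒜,
    fun j hj => hj.eq h𝒜 (QuantumSymm.isCanonicalMap_toQSym h𝒜),
    QuantumSymm.toQSym_injective h𝒜 hℬ hψ hgr hleft, QuantumSymm.toQSym_surjective h𝒜⟩,
    ⟨QuantumSymm.toQSym hℬ, QuantumSymm.isCanonicalMap_toQSym hℬ,
    fun j hj => hj.eq hℬ (QuantumSymm.isCanonicalMap_toQSym hℬ),
    QuantumSymm.toQSym_injective hℬ h𝒜 hψ.flip hgr.flip ?_, QuantumSymm.toQSym_surjective hℬ⟩⟩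
  exact hright
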